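/- **Setting.** Let $E$ be a finite set, let $|\cdot|$ be the $\ell_1$-norm on $\mathbb R^d$, and write $x_t^-=(x_t,x_{t-1},\dots)$. For probability vectors on $E$ let $d_{TV}(\nu,\nu')=\frac12\sum_{w\in E}|\nu(w)-\nu'(w)|$. *Covariates.* Let $(S_t)_{t\in\mathbb Z}$ be a stationary Markov chain with values in a Polish space $\mathcal S$ and invariant law $\pi$, let $P(s,\cdot)$ be the law of $(S_t)_{t\ge1}$ given $S_0=s$, let $g:\mathcal S\to\mathbb R^d$ be measurable, and suppose that $X_t=g(S_t)$ is stationary and ergodic with $\mathbb E\log^+|X_1|<\infty$. For a metric $\gamma$ on $\mathbb R^d$ we say that *(C) holds for $\gamma$ with rates $(a_t)_{t\ge1}$* if there is a probability kernel $\widetilde P$ from $\mathcal S^2$ to $\mathcal S^{\mathbb N^*}\times\mathcal S^{\mathbb N^*}$ such that $\widetilde P((s,\bar s),\cdot)$ is a coupling of $P(s,\cdot)$ and $P(\bar s,\cdot)$ for all $s,\bar s$, and $$a_t=\int\!\!\int \pi(ds)\,\pi(d\bar s)\int \gamma\big(g(s_t),g(\bar s_t)\big)\,\widetilde P\big((s,\bar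 s),(ds_1^+,d\bar s_1^+)\big)\longrightarrow0\qquad(t\to\infty).$$ *Model.* Let $G_{y,x}:\mathbb R^k\to\mathbb R^k$, $(y,x)\in E\times\mathbb R^d$, satisfy, for a norm on $\mathbb R^k$ also written $|\cdot|$: (i) $|G_{y,x}(z)-G_{y',x'}(z')|\le L(\mathbf 1_{y\ne y'}+|x-x'|+|z-z'|)$ for some $L\ge1$; (ii) there are $r\ge1$ and $\vartheta\in(0,1)$ such that every composition $G_{y_1,x_1}\circ\cdots\circ G_{y_r,x_r}$ is $\vartheta$-Lipschitz. Let $z\mapsto\check q(\cdot\mid z)$ be a family of probability vectors on $E$ that is Lipschitz in $z\in\mathbb R^k$ for $d_{TV}$. Let $(Y_t)_{t\in\mathbb Z}$ be an $E$-valued process and $(\lambda_t)_{t\in\mathbb Z}$ a stationary $\mathbb R^k$-valued process with $$\lambda_t=G_{Y_{t-1},X_t}(\lambda_{t-1})\ \text{a.s.},\qquad \mathbb P\big(Y_t=w\mid Y_{t-1}^-,X\big)=\check q(w\mid\lambda_t)\ \text{a.s.},\qquad t\in\mathbb Z,\ w\in E .$$ Put $q(\cdot\mid y,x)=\check q(\cdot\mid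 H(y,x))$, where $H(y,x)=\lim_n G_{y_0,x_0}\circ\cdots\circ G_{y_n,x_n}(0)$, and assume that there is a measurable set $\mathcal D$ of paths with $\mathbb P(X\in\mathcal D)=1$ and $$b_0=\sup\big\{d_{TV}\big(q(\cdot\mid y,x_t^-),q(\cdot\mid y',x_t^-)\big):\ y,y'\in E^{\mathbb N},\ x\in\mathcal D,\ t\in\mathbb Z\big\}<1 .$$ *Coefficients.* Let $V_t=(Y_t,X_t)$, $\mathcal F_0=\sigma(V_j:j\le0)$ and $$\beta_V(n)=\mathbb E\Big[\sup_A\big|\mathbb P((V_n,V_{n+1},\dots)\in A\mid\mathcal F_0)-\mathbb P((V_n,V_{n+1},\dots)\in A)\big|\Big].$$ With $\mathcal W_{1,\ell}(\mu,\nu)=\sup_f(\int f\,d\mu-\int f\,d\nu)$, the supremum being over all $f$ that are $1$-Lipschitz on $(E\times\mathbb R^d)^\ell$ for the distance $\sum_{i\le\ell}(\mathbf 1_{y_i\neq y_i'}+|x_i-x_i'|)$, let $$\tau_V(n)=\sup_{\ell\ge1}\ \frac1\ell\ \sup_{n\le j_1<\dots<j_\ell}\mathbb E\,\mathcal W_{1,\ell}\big(\mathbb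 P_{(V_{j_1},\dots,V_{j_\ell})\mid\mathcal F_0},\mathbb P_{(V_{j_1},\dots,V_{j_\ell})}\big).$$ **Claim.** 1. Suppose that (C) holds for the discrete metric with rates $(a_t)$, and that $X_0\in\mathbb L^p$ where $p,q\in[1,\infty]$ and $p^{-1}+q^{-1}=1$. If $a_i=O(i^{-\kappa})$ with $\kappa>q$, then $\beta_V(n)=O(n^{-\kappa/q+1})$, and $V$ is absolutely regular, i.e. $\beta_V(n)\to0$. If $a_i=O(\rho^i)$ with $\rho\in(0,1)$, then $\beta_V(n)=O(\bar\rho^{\,n})$ for some $\bar\rho\in(0,1)$. 2. Suppose that (C) holds for the $\ell_1$-metric with rates $(a_t)$, and that $\mathbb E|X_0|<\infty$. If $a_i=O(i^{-\kappa})$ with $\kappa>1$, then $\tau_V(n)=O(n^{-\kappa})$. If $a_i=O(\rho^i)$ with $\rho\in(0,1)$, then $\tau_V(n)=O(\bar\rho^{\,n})$ for some $\bar\rho\in(0,1)$. If moreover $\mathbb P(Y_t=w\mid Y_{t-1}^-,S)=\check q(w\mid\lambda_t)$ a.s. for all $t,w$, the same holds when $\mathcal F_0$ is replaced by $\sigma((Y_j,S_j):j\le0)$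 in the definition of $\tau_V$. -/

import Mathlib

open MeasureTheory ProbabilityTheory Filter
open scoped ENNReal NNReal Topology

noncomputable section

namespace ObsDriven

/-- `ℝ^d` with the `ℓ¹` norm. -/
abbrev Vec (d : ℕ) : Type := PiLp 1 (fun _ : Fin d => ℝ)

/-- `u n = O(v n)` for an extended nonnegative sequence `u`. -/
def IsBigORate (u : ℕ → ℝ≥0∞) (v : ℕ → ℝ) : Prop :=
  ∃ C : ℝ≥0, ∀ᶠ n in atTop, u n ≤ C * ENNReal.ofReal (v n)

/-- The past `x_t^- = (x_t, x_{t-1}, …)` of a two-sided sequence. -/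
def pastSeq {α : Type*} (x : ℤ → α) (t : ℤ) : ℕ → α := fun j => x (t - j)

/-- The path of a process. -/
def path {Ω α : Type*} (Z : ℤ → Ω → α) (ω : Ω) : ℤ → α := fun t => Z t ω

/-- The shift on two-sided sequences. -/
def shift {α : Type*} (x : ℤ → α) : ℤ → α := fun t => x (t + 1)

/-- A process is stationary if the law of its path is invariant under the shift. -/
def IsStationary {Ω α : Type*} [MeasurableSpace Ω] [MeasurableSpace α]
    (Z : ℤ → Ω → α) (μ : Measure Ω) : Prop :=
  MeasurePreserving shift (μ.map (path Z)) (μ.map (path Z))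

/-- A process is stationary and ergodic if the shift is ergodic (in particular measure
preserving) for the law of its path. -/
def IsStationaryErgodic {Ω α : Type*} [MeasurableSpace Ω] [MeasurableSpace α]
    (Z : ℤ → Ω → α) (μ : Measure Ω) : Prop :=
  Ergodic shift (μ.map (path Z))

/-! ### The covariate process -/

/-- `S` is a time-homogeneous Markov chain and `P s` is the law of `(S_1, S_2, …)` given
`S_0 = s`: for every `t`, the conditional law of the future `(S_{t+1}, S_{t+2}, …)` given the past
`(S_t, S_{t-1}, …)` is `P S_t`. One-sided paths are indexed by `ℕ`, entry `i` being time `i + 1`. -/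
def IsMarkovChain {Ω 𝒮 : Type*} [MeasurableSpace Ω] [MeasurableSpace 𝒮]
    (S : ℤ → Ω → 𝒮) (P : Kernel 𝒮 (ℕ → 𝒮)) (μ : Measure Ω) : Prop :=
  ∀ t : ℤ,
    μ.map (fun ω => (pastSeq (path S ω) t, fun i : ℕ => S (t + 1 + i) ω)) =
      (μ.map (fun ω => pastSeq (path S ω) t)) ⊗ₘ
        (P.comap (fun s : ℕ → 𝒮 => s 0) (measurable_pi_apply 0))

/-- `Pt (s, s')` is a coupling of `P s` and `P s'` for all `s, s'`. -/
def IsPathCoupling {𝒮 : Type*} [MeasurableSpace 𝒮] (P : Kernel 𝒮 (ℕ → 𝒮))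
    (Pt : Kernel (𝒮 × 𝒮) ((ℕ → 𝒮) × (ℕ → 𝒮))) : Prop :=
  ∀ s : 𝒮 × 𝒮, (Pt s).map Prod.fst = P s.1 ∧ (Pt s).map Prod.snd = P s.2

/-- The discrete metric. -/
def discreteCost {α : Type*} (x x' : α) : ℝ≥0∞ := by
  classical exact if x = x' then 0 else 1

/-- The metric induced by the norm. -/
def normCost {d : ℕ} (x x' : Vec d) : ℝ≥0∞ := ENNReal.ofReal ‖x - x'‖

/-- The coupling rate `a_t`, `t ≥ 1`: the mean of `γ (g S_{1,t}) (g S_{2,t})` when the two initial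
states are independent with law `π`. (Time `t` is the entry `t - 1`; the value at `t = 0` is
irrelevant.) -/
def couplingRate {𝒮 : Type*} [MeasurableSpace 𝒮] {d : ℕ} (γ : Vec d → Vec d → ℝ≥0∞)
    (g : 𝒮 → Vec d) (π : Measure 𝒮) (Pt : Kernel (𝒮 × 𝒮) ((ℕ → 𝒮) × (ℕ → 𝒮))) (t : ℕ) : ℝ≥0∞ :=
  ∫⁻ s, ∫⁻ p, γ (g (p.1 (t - 1))) (g (p.2 (t - 1))) ∂(Pt s) ∂(π.prod π)

/-! ### Observation-driven models -/

/-- Total variation distance of two probability vectors on a finite set. -/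
def dTV {E : Type*} [Fintype E] (ν ν' : E → ℝ) : ℝ := (1 / 2) * ∑ w, |ν w - ν' w|

/-- `G_{y_0,x_0} ∘ ⋯ ∘ G_{y_{n-1},x_{n-1}}`. -/
def backIter {E 𝕏 Λ : Type*} (G : E → 𝕏 → Λ → Λ) (y : ℕ → E) (x : ℕ → 𝕏) : ℕ → Λ → Λ
  | 0 => id
  | n + 1 => backIter G y x n ∘ G (y n) (x n)

/-- The latent value `H(y, x) = lim_n G_{y_0,x_0} ∘ ⋯ ∘ G_{y_n,x_n} (0)` produced by an infinite
past `y = y_{t-1}^-` of responses and `x = x_t^-` of covariates. -/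
def latent {E 𝕏 Λ : Type*} [TopologicalSpace Λ] [Zero Λ]
    (G : E → 𝕏 → Λ → Λ) (y : ℕ → E) (x : ℕ → 𝕏) : Λ :=
  limUnder atTop (fun n => backIter G y x (n + 1) 0)

/-- The maps `G_{y,x}` are jointly Lipschitz, and some fixed number `r` of compositions
contracts uniformly. -/
def IsContractiveFamily {E Λ : Type*} [DecidableEq E] [NormedAddCommGroup Λ] {d : ℕ}
    (G : E → Vec d → Λ → Λ) : Prop :=
  (∃ L : ℝ, 1 ≤ L ∧ ∀ (y y' : E) (x x' : Vec d) (z z' : Λ),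
    ‖G y x z - G y' x' z'‖ ≤ L * ((if y = y' then 0 else 1) + ‖x - x'‖ + ‖z - z'‖)) ∧
  (∃ r : ℕ, 0 < r ∧ ∃ ϑ : ℝ, 0 < ϑ ∧ ϑ < 1 ∧ ∀ (y : ℕ → E) (x : ℕ → Vec d) (z z' : Λ),
    ‖backIter G y x r z - backIter G y x r z'‖ ≤ ϑ * ‖z - z'‖)

/-- `z ↦ q(· | z)` is a Lipschitz family of probability vectors on `E`. -/
def IsLipschitzKernel {E Λ : Type*} [Fintype E] [NormedAddCommGroup Λ] (q : Λ → E → ℝ) : Prop :=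
  (∀ z w, 0 ≤ q z w) ∧ (∀ z, ∑ w, q z w = 1) ∧
    ∃ K : ℝ, ∀ z z', dTV (q z) (q z') ≤ K * ‖z - z'‖

/-- `b_0 < 1`: on a measurable set `D` of covariate paths of probability one, the total variation
distances between `q(· | y, x_t^-)` and `q(· | y', x_t^-)`, for arbitrary pasts `y, y'` of the
responses, are bounded away from one, where `q(· | y, x) = q(· | H(y, x))`. -/
def HasUniformOverlap {Ω E Λ : Type*} [MeasurableSpace Ω] [Fintype E] [TopologicalSpace Λ] [Zero Λ]
    {d : ℕ} (q : Λ → E → ℝ) (G : E → Vec d → Λ → Λ) (X : ℤ → Ω → Vec d) (μ : Measure Ω) : Prop :=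
  ∃ D : Set (ℤ → Vec d), MeasurableSet D ∧ (∀ᵐ ω ∂μ, path X ω ∈ D) ∧
    ∃ c : ℝ, c < 1 ∧ ∀ x ∈ D, ∀ (t : ℤ) (y y' : ℕ → E),
      dTV (q (latent G y (pastSeq x t))) (q (latent G y' (pastSeq x t))) ≤ c

/-- The σ-field generated by `(Y_{t-1}, Y_{t-2}, …)` and the whole process `Z`. -/
abbrev exogField {Ω E α : Type*} [MeasurableSpace E] [MeasurableSpace α]
    (Y : ℤ → Ω → E) (Z : ℤ → Ω → α) (t : ℤ) : MeasurableSpace Ω :=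
  MeasurableSpace.comap (fun ω => (pastSeq (path Y ω) (t - 1), path Z ω)) inferInstance

/-- `ℙ(Y_t = w | Y_{t-1}^-, Z) = q(w | λ_t)` almost surely, for all `t` and `w`. -/
def HasConditionalLaw {Ω E Λ α : Type*} [MeasurableSpace Ω] [MeasurableSpace E]
    [MeasurableSpace α] (q : Λ → E → ℝ) (lam : ℤ → Ω → Λ) (Y : ℤ → Ω → E) (Z : ℤ → Ω → α)
    (μ : Measure Ω) : Prop :=
  ∀ (t : ℤ) (w : E),
    μ[Set.indicator {ω | Y t ω = w} (fun _ => (1 : ℝ)) | exogField Y Z t] =ᵐ[μ]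
      fun ω => q (lam t ω) w

/-! ### Dependence coefficients

The σ-field `ℱ_0` is generated by a random element `ξ`, and conditional laws given `ℱ_0` are
regular conditional distributions given `ξ`. -/

/-- The coefficient of absolute regularity
`β_V(n) = 𝔼 sup_A |ℙ((V_n, V_{n+1}, …) ∈ A | V_0, V_{-1}, …) - ℙ((V_n, V_{n+1}, …) ∈ A)|`. -/
def betaCoeff {Ω T : Type*} [MeasurableSpace Ω] [MeasurableSpace T] [StandardBorelSpace T]
    [Nonempty T] (V : ℤ → Ω → T) (μ : Measure Ω) [IsFiniteMeasure μ] (n : ℕ) : ℝ≥0∞ :=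
  let fut : Ω → ℕ → T := fun ω i => V (n + i) ω
  let past : Ω → ℕ → T := fun ω => pastSeq (path V ω) 0
  ∫⁻ ω, ⨆ (A : Set (ℕ → T)) (_ : MeasurableSet A),
    ENNReal.ofReal |(condDistrib fut past μ (past ω)).real A - (μ.map fut).real A| ∂μ

/-- The distance `𝟙_{y ≠ y'} + |x - x'|` on `E × ℝ^d`. -/
def pairDist {E : Type*} [DecidableEq E] {d : ℕ} (v v' : E × Vec d) : ℝ :=
  (if v.1 = v'.1 then 0 else 1) + ‖v.2 - v'.2‖

/-- The Wasserstein distance of order one on `(E × ℝ^d)^ℓ`, as a supremum over the functions that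
are `1`-Lipschitz for the sum of the distances of the entries. -/
def wasserstein {E : Type*} [DecidableEq E] [MeasurableSpace E] {d ℓ : ℕ}
    (ν ν' : Measure (Fin ℓ → E × Vec d)) : ℝ≥0∞ :=
  ⨆ (f : (Fin ℓ → E × Vec d) → ℝ) (_ : ∀ w w', |f w - f w'| ≤ ∑ i, pairDist (w i) (w' i)),
    ENNReal.ofReal (∫ w, f w ∂ν - ∫ w, f w ∂ν')

/-- `τ(ℱ_0, U_J) = 𝔼 W(ℙ_{U_J | ℱ_0}, ℙ_{U_J})` with `U_J = (V_{j_1}, …, V_{j_ℓ})` and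
`ℱ_0 = σ(ξ)`. -/
def tauBlock {Ω E T : Type*} [MeasurableSpace Ω] [Fintype E] [Nonempty E] [DecidableEq E]
    [MeasurableSpace E] [DiscreteMeasurableSpace E] [MeasurableSpace T] {d ℓ : ℕ}
    (V : ℤ → Ω → E × Vec d) (ξ : Ω → T) (μ : Measure Ω) [IsFiniteMeasure μ]
    (J : Fin ℓ → ℤ) : ℝ≥0∞ :=
  let U : Ω → Fin ℓ → E × Vec d := fun ω i => V (J i) ω
  ∫⁻ ω, wasserstein (condDistrib U ξ μ (ξ ω)) (μ.map U) ∂μ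

/-- `τ^{(k)}(n) = max_{1 ≤ ℓ ≤ k} ℓ⁻¹ sup {τ(ℱ_0, U_J) : n ≤ j_1 < ⋯ < j_ℓ}`. -/
def tauUpTo {Ω E T : Type*} [MeasurableSpace Ω] [Fintype E] [Nonempty E] [DecidableEq E]
    [MeasurableSpace E] [DiscreteMeasurableSpace E] [MeasurableSpace T] {d : ℕ}
    (V : ℤ → Ω → E × Vec d) (ξ : Ω → T) (μ : Measure Ω) [IsFiniteMeasure μ]
    (k n : ℕ) : ℝ≥0∞ :=
  ⨆ ℓ ∈ Finset.Icc 1 k, (ℓ : ℝ≥0∞)⁻¹ *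
    ⨆ (J : Fin ℓ → ℤ) (_ : StrictMono J) (_ : ∀ i, (n : ℤ) ≤ J i), tauBlock V ξ μ J

/-- `τ_V(n) = sup_{k ≥ 1} τ^{(k)}(n)`. -/
def tauCoeff {Ω E T : Type*} [MeasurableSpace Ω] [Fintype E] [Nonempty E] [DecidableEq E]
    [MeasurableSpace E] [DiscreteMeasurableSpace E] [MeasurableSpace T] {d : ℕ}
    (V : ℤ → Ω → E × Vec d) (ξ : Ω → T) (μ : Measure Ω) [IsFiniteMeasure μ]
    (n : ℕ) : ℝ≥0∞ :=
  ⨆ (k : ℕ) (_ : 1 ≤ k), tauUpTo V ξ μ k n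

end ObsDriven

end

set_option linter.unusedSectionVars false

/-! Given the whole covariate path, the responses form a chain with infinite memory: the law of
`Y_t` after the history `y` is `q(· | H(y, x_t^-))`. Since the latent maps contract, two histories
that agree on their last `m` values have transitions at total variation distance at most `min c (C θ
^ m)` with `c < 1`. Under a maximal coupling at each step, the length of agreement grows by one with
probability at least `1 - min c (C θ ^ m)` and otherwise drops to `0`. Some function `f` of this
length with `f 0 = 1` contracts in mean by a factor `ρ < 1` (`exists_lyapunov`), so a disagreement
at time `s` has probability at most `ρ ^ s`. If the covariate paths differ too, each step has an
additional error `δ`, at most a `θ`-weighted sum of the differences of the covariates, and the bound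
becomes the solution `accum` of `u_{s+1} = ρ u_s + δ_s` (`evol_sub_le`). No coupled chain is
constructed: expectations are computed by the backward recursion `evol`, and the coupling acts on
test functions.

To apply this to `V`, the conditional law given the past must be identified. Past responses tell
nothing about future covariates beyond what past covariates tell (`Forgetting.map_pastPair_futSeq`):
restarting the chain from a fixed history at a remote time `-N` changes little, and the restarted
chain uses covariates up to time `0` only. Hence, given the past, the covariates are continued by
their own conditional law and the chain is run along them (`Forgetting.condDistrib_block`). The
unconditional law is the average over an independent copy of the past. So the coupling of (C) bounds
the difference of the two laws by the mean of a sum of costs, one for each time: the cost of the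
covariates plus `accum` (`Forgetting.integral_condLaw_sub_le`). For `τ` the costs of a block are
averaged; for `β` they are summed over all times from `n` on, which costs one power of `n` in the
polynomial case.

For the rates, the errors and then `accum` are convolutions of the mean distances of the covariates
with geometric sequences, and this does not change a slower rate (`IsBigORate.of_recursion`). For
`τ` the mean distances are the `a_t` themselves. For `β`, Hölder's inequality bounds them by a
multiple of `a_t ^ (1 / q)`. In the geometric case `q = ∞` is allowed and Hölder's inequality may
give no decay; there the errors, which never exceed one, are bounded by sums of square roots, and
the Cauchy–Schwarz inequality gives the order `a_t ^ (1 / 2)`. Conditioning on the states of the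
chain is the same argument with `S` in place of `X` as the exogenous process. -/

noncomputable section

namespace ObsDriven

/-! ### A Lyapunov function for the length of agreement -/

/-- The length of agreement moves from `m` to `m + 1` with probability `1 - d` and to `0`, where `f
= 1`, with probability `d`. For large `m` a reset is so rare that a geometric decay of `f` absorbs
it. For the finitely many small `m` only `d ≤ c < 1` is available, and there `f` lies slightly below
one, with a deficit that solves the recursion for the bound `c`. -/
lemma exists_lyapunov {c C θ : ℝ} (hc0 : 0 ≤ c) (hc1 : c < 1) (hC : 0 ≤ C) (hθ0 : 0 < θ)
    (hθ1 : θ < 1) :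
    ∃ ρ : ℝ, 0 < ρ ∧ ρ < 1 ∧ ∃ f : ℕ → ℝ, f 0 = 1 ∧ (∀ m, 0 ≤ f m ∧ f m ≤ 1) ∧
      ∀ m d, d ≤ c → d ≤ C * θ ^ m → (1 - d) * f (m + 1) + d ≤ ρ * f m := by
  set r := √θ with hr
  have hr0 : 0 < r := Real.sqrt_pos.2 hθ0
  have hr1 : r < 1 := by rw [hr, Real.sqrt_lt' one_pos]; simpa using hθ1
  have hrr : r * r = θ := Real.mul_self_sqrt hθ0.le
  -- From `m₀` on, the reset probability takes at most half of the gap between the decay `r = √θ` of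
  -- `f` and one; the factor `2` offsets the lower bound `1 / 2` for `f m₀`.
  obtain ⟨m₀, hm₀⟩ : ∃ m₀ : ℕ, 2 * C * θ ^ m₀ ≤ (1 - r) / 2 := by
    have h : Tendsto (fun m : ℕ => 2 * C * θ ^ m) atTop (𝓝 (2 * C * 0)) :=
      (tendsto_pow_atTop_nhds_zero_of_lt_one hθ0.le hθ1).const_mul _
    rw [mul_zero] at h
    exact (h.eventually_le_const (by linarith)).exists
  -- `g` is the deficit `1 - f` on the first `m₀` values, per unit of `1 - ρ`
  set k := (1 - c)⁻¹ with hk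
  have hk1 : 1 ≤ k := (one_le_inv₀ (by linarith)).2 (by linarith)
  let g : ℕ → ℝ := fun m => ∑ j ∈ Finset.range m, k ^ (j + 1)
  have hg0 : g 0 = 0 := by simp [g]
  have hgs : ∀ m, (1 - c) * g (m + 1) = 1 + g m := by
    intro m
    simp only [g, Finset.sum_range_succ' _ m, Finset.mul_sum, mul_add]
    have hck : (1 - c) * k = 1 := by rw [hk]; exact mul_inv_cancel₀ (by linarith)
    have : ∀ j, (1 - c) * k ^ (j + 1 + 1) = k ^ (j + 1) := fun j => by
      rw [pow_succ k (j + 1), mul_comm (k ^ (j + 1)), ← mul_assoc, hck, one_mul]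
    simp only [this]
    rw [zero_add, pow_one, hck, add_comm]
  have hgnn : ∀ m, 0 ≤ g m := fun m => Finset.sum_nonneg fun j _ => by positivity
  have hgmono : Monotone g := by
    refine monotone_nat_of_le_succ fun m => ?_
    simp only [g, Finset.sum_range_succ]
    have : (0 : ℝ) ≤ k ^ (m + 1) := by positivity
    linarith
  -- `1 - ε` is the contraction rate. The first bound suits the geometric regime, the second keeps
  -- `f` above `1 / 2` up to `m₀`.
  obtain ⟨ε, hε0, hε1, hε2⟩ : ∃ ε : ℝ, 0 < ε ∧ ε ≤ (1 - r) / 2 ∧ ε * g m₀ ≤ 1 / 2 := by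
    refine ⟨min ((1 - r) / 2) (1 / 2 / (g m₀ + 1)), ?_, min_le_left _ _, ?_⟩
    · have := hgnn m₀
      exact lt_min (by linarith) (by positivity)
    · have h1 := hgnn m₀
      calc min ((1 - r) / 2) (1 / 2 / (g m₀ + 1)) * g m₀ ≤ 1 / 2 / (g m₀ + 1) * (g m₀ + 1) :=
            mul_le_mul (min_le_right _ _) (by linarith) h1 (by positivity)
        _ = 1 / 2 := by field_simp
  have hρr : r + (1 - r) / 2 ≤ 1 - ε := by linarith
  let f : ℕ → ℝ := fun m => if m ≤ m₀ then 1 - ε * g m else (1 - ε * g m₀) * r ^ (m - m₀)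
  have hf01 : ∀ m, 0 ≤ f m ∧ f m ≤ 1 := by
    intro m
    simp only [f]
    split_ifs with h
    · have h1 : ε * g m ≤ ε * g m₀ := mul_le_mul_of_nonneg_left (hgmono h) hε0.le
      have h2 := mul_nonneg hε0.le (hgnn m)
      constructor <;> linarith
    · have h2 := mul_nonneg hε0.le (hgnn m₀)
      have h3 : r ^ (m - m₀) ≤ 1 := pow_le_one₀ hr0.le hr1.le
      have h4 : 0 ≤ r ^ (m - m₀) := by positivity
      constructor
      · exact mul_nonneg (by linarith) h4
      · nlinarith
  refine ⟨1 - ε, by linarith, by linarith, f, by simp [f, hg0], hf01, ?_⟩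
  intro m d hdc hdC
  -- Since `f ≤ 1`, the left side increases with `d`, so `d` may be replaced by either of its upper
  -- bounds.
  have hstep : ∀ b, d ≤ b → (1 - d) * f (m + 1) + d ≤ (1 - b) * f (m + 1) + b := by
    intro b hb
    nlinarith [(hf01 (m + 1)).2]
  by_cases hm : m + 1 ≤ m₀
  · refine (hstep c hdc).trans ?_
    simp only [f, hm, if_true, (Nat.le_of_succ_le hm)]
    have h1 := hgs m
    have h2 := mul_nonneg hε0.le (hgnn m)
    nlinarith [mul_nonneg hε0.le h2]
  · have hm' : m₀ ≤ m := by omega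
    have hfm : f m = (1 - ε * g m₀) * r ^ (m - m₀) := by
      simp only [f]
      split_ifs with h
      · have : m = m₀ := le_antisymm h hm'
        simp [this]
      · rfl
    have hfm1 : f (m + 1) = (1 - ε * g m₀) * r ^ (m - m₀) * r := by
      have : m + 1 - m₀ = (m - m₀) + 1 := by omega
      simp only [f, hm, if_false, this, pow_succ, mul_assoc]
    refine (hstep (C * θ ^ m) hdC).trans ?_
    have hb0 : 0 ≤ C * θ ^ m := by positivity
    have h1 : C * θ ^ m ≤ (1 - r) / 2 * f m := by
      obtain ⟨j, rfl⟩ := Nat.exists_eq_add_of_le hm'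
      rw [hfm, Nat.add_sub_cancel_left, pow_add]
      have h2 : θ ^ j ≤ r ^ j := pow_le_pow_left₀ hθ0.le (by nlinarith) j
      have h3 : (0 : ℝ) ≤ r ^ j := by positivity
      have h4 : 0 ≤ C * θ ^ m₀ := by positivity
      calc C * (θ ^ m₀ * θ ^ j) = C * θ ^ m₀ * θ ^ j := by ring
        _ ≤ C * θ ^ m₀ * r ^ j := mul_le_mul_of_nonneg_left h2 h4
        _ ≤ (1 - r) / 2 * (1 / 2) * r ^ j := mul_le_mul_of_nonneg_right (by linarith) h3
        _ ≤ (1 - r) / 2 * (1 - ε * g m₀) * r ^ j :=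
            mul_le_mul_of_nonneg_right
              (mul_le_mul_of_nonneg_left (by linarith) (by linarith)) h3
        _ = _ := by ring
    have h5 : f (m + 1) = f m * r := by rw [hfm1, hfm]
    have h6 := (hf01 (m + 1)).1
    have h7 := (hf01 m).1
    calc (1 - C * θ ^ m) * f (m + 1) + C * θ ^ m ≤ f (m + 1) + C * θ ^ m := by nlinarith
      _ ≤ f m * r + (1 - r) / 2 * f m := by rw [h5]; linarith
      _ = (r + (1 - r) / 2) * f m := by ring
      _ ≤ (1 - ε) * f m := mul_le_mul_of_nonneg_right hρr h7

/-! ### Histories -/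

section Histories

variable {E : Type*}

/-- Add a most recent value to a history. -/
def consSeq (w : E) (y : ℕ → E) : ℕ → E := fun n => Nat.casesOn n w y

@[simp] lemma consSeq_zero (w : E) (y : ℕ → E) : consSeq w y 0 = w := rfl

@[simp] lemma consSeq_succ (w : E) (y : ℕ → E) (n : ℕ) : consSeq w y (n + 1) = y n := rfl

open Classical in
/-- A function of the length of agreement of two histories. -/
def agreeFun (f : ℕ → ℝ) (y y' : ℕ → E) : ℝ := if y = y' then 0 else f (PiNat.firstDiff y y')

lemma agreeFun_self (f : ℕ → ℝ) (y : ℕ → E) : agreeFun f y y = 0 := by simp [agreeFun]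

lemma firstDiff_eq {y y' : ℕ → E} {m : ℕ} (h : ∀ i < m, y i = y' i) (hm : y m ≠ y' m) :
    PiNat.firstDiff y y' = m := by
  have hne : y ≠ y' := fun he => hm (by rw [he])
  refine le_antisymm ?_ ?_
  · by_contra! hlt
    exact hm (PiNat.apply_eq_of_lt_firstDiff hlt)
  · by_contra! hlt
    exact PiNat.apply_firstDiff_ne hne (h _ hlt)

lemma consSeq_inj {w : E} {y y' : ℕ → E} : consSeq w y = consSeq w y' ↔ y = y' :=
  ⟨fun h => funext fun n => congrFun h (n + 1), fun h => by rw [h]⟩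

/-- With `agreeFun_of_apply_zero_ne` this describes the dynamics of the agreement: a common new
value lengthens it by one, distinct new values reset it. -/
lemma agreeFun_consSeq_self (f : ℕ → ℝ) (w : E) {y y' : ℕ → E} (h : y ≠ y') :
    agreeFun f (consSeq w y) (consSeq w y') = f (PiNat.firstDiff y y' + 1) := by
  rw [agreeFun, if_neg (by rwa [consSeq_inj])]
  congr 1
  refine firstDiff_eq ?_ ?_
  · rintro (_ | i) hi
    · rfl
    · change y i = y' i
      exact PiNat.apply_eq_of_lt_firstDiff (Nat.succ_lt_succ_iff.1 hi)
  · exact PiNat.apply_firstDiff_ne h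

lemma agreeFun_of_apply_zero_ne {f : ℕ → ℝ} {y y' : ℕ → E} (h : y 0 ≠ y' 0) :
    agreeFun f y y' = f 0 := by
  rw [agreeFun, if_neg (fun he => h (by rw [he])), firstDiff_eq (m := 0) (by simp) h]

lemma agreeFun_mem {f : ℕ → ℝ} (hf : ∀ m, 0 ≤ f m ∧ f m ≤ 1) (y y' : ℕ → E) :
    0 ≤ agreeFun f y y' ∧ agreeFun f y y' ≤ 1 := by
  unfold agreeFun
  split_ifs
  · simp
  · exact hf _

/-- The one step bound for the Lyapunov function of the length of agreement. -/
lemma agreeFun_step {f : ℕ → ℝ} {c C θ ρ : ℝ}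
    (hf : ∀ m, 0 ≤ f m ∧ f m ≤ 1)
    (hstep : ∀ m d, d ≤ c → d ≤ C * θ ^ m → (1 - d) * f (m + 1) + d ≤ ρ * f m)
    (w : E) (y y' : ℕ → E) {D δ : ℝ} (hδ : 0 ≤ δ)
    (hD : D ≤ agreeFun (fun m => min c (C * θ ^ m)) y y' + δ) :
    (1 - D) * agreeFun f (consSeq w y) (consSeq w y') + D ≤ ρ * agreeFun f y y' + δ := by
  by_cases h : y = y'
  · subst h
    simp only [agreeFun_self] at hD ⊢
    linarith
  · rw [agreeFun_consSeq_self f w h]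
    rw [agreeFun, if_neg h] at hD ⊢
    set m := PiNat.firstDiff y y'
    -- `(1 - D) f(m + 1) + D` has slope `1 - f(m + 1)` in `D`, which is in `[0, 1]`, so the error
    -- adds at most `δ`.
    have h1 := hstep m (min c (C * θ ^ m)) (min_le_left _ _) (min_le_right _ _)
    have h2 := hf (m + 1)
    nlinarith

end Histories

/-! ### One step of a maximal coupling -/

lemma dTV_nonneg {E : Type*} [Fintype E] (p p' : E → ℝ) : 0 ≤ dTV p p' := by
  unfold dTV; positivity

lemma dTV_le_one {E : Type*} [Fintype E] {p p' : E → ℝ} (hp : ∀ w, 0 ≤ p w)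
    (hp' : ∀ w, 0 ≤ p' w) (hs : ∑ w, p w = 1) (hs' : ∑ w, p' w = 1) : dTV p p' ≤ 1 := by
  have : ∑ w, |p w - p' w| ≤ ∑ w, (p w + p' w) :=
    Finset.sum_le_sum fun w _ => abs_le.2 ⟨by linarith [hp w, hp' w], by linarith [hp w, hp' w]⟩
  rw [Finset.sum_add_distrib, hs, hs'] at this
  unfold dTV; linarith

lemma dTV_triangle {E : Type*} [Fintype E] (p p' p'' : E → ℝ) :
    dTV p p'' ≤ dTV p p' + dTV p' p'' := by
  unfold dTV
  rw [← mul_add, ← Finset.sum_add_distrib]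
  exact mul_le_mul_of_nonneg_left (Finset.sum_le_sum fun w _ => abs_sub_le _ _ _) (by norm_num)

/-- Maximal coupling in dual form. The common mass `min p p'`, of total `1 - dTV p p'`, is put on
the diagonal and costs `A` per unit; the two remainders both have mass `dTV p p'` and cost at most
`B` per unit however they are matched. -/
lemma sum_mul_sub_sum_mul_le {E : Type*} [Fintype E] [Nonempty E] {p p' : E → ℝ}
    (hs : ∑ w, p w = 1) (hs' : ∑ w, p' w = 1) (hp : ∀ w, 0 ≤ p w) (hp' : ∀ w, 0 ≤ p' w)
    {Φ Φ' : E → ℝ} {A B : ℝ} (hdiag : ∀ w, Φ w - Φ' w ≤ A)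
    (hoff : ∀ w w', Φ w - Φ' w' ≤ B) :
    ∑ w, p w * Φ w - ∑ w, p' w * Φ' w ≤ (1 - dTV p p') * A + dTV p p' * B := by
  set m : E → ℝ := fun w => min (p w) (p' w) with hm
  have hm0 : ∀ w, 0 ≤ m w := fun w => le_min (hp w) (hp' w)
  have hmsum : ∑ w, m w = 1 - dTV p p' := by
    have h : ∀ w, m w = (p w + p' w) / 2 - (1 / 2) * |p w - p' w| := fun w => by
      simp only [hm]
      rcases le_total (p w) (p' w) with h | h
      · rw [min_eq_left h, abs_of_nonpos (by linarith)]; ring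
      · rw [min_eq_right h, abs_of_nonneg (by linarith)]; ring
    simp only [h, Finset.sum_sub_distrib, ← Finset.sum_div, Finset.sum_add_distrib, hs, hs',
      dTV, Finset.mul_sum]
    norm_num
  -- The remainders are compared with the extreme values of `Φ` and `Φ'`, so no joint law of them is
  -- needed.
  obtain ⟨w₁, hw₁⟩ := Finite.exists_max Φ
  obtain ⟨w₂, hw₂⟩ := Finite.exists_min Φ'
  have h1 : ∑ w, m w * (Φ w - Φ' w) ≤ (1 - dTV p p') * A := by
    rw [← hmsum, Finset.sum_mul]
    exact Finset.sum_le_sum fun w _ => mul_le_mul_of_nonneg_left (hdiag w) (hm0 w)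
  have h2 : ∑ w, (p w - m w) * Φ w ≤ dTV p p' * Φ w₁ := by
    have : dTV p p' = ∑ w, (p w - m w) := by rw [Finset.sum_sub_distrib, hs, hmsum]; ring
    rw [this, Finset.sum_mul]
    exact Finset.sum_le_sum fun w _ =>
      mul_le_mul_of_nonneg_left (hw₁ w) (sub_nonneg.2 (min_le_left _ _))
  have h3 : dTV p p' * Φ' w₂ ≤ ∑ w, (p' w - m w) * Φ' w := by
    have : dTV p p' = ∑ w, (p' w - m w) := by rw [Finset.sum_sub_distrib, hs', hmsum]; ring
    rw [this, Finset.sum_mul]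
    exact Finset.sum_le_sum fun w _ =>
      mul_le_mul_of_nonneg_left (hw₂ w) (sub_nonneg.2 (min_le_right _ _))
  have h4 : ∑ w, p w * Φ w - ∑ w, p' w * Φ' w = ∑ w, m w * (Φ w - Φ' w)
      + ∑ w, (p w - m w) * Φ w - ∑ w, (p' w - m w) * Φ' w := by
    rw [← Finset.sum_sub_distrib, ← Finset.sum_add_distrib, ← Finset.sum_sub_distrib]
    exact Finset.sum_congr rfl fun w _ => by ring
  have h5 := mul_le_mul_of_nonneg_left (hoff w₁ w₂) (dTV_nonneg p p')
  rw [h4]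
  linarith

/-! ### Expectations along a chain with infinite memory -/

section Evol

variable {E : Type*} [Fintype E]

/-- The expectation of `F (Y_N, Y_{N-1}, …)` when the history at time `0` is given and `p s` is
the law of the value at time `s + 1` given the history at time `s`. -/
def evol (p : ℕ → (ℕ → E) → E → ℝ) : ℕ → ((ℕ → E) → ℝ) → (ℕ → E) → ℝ
  | 0, F => F
  | N + 1, F => evol p N (fun y => ∑ w, p N y w * F (consSeq w y))

/-- The solution of `u_0 = 1`, `u_{s+1} = ρ u_s + δ_s`. -/
def accum (ρ : ℝ) (δ : ℕ → ℝ) : ℕ → ℝ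
  | 0 => 1
  | s + 1 => ρ * accum ρ δ s + δ s

lemma accum_nonneg {ρ : ℝ} (hρ : 0 ≤ ρ) {δ : ℕ → ℝ} (hδ : ∀ s, 0 ≤ δ s) (s : ℕ) :
    0 ≤ accum ρ δ s := by
  induction s with
  | zero => simp [accum]
  | succ s ih => simp only [accum]; have := hδ s; positivity

variable [Nonempty E] [DecidableEq E]

/-- Backward induction on a class of bounds that is stable under one step: a constant, a multiple of
`agreeFun f`, and weights on disagreements at individual times. The newest disagreement is dominated
by `agreeFun f`, since `f 0 = 1`, and joins its coefficient; a maximal coupling of the newest values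
then multiplies this coefficient by `ρ` and adds `δ N` times it to the constant, in accordance with
the recursion of `accum`. -/
lemma evol_sub_le_aux {f : ℕ → ℝ} {c C θ ρ : ℝ} (hf0 : f 0 = 1)
    (hf : ∀ m, 0 ≤ f m ∧ f m ≤ 1)
    (hstep : ∀ m d, d ≤ c → d ≤ C * θ ^ m → (1 - d) * f (m + 1) + d ≤ ρ * f m)
    (hρ : 0 ≤ ρ) {p p' : ℕ → (ℕ → E) → E → ℝ} {δ : ℕ → ℝ} (hδ : ∀ s, 0 ≤ δ s)
    (hp : ∀ s y w, 0 ≤ p s y w) (hs : ∀ s y, ∑ w, p s y w = 1)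
    (hp' : ∀ s y w, 0 ≤ p' s y w) (hs' : ∀ s y, ∑ w, p' s y w = 1)
    (hd : ∀ s y y', dTV (p s y) (p' s y') ≤
      agreeFun (fun m => min c (C * θ ^ m)) y y' + δ s) :
    ∀ (N : ℕ) (F F' : (ℕ → E) → ℝ) (e B : ℝ) (a : ℕ → ℝ), 0 ≤ B → (∀ i, 0 ≤ a i) →
      (∀ y y', F y - F' y' ≤ e + B * agreeFun f y y' +
        ∑ i ∈ Finset.range N, a i * (if y i = y' i then 0 else 1)) →
      ∀ y y', evol p N F y - evol p' N F' y' ≤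
        e + B * accum ρ δ N + ∑ i ∈ Finset.range N, a i * accum ρ δ (N - i) := by
  intro N
  induction N with
  | zero =>
    intro F F' e B a hB ha hF y y'
    have h1 := hF y y'
    have h2 := (agreeFun_mem hf y y').2
    simp only [evol, accum, Finset.range_zero, Finset.sum_empty] at h1 ⊢
    nlinarith
  | succ N ih =>
    intro F F' e B a hB ha hF y y'
    have hB' : 0 ≤ a 0 + B := add_nonneg (ha 0) hB
    have key := ih (fun y => ∑ w, p N y w * F (consSeq w y))
      (fun y => ∑ w, p' N y w * F' (consSeq w y)) (e + (a 0 + B) * δ N) (ρ * (a 0 + B))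
      (fun i => a (i + 1)) (mul_nonneg hρ hB') (fun i => ha _) ?_ y y'
    · refine key.trans (le_of_eq ?_)
      rw [Finset.sum_range_succ' _ N]
      simp only [accum, Nat.add_sub_add_right, Nat.sub_zero]
      ring
    · intro y y'
      set T := ∑ i ∈ Finset.range N, a (i + 1) * (if y i = y' i then 0 else 1)
      have hw : ∀ w w', F (consSeq w y) - F' (consSeq w' y') ≤
          e + T + (a 0 + B) * agreeFun f (consSeq w y) (consSeq w' y') := by
        intro w w'
        refine (hF _ _).trans ?_
        rw [Finset.sum_range_succ' _ N]
        change e + B * agreeFun f (consSeq w y) (consSeq w' y') +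
          (T + a 0 * (if w = w' then 0 else 1)) ≤ _
        have hle : (if w = w' then (0 : ℝ) else 1) ≤
            agreeFun f (consSeq w y) (consSeq w' y') := by
          split_ifs with h
          · exact (agreeFun_mem hf _ _).1
          · rw [agreeFun_of_apply_zero_ne (by simpa using h), hf0]
        have := mul_le_mul_of_nonneg_left hle (ha 0)
        linarith
      -- The agreement after a common new value does not depend on that value, so one value `w₀`
      -- represents the diagonal.
      obtain ⟨w₀⟩ := ‹Nonempty E›
      set W := agreeFun f (consSeq w₀ y) (consSeq w₀ y') with hW
      have hWw : ∀ w, agreeFun f (consSeq w y) (consSeq w y') = W := by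
        intro w
        by_cases h : y = y'
        · subst h; simp [hW, agreeFun_self]
        · rw [hW, agreeFun_consSeq_self f w h, agreeFun_consSeq_self f w₀ h]
      have hstep1 := sum_mul_sub_sum_mul_le (hs N y) (hs' N y') (hp N y) (hp' N y')
        (Φ := fun w => F (consSeq w y)) (Φ' := fun w => F' (consSeq w y'))
        (A := e + T + (a 0 + B) * W) (B := e + T + (a 0 + B))
        (fun w => (hw w w).trans (by rw [hWw]))
        (fun w w' => (hw w w').trans (by
          have := mul_le_mul_of_nonneg_left
            (agreeFun_mem hf (consSeq w y) (consSeq w' y')).2 hB'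
          linarith))
      have hstep2 := agreeFun_step hf hstep w₀ y y' (hδ N) (hd N y y')
      have hstep3 := mul_le_mul_of_nonneg_left hstep2 hB'
      refine hstep1.trans ?_
      rw [← hW] at hstep3
      nlinarith

/-- Comparison of two chains with infinite memory started from arbitrary histories. -/
lemma evol_sub_le {f : ℕ → ℝ} {c C θ ρ : ℝ} (hf0 : f 0 = 1)
    (hf : ∀ m, 0 ≤ f m ∧ f m ≤ 1)
    (hstep : ∀ m d, d ≤ c → d ≤ C * θ ^ m → (1 - d) * f (m + 1) + d ≤ ρ * f m)
    (hρ : 0 ≤ ρ) {p p' : ℕ → (ℕ → E) → E → ℝ} {δ : ℕ → ℝ} (hδ : ∀ s, 0 ≤ δ s)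
    (hp : ∀ s y w, 0 ≤ p s y w) (hs : ∀ s y, ∑ w, p s y w = 1)
    (hp' : ∀ s y w, 0 ≤ p' s y w) (hs' : ∀ s y, ∑ w, p' s y w = 1)
    (hd : ∀ s y y', dTV (p s y) (p' s y') ≤
      agreeFun (fun m => min c (C * θ ^ m)) y y' + δ s)
    (N : ℕ) (F F' : (ℕ → E) → ℝ) (e : ℝ) {ι : Type*} (J : Finset ι) (k : ι → ℕ)
    (hk : ∀ i ∈ J, k i < N)
    (hF : ∀ y y', F y - F' y' ≤ e + ∑ i ∈ J, (if y (k i) = y' (k i) then 0 else 1))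
    (y y' : ℕ → E) :
    evol p N F y - evol p' N F' y' ≤ e + ∑ i ∈ J, accum ρ δ (N - k i) := by
  classical
  -- The weight at position `j` is the number of `i ∈ J` with `k i = j`, so `k` need not be
  -- injective.
  have hsum : ∀ φ : ℕ → ℝ, ∑ j ∈ Finset.range N,
      (∑ i ∈ J, if k i = j then (1 : ℝ) else 0) * φ j = ∑ i ∈ J, φ (k i) := by
    intro φ
    simp only [Finset.sum_mul]
    rw [Finset.sum_comm]
    refine Finset.sum_congr rfl fun i hi => ?_
    rw [Finset.sum_eq_single (k i)]
    · simp
    · intro j _ hj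
      simp [hj.symm]
    · intro h
      exact absurd (Finset.mem_range.2 (hk i hi)) h
  have := evol_sub_le_aux hf0 hf hstep hρ hδ hp hs hp' hs' hd N F F' e 0
    (fun j => ∑ i ∈ J, if k i = j then (1 : ℝ) else 0) le_rfl
    (fun j => Finset.sum_nonneg fun i _ => by split_ifs <;> norm_num)
    (fun y y' => by
      rw [hsum (fun j => if y j = y' j then 0 else 1), zero_mul, add_zero]
      exact hF y y') y y'
  rwa [hsum (fun j => accum ρ δ (N - j)), zero_mul, add_zero] at this

end Evol


/-! ### The latent process -/

section Latent

variable {E : Type*} {d : ℕ} {Λ : Type*}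

lemma backIter_add (G : E → Vec d → Λ → Λ) (y : ℕ → E) (x : ℕ → Vec d) (r n : ℕ) (z : Λ) :
    backIter G y x (r + n) z =
      backIter G y x r (backIter G (fun i => y (r + i)) (fun i => x (r + i)) n z) := by
  induction n generalizing z with
  | zero => rfl
  | succ n ih =>
    rw [← add_assoc]
    simp only [backIter, Function.comp_apply, ih]

variable [DecidableEq E] [NormedAddCommGroup Λ]

/-- Every full group of `r` maps contributes a factor `ϑ`, and the fewer than `r` maps left over at
most `L ^ r`. With `θ = ϑ ^ (1 / r)` the loss at the last incomplete group is the factor `1 / ϑ` in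
the constant. -/
lemma IsContractiveFamily.exists_contraction {G : E → Vec d → Λ → Λ}
    (hG : IsContractiveFamily G) :
    ∃ L C θ : ℝ, 1 ≤ L ∧ 0 ≤ C ∧ 0 < θ ∧ θ < 1 ∧
      (∀ (y y' : E) (x x' : Vec d) (z z' : Λ),
        ‖G y x z - G y' x' z'‖ ≤ L * ((if y = y' then 0 else 1) + ‖x - x'‖ + ‖z - z'‖)) ∧
      ∀ (n : ℕ) (y : ℕ → E) (x : ℕ → Vec d) (z z' : Λ),
        ‖backIter G y x n z - backIter G y x n z'‖ ≤ C * θ ^ n * ‖z - z'‖ := by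
  obtain ⟨⟨L, hL1, hL⟩, r, hr, ϑ, hϑ0, hϑ1, hϑ⟩ := hG
  set θ := ϑ ^ ((r : ℝ)⁻¹) with hθ
  have hθ0 : 0 < θ := Real.rpow_pos_of_pos hϑ0 _
  have hθ1 : θ < 1 := Real.rpow_lt_one hϑ0.le hϑ1 (by positivity)
  have hθr : θ ^ r = ϑ := Real.rpow_inv_natCast_pow hϑ0.le hr.ne'
  have hL0 : 0 ≤ L := by linarith
  have hLip : ∀ (n : ℕ) (y : ℕ → E) (x : ℕ → Vec d) (z z' : Λ),
      ‖backIter G y x n z - backIter G y x n z'‖ ≤ L ^ n * ‖z - z'‖ := by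
    intro n
    induction n with
    | zero => intro y x z z'; simp [backIter]
    | succ n ih =>
      intro y x z z'
      simp only [backIter, Function.comp_apply]
      refine (ih y x _ _).trans ?_
      have := hL (y n) (y n) (x n) (x n) z z'
      simp only [if_true, sub_self, norm_zero, zero_add] at this
      calc L ^ n * ‖G (y n) (x n) z - G (y n) (x n) z'‖ ≤ L ^ n * (L * ‖z - z'‖) :=
            mul_le_mul_of_nonneg_left this (by positivity)
        _ = L ^ (n + 1) * ‖z - z'‖ := by ring
  refine ⟨L, L ^ r / ϑ, θ, hL1, by positivity, hθ0, hθ1, hL, ?_⟩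
  intro n
  induction n using Nat.strong_induction_on with
  | _ n ih =>
    intro y x z z'
    by_cases hn : n < r
    · refine (hLip n y x z z').trans (mul_le_mul_of_nonneg_right ?_ (norm_nonneg _))
      calc L ^ n ≤ L ^ r := pow_le_pow_right₀ hL1 hn.le
        _ = L ^ r / ϑ * θ ^ r := by rw [hθr]; field_simp
        _ ≤ L ^ r / ϑ * θ ^ n :=
            mul_le_mul_of_nonneg_left (pow_le_pow_of_le_one hθ0.le hθ1.le hn.le) (by positivity)
    · obtain ⟨m, rfl⟩ := Nat.exists_eq_add_of_le (not_lt.1 hn)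
      rw [backIter_add, backIter_add]
      refine (hϑ _ _ _ _).trans ?_
      calc _ ≤ ϑ * (L ^ r / ϑ * θ ^ m * ‖z - z'‖) :=
            mul_le_mul_of_nonneg_left (ih m (by omega) _ _ _ _) hϑ0.le
        _ = L ^ r / ϑ * θ ^ (r + m) * ‖z - z'‖ := by rw [pow_add, hθr]; ring

/-- Telescoping: the parameters are exchanged one position at a time. The exchange at position `i`
moves the value by at most `L` times the difference of the parameters, and the `i` maps outside
shrink this by `C θ ^ i`. -/
lemma norm_backIter_sub_le {G : E → Vec d → Λ → Λ} {L C θ : ℝ} (hC : 0 ≤ C) (hθ : 0 ≤ θ)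
    (hL : ∀ (y y' : E) (x x' : Vec d) (z z' : Λ),
      ‖G y x z - G y' x' z'‖ ≤ L * ((if y = y' then 0 else 1) + ‖x - x'‖ + ‖z - z'‖))
    (hG : ∀ (n : ℕ) (y : ℕ → E) (x : ℕ → Vec d) (z z' : Λ),
      ‖backIter G y x n z - backIter G y x n z'‖ ≤ C * θ ^ n * ‖z - z'‖)
    (y y' : ℕ → E) (x x' : ℕ → Vec d) (n : ℕ) (z : Λ) :
    ‖backIter G y x n z - backIter G y' x' n z‖ ≤
      ∑ i ∈ Finset.range n, C * L * (θ ^ i * ((if y i = y' i then 0 else 1) + ‖x i - x' i‖)) := by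
  induction n generalizing z with
  | zero => simp [backIter]
  | succ n ih =>
    rw [Finset.sum_range_succ]
    simp only [backIter, Function.comp_apply]
    have h1 := ih (G (y' n) (x' n) z)
    have h2 := hG n y x (G (y n) (x n) z) (G (y' n) (x' n) z)
    have h3 := hL (y n) (y' n) (x n) (x' n) z z
    rw [sub_self, norm_zero, add_zero] at h3
    have h4 := mul_le_mul_of_nonneg_left h3 (by positivity : 0 ≤ C * θ ^ n)
    have h5 := norm_sub_le_norm_sub_add_norm_sub (backIter G y x n (G (y n) (x n) z))
      (backIter G y x n (G (y' n) (x' n) z)) (backIter G y' x' n (G (y' n) (x' n) z))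
    calc _ ≤ _ := h5
      _ ≤ C * θ ^ n * (L * ((if y n = y' n then 0 else 1) + ‖x n - x' n‖)) +
          ∑ i ∈ Finset.range n,
            C * L * (θ ^ i * ((if y i = y' i then 0 else 1) + ‖x i - x' i‖)) :=
          add_le_add (h2.trans h4) h1
      _ = _ := by ring

/-- The iterations converge when the covariates are summable against `θ ^ i`. -/
lemma tendsto_backIter_latent [Finite E] [CompleteSpace Λ] {G : E → Vec d → Λ → Λ} {L C θ : ℝ}
    (hL0 : 0 ≤ L) (hC : 0 ≤ C) (hθ0 : 0 < θ) (hθ1 : θ < 1)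
    (hL : ∀ (y y' : E) (x x' : Vec d) (z z' : Λ),
      ‖G y x z - G y' x' z'‖ ≤ L * ((if y = y' then 0 else 1) + ‖x - x'‖ + ‖z - z'‖))
    (hG : ∀ (n : ℕ) (y : ℕ → E) (x : ℕ → Vec d) (z z' : Λ),
      ‖backIter G y x n z - backIter G y x n z'‖ ≤ C * θ ^ n * ‖z - z'‖)
    (y : ℕ → E) {x : ℕ → Vec d} (hx : Summable fun i => θ ^ i * ‖x i‖) :
    Tendsto (fun n => backIter G y x n 0) atTop (𝓝 (latent G y x)) := by
  set M := ‖G (y 0) 0 0‖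
  have hM : ∀ n, ‖G (y n) (x n) 0‖ ≤ M + L * (1 + ‖x n‖) := by
    intro n
    have h1 := hL (y n) (y 0) (x n) 0 0 0
    rw [sub_zero, sub_zero, norm_zero, add_zero] at h1
    have h2 : (if y n = y 0 then (0 : ℝ) else 1) ≤ 1 := by split_ifs <;> norm_num
    have h3 : ‖G (y n) (x n) 0‖ ≤ ‖G (y n) (x n) 0 - G (y 0) 0 0‖ + M := norm_le_norm_sub_add _ _
    have h4 : L * ((if y n = y 0 then (0 : ℝ) else 1) + ‖x n‖) ≤ L * (1 + ‖x n‖) :=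
      mul_le_mul_of_nonneg_left (by linarith) hL0
    linarith
  have hsum : Summable fun n => C * ((M + L) * θ ^ n + L * (θ ^ n * ‖x n‖)) :=
    (((summable_geometric_of_lt_one hθ0.le hθ1).mul_left _).add (hx.mul_left L)).mul_left C
  have hcau : CauchySeq (fun n => backIter G y x n 0) := by
    refine cauchySeq_of_dist_le_of_summable _ (fun n => ?_) hsum
    rw [dist_comm, dist_eq_norm]
    simp only [backIter, Function.comp_apply]
    refine (hG n y x _ _).trans ?_
    rw [sub_zero]
    calc C * θ ^ n * ‖G (y n) (x n) 0‖ ≤ C * θ ^ n * (M + L * (1 + ‖x n‖)) :=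
          mul_le_mul_of_nonneg_left (hM n) (by positivity)
      _ = _ := by ring
  obtain ⟨l, hl⟩ := cauchySeq_tendsto_of_complete hcau
  have : latent G y x = l := ((tendsto_add_atTop_iff_nat 1).2 hl).limUnder_eq
  rwa [this]

/-- Passage to the limit in `norm_backIter_sub_le`; summability of both covariate pasts makes the
series converge and both iterations tend to their latent values. -/
lemma norm_latent_sub_le [Finite E] [CompleteSpace Λ] {G : E → Vec d → Λ → Λ} {L C θ : ℝ}
    (hL0 : 0 ≤ L) (hC : 0 ≤ C) (hθ0 : 0 < θ) (hθ1 : θ < 1)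
    (hL : ∀ (y y' : E) (x x' : Vec d) (z z' : Λ),
      ‖G y x z - G y' x' z'‖ ≤ L * ((if y = y' then 0 else 1) + ‖x - x'‖ + ‖z - z'‖))
    (hG : ∀ (n : ℕ) (y : ℕ → E) (x : ℕ → Vec d) (z z' : Λ),
      ‖backIter G y x n z - backIter G y x n z'‖ ≤ C * θ ^ n * ‖z - z'‖)
    (y y' : ℕ → E) {x x' : ℕ → Vec d} (hx : Summable fun i => θ ^ i * ‖x i‖)
    (hx' : Summable fun i => θ ^ i * ‖x' i‖) :
    ‖latent G y x - latent G y' x'‖ ≤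
      C * L * ∑' i, θ ^ i * ((if y i = y' i then 0 else 1) + ‖x i - x' i‖) := by
  have hs : Summable fun i => θ ^ i * ((if y i = y' i then 0 else 1) + ‖x i - x' i‖) := by
    refine Summable.of_nonneg_of_le (fun i => ?_) (fun i => ?_)
      ((summable_geometric_of_lt_one hθ0.le hθ1).add (hx.add hx'))
    · have : (0 : ℝ) ≤ if y i = y' i then 0 else 1 := by split_ifs <;> norm_num
      positivity
    · have h1 : (if y i = y' i then (0 : ℝ) else 1) ≤ 1 := by split_ifs <;> norm_num
      have h2 := norm_sub_le (x i) (x' i)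
      have h3 : 0 < θ ^ i := by positivity
      nlinarith
  have h1 := tendsto_backIter_latent hL0 hC hθ0 hθ1 hL hG y hx
  have h2 := tendsto_backIter_latent hL0 hC hθ0 hθ1 hL hG y' hx'
  refine le_of_tendsto (h1.sub h2).norm (Eventually.of_forall fun n => ?_)
  refine (norm_backIter_sub_le hC hθ0.le hL hG y y' x x' n 0).trans ?_
  rw [← Finset.mul_sum]
  refine mul_le_mul_of_nonneg_left (hs.sum_le_tsum _ fun i _ => ?_) (by positivity)
  have : (0 : ℝ) ≤ if y i = y' i then 0 else 1 := by split_ifs <;> norm_num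
  positivity

/-- Only the tail of the geometric series from the first disagreement on can contribute. Together
with `norm_latent_sub_le` this turns contraction into the bound `C θ ^ m` for histories with
agreement `m`. -/
lemma tsum_disagree_le {θ : ℝ} (hθ0 : 0 < θ) (hθ1 : θ < 1) (y y' : ℕ → E) :
    Summable (fun i => θ ^ i * (if y i = y' i then (0 : ℝ) else 1)) ∧
    ∑' i, θ ^ i * (if y i = y' i then (0 : ℝ) else 1) ≤
      agreeFun (fun m => (1 - θ)⁻¹ * θ ^ m) y y' := by
  have hgeo := summable_geometric_of_lt_one hθ0.le hθ1
  have hs : Summable (fun i => θ ^ i * (if y i = y' i then (0 : ℝ) else 1)) := by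
    refine Summable.of_nonneg_of_le (fun i => ?_) (fun i => ?_) hgeo
    · split_ifs <;> positivity
    · split_ifs
      · simp; positivity
      · simp
  refine ⟨hs, ?_⟩
  by_cases h : y = y'
  · subst h; simp [agreeFun_self]
  · rw [agreeFun, if_neg h, ← hs.sum_add_tsum_nat_add (PiNat.firstDiff y y')]
    rw [Finset.sum_eq_zero, zero_add]
    · rw [← tsum_geometric_of_lt_one hθ0.le hθ1, ← tsum_mul_right]
      refine ((summable_nat_add_iff _).2 hs).tsum_le_tsum (fun i => ?_) (hgeo.mul_right _)
      rw [pow_add]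
      split_ifs
      · simp; positivity
      · simp
    · intro i hi
      rw [if_pos (PiNat.apply_eq_of_lt_firstDiff (Finset.mem_range.1 hi)), mul_zero]

end Latent


/-! ### Histories of responses along exogenous paths -/

section Paths

variable {Ω E 𝒵 : Type*}

/-- The history of the responses up to time `t` together with the whole exogenous path. -/
def hist (Y : ℤ → Ω → E) (Z : ℤ → Ω → 𝒵) (t : ℤ) (ω : Ω) : (ℕ → E) × (ℤ → 𝒵) :=
  (pastSeq (path Y ω) t, path Z ω)

lemma pastSeq_eq_consSeq (y : ℤ → E) (t : ℤ) :
    pastSeq y t = consSeq (y t) (pastSeq y (t - 1)) := by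
  funext n
  cases n with
  | zero => simp [pastSeq]
  | succ n => simp only [pastSeq, consSeq_succ]; congr 1; push_cast; ring

variable [MeasurableSpace Ω] [MeasurableSpace E] [MeasurableSpace 𝒵]

lemma measurable_consSeq_left (w : E) : Measurable (consSeq w) := by
  refine measurable_pi_iff.2 fun n => ?_
  cases n with
  | zero => exact measurable_const
  | succ n => exact measurable_pi_apply n

lemma measurable_pastSeq (t : ℤ) : Measurable fun z : ℤ → E => pastSeq z t :=
  measurable_pi_iff.2 fun _ => measurable_pi_apply _

lemma measurable_path {Y : ℤ → Ω → E} (hY : ∀ t, Measurable (Y t)) : Measurable (path Y) :=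
  measurable_pi_iff.2 hY

lemma measurable_hist {Y : ℤ → Ω → E} (hY : ∀ t, Measurable (Y t)) {Z : ℤ → Ω → 𝒵}
    (hZ : ∀ t, Measurable (Z t)) (t : ℤ) : Measurable (hist Y Z t) :=
  ((measurable_pastSeq t).comp (measurable_path hY)).prodMk (measurable_path hZ)

end Paths

/-! ### Transition kernels of a chain with infinite memory -/

section Kernels

variable {E : Type*} [Fintype E] [MeasurableSpace E]
  {ζ : Type*} [MeasurableSpace ζ]

/-- Transition of the history when `p (y, z)` is the law of the next value; the exogenous
component `z` does not move. -/
def stepKernel (p : (ℕ → E) × ζ → E → ℝ) (hp : ∀ w, Measurable fun s => p s w) :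
    Kernel ((ℕ → E) × ζ) ((ℕ → E) × ζ) where
  toFun s := ∑ w, ENNReal.ofReal (p s w) • Measure.dirac (consSeq w s.1, s.2)
  measurable' := by
    refine Measure.measurable_of_measurable_coe _ fun A hA => ?_
    simp only [Measure.coe_finsetSum, Finset.sum_apply, Measure.smul_apply, smul_eq_mul]
    refine Finset.measurable_sum _ fun w _ => (hp w).ennreal_ofReal.mul ?_
    have : Measurable fun s : (ℕ → E) × ζ => (consSeq w s.1, s.2) :=
      ((measurable_consSeq_left w).comp measurable_fst).prodMk measurable_snd
    exact (Measure.measurable_coe hA).comp (Measure.measurable_dirac.comp this)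

lemma stepKernel_apply (p : (ℕ → E) × ζ → E → ℝ) (hp : ∀ w, Measurable fun s => p s w)
    (s : (ℕ → E) × ζ) :
    stepKernel p hp s = ∑ w, ENNReal.ofReal (p s w) • Measure.dirac (consSeq w s.1, s.2) := rfl

lemma lintegral_stepKernel (p : (ℕ → E) × ζ → E → ℝ) (hp : ∀ w, Measurable fun s => p s w)
    (s : (ℕ → E) × ζ) {F : (ℕ → E) × ζ → ℝ≥0∞} (hF : Measurable F) :
    ∫⁻ a, F a ∂(stepKernel p hp s) = ∑ w, ENNReal.ofReal (p s w) * F (consSeq w s.1, s.2) := by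
  rw [stepKernel_apply, lintegral_finsetSum_measure]
  simp [lintegral_smul_measure, lintegral_dirac' _ hF]

lemma isMarkovKernel_stepKernel {p : (ℕ → E) × ζ → E → ℝ} (hp : ∀ w, Measurable fun s => p s w)
    (h0 : ∀ s w, 0 ≤ p s w) (h1 : ∀ s, ∑ w, p s w = 1) : IsMarkovKernel (stepKernel p hp) := by
  refine ⟨fun s => ⟨?_⟩⟩
  rw [stepKernel_apply]
  simp only [Measure.coe_finsetSum, Finset.sum_apply, Measure.smul_apply, measure_univ,
    smul_eq_mul, mul_one]
  rw [← ENNReal.ofReal_sum_of_nonneg fun w _ => h0 s w, h1, ENNReal.ofReal_one]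

lemma integral_stepKernel {p : (ℕ → E) × ζ → E → ℝ} (hp : ∀ w, Measurable fun s => p s w)
    (h0 : ∀ s w, 0 ≤ p s w) (s : (ℕ → E) × ζ) {F : (ℕ → E) × ζ → ℝ} (hF : Measurable F) :
    ∫ a, F a ∂(stepKernel p hp s) = ∑ w, p s w * F (consSeq w s.1, s.2) := by
  rw [stepKernel_apply, integral_finsetSum_measure]
  · refine Finset.sum_congr rfl fun w _ => ?_
    rw [integral_smul_measure, integral_dirac' _ _ hF.stronglyMeasurable,
      ENNReal.toReal_ofReal (h0 s w), smul_eq_mul]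
  · intro w _
    refine Integrable.smul_measure ?_ ENNReal.ofReal_ne_top
    exact integrable_dirac' hF.stronglyMeasurable (by simp)

/-- The law of the history after `N` steps. -/
def runKernel (p : ℕ → (ℕ → E) × ζ → E → ℝ) (hp : ∀ n w, Measurable fun s => p n s w) :
    ℕ → Kernel ((ℕ → E) × ζ) ((ℕ → E) × ζ)
  | 0 => Kernel.id
  | N + 1 => stepKernel (p N) (hp N) ∘ₖ runKernel p hp N

lemma isMarkovKernel_runKernel {p : ℕ → (ℕ → E) × ζ → E → ℝ}
    (hp : ∀ n w, Measurable fun s => p n s w)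
    (h0 : ∀ n s w, 0 ≤ p n s w) (h1 : ∀ n s, ∑ w, p n s w = 1) (N : ℕ) :
    IsMarkovKernel (runKernel p hp N) := by
  induction N with
  | zero => rw [runKernel]; infer_instance
  | succ N ih =>
    rw [runKernel]
    have := isMarkovKernel_stepKernel (hp N) (h0 N) (h1 N)
    infer_instance

/-- The link between the two descriptions of the chain: kernels carry measurability and conditional
laws, while `evol` is the form in which two chains are compared. -/
lemma integral_runKernel {p : ℕ → (ℕ → E) × ζ → E → ℝ}
    (hp : ∀ n w, Measurable fun s => p n s w)
    (h0 : ∀ n s w, 0 ≤ p n s w) (h1 : ∀ n s, ∑ w, p n s w = 1) (N : ℕ)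
    {F : (ℕ → E) × ζ → ℝ} (hF : Measurable F) {M : ℝ} (hM : ∀ s, |F s| ≤ M)
    (y : ℕ → E) (z : ζ) :
    ∫ a, F a ∂(runKernel p hp N (y, z)) =
      evol (fun n y w => p n (y, z) w) N (fun y => F (y, z)) y := by
  induction N generalizing F with
  | zero =>
    simp only [runKernel, evol, Kernel.id_apply]
    exact integral_dirac' _ _ hF.stronglyMeasurable
  | succ N ih =>
    have := isMarkovKernel_runKernel hp h0 h1 N
    have := isMarkovKernel_stepKernel (hp N) (h0 N) (h1 N)
    rw [runKernel, Kernel.integral_comp]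
    · simp only [integral_stepKernel (hp N) (h0 N) _ hF]
      rw [ih]
      · rfl
      · refine Finset.measurable_sum _ fun w _ => (hp N w).mul (hF.comp ?_)
        exact ((measurable_consSeq_left w).comp measurable_fst).prodMk measurable_snd
      · intro s
        calc |∑ w, p N s w * F (consSeq w s.1, s.2)|
            ≤ ∑ w, |p N s w * F (consSeq w s.1, s.2)| := Finset.abs_sum_le_sum_abs _ _
          _ ≤ ∑ w, p N s w * M := Finset.sum_le_sum fun w _ => by
              rw [abs_mul, abs_of_nonneg (h0 N s w)]
              exact mul_le_mul_of_nonneg_left (hM _) (h0 N s w)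
          _ = M := by rw [← Finset.sum_mul, h1, one_mul]
    · exact Integrable.of_bound hF.aestronglyMeasurable M (Eventually.of_forall hM)

/-- What was known at the start can be taken out of the expectation. -/
lemma lintegral_runKernel_mul {p : ℕ → (ℕ → E) × ζ → E → ℝ}
    (hp : ∀ n w, Measurable fun s => p n s w) (N : ℕ)
    {g F : (ℕ → E) × ζ → ℝ≥0∞} (hg : Measurable g) (hF : Measurable F) (s : (ℕ → E) × ζ) :
    ∫⁻ a, g (fun i => a.1 (i + N), a.2) * F a ∂(runKernel p hp N s) =
      g s * ∫⁻ a, F a ∂(runKernel p hp N s) := by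
  have hdrop : ∀ N, Measurable fun a : (ℕ → E) × ζ => ((fun i => a.1 (i + N), a.2) :
      (ℕ → E) × ζ) := fun N =>
    (measurable_pi_iff.2 fun i => (measurable_pi_apply (i + N)).comp measurable_fst).prodMk
      measurable_snd
  have hcons : ∀ w : E, Measurable fun s : (ℕ → E) × ζ => (consSeq w s.1, s.2) := fun w =>
    ((measurable_consSeq_left w).comp measurable_fst).prodMk measurable_snd
  induction N generalizing F with
  | zero =>
    simp only [runKernel, Kernel.id_apply, add_zero]
    rw [lintegral_dirac' s hF]
    exact lintegral_dirac' s (hg.mul hF)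
  | succ N ih =>
    have hgF : Measurable fun a : (ℕ → E) × ζ => g (fun i => a.1 (i + (N + 1)), a.2) * F a :=
      (hg.comp (hdrop (N + 1))).mul hF
    rw [runKernel, Kernel.lintegral_comp _ _ _ hgF, Kernel.lintegral_comp _ _ _ hF]
    simp only [lintegral_stepKernel _ _ _ hgF, lintegral_stepKernel _ _ _ hF]
    have hT : Measurable fun b : (ℕ → E) × ζ =>
        ∑ w, ENNReal.ofReal (p N b w) * F (consSeq w b.1, b.2) :=
      Finset.measurable_sum _ fun w _ => (hp N w).ennreal_ofReal.mul (hF.comp (hcons w))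
    rw [← ih hT]
    refine lintegral_congr fun a => ?_
    rw [Finset.mul_sum]
    refine Finset.sum_congr rfl fun w _ => ?_
    have : (fun i => consSeq w a.1 (i + (N + 1))) = fun i => a.1 (i + N) := rfl
    rw [this]
    ring

end Kernels

/-! ### The law of a process with given transitions -/

section Law

variable {Ω : Type*} [MeasurableSpace Ω] {μ : Measure Ω} [IsProbabilityMeasure μ]
  {E : Type*} [Fintype E] [MeasurableSpace E] [DiscreteMeasurableSpace E]
  {𝒵 : Type*} [MeasurableSpace 𝒵]

/-- `p` gives the conditional laws of the responses given the past responses and the whole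
exogenous process. -/
structure HasTransition (p : ℤ → (ℕ → E) × (ℤ → 𝒵) → E → ℝ) (Y : ℤ → Ω → E) (Z : ℤ → Ω → 𝒵)
    (μ : Measure Ω) : Prop where
  measurable_resp : ∀ t, Measurable (Y t)
  measurable_exog : ∀ t, Measurable (Z t)
  measurable : ∀ t w, Measurable fun s => p t s w
  nonneg : ∀ t s w, 0 ≤ p t s w
  sum_eq_one : ∀ t s, ∑ w, p t s w = 1
  causal : ∀ t y z z', (∀ s ≤ t, z s = z' s) → p t (y, z) = p t (y, z')
  condExp : ∀ t w, μ[Set.indicator {ω | Y t ω = w} (fun _ => (1 : ℝ)) | exogField Y Z t] =ᵐ[μ]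
    fun ω => p t (hist Y Z (t - 1) ω) w

variable {p : ℤ → (ℕ → E) × (ℤ → 𝒵) → E → ℝ} {Y : ℤ → Ω → E} {Z : ℤ → Ω → 𝒵}

/-- The event is split according to the value `w` of `Y t`. The remaining condition is an event of
the conditioning σ-field, so the defining property of the conditional expectation replaces the
indicator of `Y t = w` by its conditional probability. -/
lemma HasTransition.map_hist_step (h : HasTransition p Y Z μ) (t : ℤ) :
    μ.map (hist Y Z t) = stepKernel (p t) (h.measurable t) ∘ₘ μ.map (hist Y Z (t - 1)) := by
  have hm := measurable_hist h.measurable_resp h.measurable_exog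
  have hcons : ∀ w : E, Measurable fun s : (ℕ → E) × (ℤ → 𝒵) => (consSeq w s.1, s.2) := fun w =>
    ((measurable_consSeq_left w).comp measurable_fst).prodMk measurable_snd
  ext A hA
  rw [Measure.bind_apply hA (Kernel.aemeasurable _), Measure.map_apply (hm t) hA,
    lintegral_map (Kernel.measurable_coe _ hA) (hm (t - 1))]
  let B : E → Set Ω := fun w => {ω | (consSeq w (hist Y Z (t - 1) ω).1, (hist Y Z (t - 1) ω).2) ∈ A}
  have hBm : ∀ w, MeasurableSet[exogField Y Z t] (B w) := fun w =>
    ⟨_, hcons w hA, rfl⟩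
  have hle : exogField Y Z t ≤ ‹MeasurableSpace Ω› :=
    Measurable.comap_le (hm (t - 1))
  have hYm : ∀ w, MeasurableSet {ω | Y t ω = w} := fun w =>
    h.measurable_resp t (measurableSet_singleton w)
  have hsplit : (hist Y Z t) ⁻¹' A = ⋃ w ∈ (Finset.univ : Finset E), ({ω | Y t ω = w} ∩ B w) := by
    ext ω
    simp only [Set.mem_preimage, Finset.mem_univ, Set.iUnion_true, Set.mem_iUnion,
      Set.mem_inter_iff,
      Set.mem_ofPred_eq, exists_eq_left', B, hist]
    rw [pastSeq_eq_consSeq (path Y ω) t]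
    rfl
  rw [hsplit, measure_biUnion_finset]
  · simp only [stepKernel_apply, Measure.coe_finsetSum, Finset.sum_apply, Measure.smul_apply,
      smul_eq_mul]
    rw [lintegral_finsetSum]
    · refine Finset.sum_congr rfl fun w _ => ?_
      have hint : Integrable (Set.indicator {ω | Y t ω = w} (fun _ => (1 : ℝ))) μ :=
        (integrable_const 1).indicator (hYm w)
      have h1 : ∫ ω in B w, p t (hist Y Z (t - 1) ω) w ∂μ = μ.real ({ω | Y t ω = w} ∩ B w) := by
        rw [← setIntegral_congr_ae (hle _ (hBm w)) ((h.condExp t w).mono fun ω hω _ => hω),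
          setIntegral_condExp hle hint (hBm w), integral_indicator_const _ (hYm w)]
        simp [measureReal_restrict_apply (hYm w)]
      have h2 : ∫⁻ ω in B w, ENNReal.ofReal (p t (hist Y Z (t - 1) ω) w) ∂μ =
          μ ({ω | Y t ω = w} ∩ B w) := by
        rw [← ofReal_integral_eq_lintegral_ofReal, h1, ofReal_measureReal]
        · refine Integrable.of_bound ((h.measurable t w).comp (hm (t - 1))).aestronglyMeasurable 1
            (Eventually.of_forall fun ω => ?_)
          rw [Real.norm_of_nonneg (h.nonneg _ _ _), ← h.sum_eq_one t (hist Y Z (t - 1) ω)]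
          exact Finset.single_le_sum (fun w _ => h.nonneg _ _ w) (Finset.mem_univ w)
        · exact Eventually.of_forall fun ω => h.nonneg _ _ _
      rw [← h2, ← lintegral_indicator (hle _ (hBm w))]
      refine lintegral_congr fun ω => ?_
      rw [Measure.dirac_apply' _ hA]
      by_cases hω : ω ∈ B w
      · rw [Set.indicator_of_mem hω, Set.indicator_of_mem (by exact hω)]
        simp
      · rw [Set.indicator_of_notMem hω, Set.indicator_of_notMem (by exact hω)]
        simp
    · intro w _
      refine ((h.measurable t w).comp (hm (t - 1))).ennreal_ofReal.mul ?_
      exact (Measure.measurable_coe hA).comp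
        (Measure.measurable_dirac.comp ((hcons w).comp (hm (t - 1))))
  · intro w _ w' _ hww
    refine Set.disjoint_left.2 fun ω hω hω' => hww ?_
    exact hω.1.symm.trans hω'.1
  · intro w _
    exact (hYm w).inter (hle _ (hBm w))

lemma HasTransition.map_hist_run (h : HasTransition p Y Z μ) (t : ℤ) (N : ℕ) :
    μ.map (hist Y Z (t + N)) =
      runKernel (fun n => p (t + 1 + n)) (fun _ => h.measurable _) N ∘ₘ μ.map (hist Y Z t) := by
  induction N with
  | zero => simp [runKernel]
  | succ N ih =>
    have e : t + ((N + 1 : ℕ) : ℤ) = t + 1 + N := by push_cast; ring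
    have e' : t + 1 + (N : ℤ) - 1 = t + N := by ring
    rw [runKernel, ← Measure.comp_assoc, ← ih, e, h.map_hist_step, e']

end Law


/-! ### Splitting a path into past and future -/

section Glue

variable {𝒵 : Type*}

/-- The two-sided path with past `a = (z_0, z_{-1}, …)` and future `b = (z_1, z_2, …)`. -/
def glue (a b : ℕ → 𝒵) : ℤ → 𝒵 := fun t => if t ≤ 0 then a (-t).toNat else b (t - 1).toNat

/-- The future `(z_1, z_2, …)` of a path. -/
def futSeq (z : ℤ → 𝒵) : ℕ → 𝒵 := fun i => z (1 + i)

lemma glue_pastSeq_futSeq (z : ℤ → 𝒵) : glue (pastSeq z 0) (futSeq z) = z := by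
  funext t
  simp only [glue, pastSeq, futSeq]
  split_ifs with h
  · congr 1; omega
  · congr 1; omega

lemma glue_congr_of_nonpos (a b b' : ℕ → 𝒵) {s : ℤ} (hs : s ≤ 0) : glue a b s = glue a b' s := by
  simp [glue, hs]

variable [MeasurableSpace 𝒵]

lemma measurable_glue : Measurable fun ab : (ℕ → 𝒵) × (ℕ → 𝒵) => glue ab.1 ab.2 := by
  refine measurable_pi_iff.2 fun t => ?_
  unfold glue
  by_cases h : t ≤ 0
  · simp only [h, if_true]
    exact (measurable_pi_apply _).comp measurable_fst
  · simp only [h, if_false]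
    exact (measurable_pi_apply _).comp measurable_snd

lemma measurable_futSeq : Measurable fun z : ℤ → 𝒵 => futSeq z :=
  measurable_pi_iff.2 fun _ => measurable_pi_apply _

end Glue

/-! ### Elementary rules for the backward recursion -/

section EvolAlgebra

variable {E : Type*} [Fintype E]

/-- The constant will be a functional of the exogenous path, which is frozen while the chain runs.
-/
lemma evol_mul_const (p : ℕ → (ℕ → E) → E → ℝ) (N : ℕ) (F : (ℕ → E) → ℝ) (c : ℝ) (y : ℕ → E) :
    evol p N (fun y => F y * c) y = evol p N F y * c := by
  induction N generalizing F with
  | zero => rfl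
  | succ N ih =>
    simp only [evol]
    rw [← ih]
    congr 1
    funext y
    rw [Finset.sum_mul]
    exact Finset.sum_congr rfl fun w _ => by ring

lemma abs_evol_le {p : ℕ → (ℕ → E) → E → ℝ} (h0 : ∀ n y w, 0 ≤ p n y w)
    (h1 : ∀ n y, ∑ w, p n y w = 1) (N : ℕ) {F : (ℕ → E) → ℝ} {M : ℝ} (hF : ∀ y, |F y| ≤ M)
    (y : ℕ → E) : |evol p N F y| ≤ M := by
  induction N generalizing F with
  | zero => exact hF y
  | succ N ih =>
    refine ih fun s => ?_
    calc |∑ w, p N s w * F (consSeq w s)| ≤ ∑ w, |p N s w * F (consSeq w s)| :=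
          Finset.abs_sum_le_sum_abs _ _
      _ ≤ ∑ w, p N s w * M := Finset.sum_le_sum fun w _ => by
          rw [abs_mul, abs_of_nonneg (h0 N s w)]
          exact mul_le_mul_of_nonneg_left (hF _) (h0 N s w)
      _ = M := by rw [← Finset.sum_mul, h1, one_mul]

/-- Only the first `N` transitions matter; with causality of the transitions, an expectation up to
time `0` then ignores future covariates. -/
lemma evol_congr_left {p p' : ℕ → (ℕ → E) → E → ℝ} {N : ℕ} (h : ∀ n < N, p n = p' n)
    (F : (ℕ → E) → ℝ) : evol p N F = evol p' N F := by
  induction N generalizing F with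
  | zero => rfl
  | succ N ih =>
    simp only [evol]
    rw [h N (Nat.lt_succ_self N)]
    exact ih (fun n hn => h n (hn.trans (Nat.lt_succ_self N))) _

lemma accum_zero (ρ : ℝ) (s : ℕ) : accum ρ (fun _ => 0) s = ρ ^ s := by
  induction s with
  | zero => rfl
  | succ s ih => rw [accum, ih, add_zero, pow_succ, mul_comm]

end EvolAlgebra

/-! ### Loss of memory -/

lemma integral_measure_comp {α β : Type*} [MeasurableSpace α] [MeasurableSpace β] {ν : Measure α}
    {κ : Kernel α β} {F : β → ℝ} (hF : Integrable F (κ ∘ₘ ν)) :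
    ∫ b, F b ∂(κ ∘ₘ ν) = ∫ a, ∫ b, F b ∂(κ a) ∂ν := by
  rw [Measure.comp_eq_comp_const_apply] at hF ⊢
  rw [Kernel.integral_comp hF, Kernel.const_apply]

section Forgetting

variable {Ω : Type*} [MeasurableSpace Ω] {μ : Measure Ω} [IsProbabilityMeasure μ]
  {E : Type*} [Fintype E] [Nonempty E] [DecidableEq E] [MeasurableSpace E]
  [DiscreteMeasurableSpace E] {𝒵 : Type*} [MeasurableSpace 𝒵]

/-- For covariate paths in `𝒢`, the transitions from two histories are close when the histories
agree for a long time, up to an error `δ` due to different covariates, and never get too far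
apart; `ρ` is the contraction rate of the Lyapunov function. -/
structure Forgetting (p : ℤ → (ℕ → E) × (ℤ → 𝒵) → E → ℝ) (𝒢 : Set (ℤ → 𝒵))
    (δ : ℤ → (ℤ → 𝒵) → (ℤ → 𝒵) → ℝ) (ρ : ℝ) : Prop where
  pos : 0 < ρ
  lt_one : ρ < 1
  measurableSet : MeasurableSet 𝒢
  nonneg : ∀ t z z', 0 ≤ δ t z z'
  self_eq_zero : ∀ t z, δ t z z = 0
  dTV_le : ∃ (f : ℕ → ℝ) (c C θ : ℝ), f 0 = 1 ∧ (∀ m, 0 ≤ f m ∧ f m ≤ 1) ∧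
    (∀ m d, d ≤ c → d ≤ C * θ ^ m → (1 - d) * f (m + 1) + d ≤ ρ * f m) ∧
    ∀ z ∈ 𝒢, ∀ z' ∈ 𝒢, ∀ t y y', dTV (p t (y, z)) (p t (y', z')) ≤
      agreeFun (fun m => min c (C * θ ^ m)) y y' + δ t z z'

variable {p : ℤ → (ℕ → E) × (ℤ → 𝒵) → E → ℝ} {Y : ℤ → Ω → E} {Z : ℤ → Ω → 𝒵}
  {𝒢 : Set (ℤ → 𝒵)} {δ : ℤ → (ℤ → 𝒵) → (ℤ → 𝒵) → ℝ} {ρ : ℝ}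

lemma Forgetting.evol_sub_le (hF : Forgetting p 𝒢 δ ρ) (h : HasTransition p Y Z μ)
    {z z' : ℤ → 𝒵} (hz : z ∈ 𝒢) (hz' : z' ∈ 𝒢) (t : ℤ)
    (N : ℕ) (F F' : (ℕ → E) → ℝ) (e : ℝ) {ι : Type*} (J : Finset ι) (k : ι → ℕ)
    (hk : ∀ i ∈ J, k i < N)
    (hFF' : ∀ y y', F y - F' y' ≤ e + ∑ i ∈ J, (if y (k i) = y' (k i) then 0 else 1))
    (y y' : ℕ → E) :
    evol (fun n y w => p (t + 1 + n) (y, z) w) N F y -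
      evol (fun n y w => p (t + 1 + n) (y, z') w) N F' y' ≤
      e + ∑ i ∈ J, accum ρ (fun n => δ (t + 1 + n) z z') (N - k i) := by
  obtain ⟨f, c, C, θ, hf0, hf, hstep, hd⟩ := hF.dTV_le
  exact ObsDriven.evol_sub_le hf0 hf hstep hF.pos.le
    (p := fun n y w => p (t + 1 + n) (y, z) w) (p' := fun n y w => p (t + 1 + n) (y, z') w)
    (δ := fun n => δ (t + 1 + n) z z') (fun s => hF.nonneg _ _ _)
    (fun s y w => h.nonneg _ _ _) (fun s y => h.sum_eq_one _ _) (fun s y w => h.nonneg _ _ _)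
    (fun s y => h.sum_eq_one _ _) (fun s y y' => hd z hz z' hz' _ y y') N F F' e J k hk hFF' _ _

/-- The start of a chain is forgotten. -/
lemma Forgetting.abs_evol_sub_le (hF : Forgetting p 𝒢 δ ρ) (h : HasTransition p Y Z μ)
    {z : ℤ → 𝒵} (hz : z ∈ 𝒢) (t : ℤ) {N k : ℕ} (hkN : k ≤ N) {A : Set (ℕ → E)}
    (hA : ∀ y y' : ℕ → E, (∀ i < k, y i = y' i) → y ∈ A → y' ∈ A) (y y' : ℕ → E) :
    |evol (fun n y w => p (t + 1 + n) (y, z) w) N (A.indicator 1) y -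
      evol (fun n y w => p (t + 1 + n) (y, z) w) N (A.indicator 1) y'| ≤ k * ρ ^ (N - k) := by
  have hI : ∀ y y' : ℕ → E, A.indicator (1 : (ℕ → E) → ℝ) y - A.indicator (1 : (ℕ → E) → ℝ) y' ≤
      0 + ∑ i ∈ Finset.range k, (if y i = y' i then (0 : ℝ) else 1) := by
    intro y y'
    rw [zero_add]
    have hnn : ∀ i ∈ Finset.range k, (0 : ℝ) ≤ if y i = y' i then 0 else 1 := fun i _ => by
      split_ifs <;> norm_num
    by_cases hall : ∀ i < k, y i = y' i
    · have h1 : y ∈ A ↔ y' ∈ A := ⟨hA y y' hall, hA y' y fun i hi => (hall i hi).symm⟩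
      refine le_trans (le_of_eq ?_) (Finset.sum_nonneg hnn)
      by_cases hy : y ∈ A
      · simp [hy, h1.1 hy]
      · simp [hy, mt h1.2 hy]
    · push Not at hall
      obtain ⟨i, hi, hne⟩ := hall
      calc A.indicator (1 : (ℕ → E) → ℝ) y - A.indicator (1 : (ℕ → E) → ℝ) y' ≤ 1 := by
            have h1 : A.indicator (1 : (ℕ → E) → ℝ) y ≤ 1 :=
              Set.indicator_le_self' (fun _ _ => zero_le_one) y
            have h2 : 0 ≤ A.indicator (1 : (ℕ → E) → ℝ) y' :=
              Set.indicator_nonneg (fun _ _ => zero_le_one) y'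
            linarith
        _ = if y i = y' i then (0 : ℝ) else 1 := by rw [if_neg hne]
        _ ≤ _ := Finset.single_le_sum (f := fun i => if y i = y' i then (0 : ℝ) else 1)
            hnn (Finset.mem_range.2 hi)
  have hb : ∀ y y' : ℕ → E, evol (fun n y w => p (t + 1 + n) (y, z) w) N (A.indicator 1) y -
      evol (fun n y w => p (t + 1 + n) (y, z) w) N (A.indicator 1) y' ≤ k * ρ ^ (N - k) := by
    intro y y'
    refine (hF.evol_sub_le h hz hz t N _ _ 0 (Finset.range k) id
      (fun i hi => (Finset.mem_range.1 hi).trans_le hkN) hI y y').trans ?_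
    simp only [hF.self_eq_zero, accum_zero, zero_add, id]
    calc ∑ i ∈ Finset.range k, ρ ^ (N - i) ≤ ∑ _i ∈ Finset.range k, ρ ^ (N - k) :=
          Finset.sum_le_sum fun i hi => pow_le_pow_of_le_one hF.pos.le hF.lt_one.le
            (Nat.sub_le_sub_left (Finset.mem_range.1 hi).le N)
      _ = k * ρ ^ (N - k) := by simp
  exact abs_sub_le_iff.2 ⟨hb y y', hb y' y⟩

/-- The expectation is disintegrated at time `t`: given the history at `t` and the whole exogenous
path, the next `N` responses follow the chain with frozen exogenous path. -/
lemma HasTransition.integral_hist (h : HasTransition p Y Z μ) (t : ℤ) (N : ℕ)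
    {F : (ℕ → E) × (ℤ → 𝒵) → ℝ} (hF : Measurable F) {M : ℝ} (hM : ∀ s, |F s| ≤ M) :
    ∫ ω, F (hist Y Z (t + N) ω) ∂μ = ∫ ω, evol (fun n y w => p (t + 1 + n) (y, path Z ω) w) N
      (fun y => F (y, path Z ω)) (pastSeq (path Y ω) t) ∂μ := by
  have hm := measurable_hist h.measurable_resp h.measurable_exog
  have := isMarkovKernel_runKernel (fun n : ℕ => h.measurable (t + 1 + n))
    (fun n => h.nonneg (t + 1 + n)) (fun n => h.sum_eq_one (t + 1 + n)) N
  have hpr := Measure.isProbabilityMeasure_map (μ := μ) (hm t).aemeasurable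
  rw [← integral_map (hm _).aemeasurable hF.aestronglyMeasurable, h.map_hist_run,
    integral_measure_comp (Integrable.of_bound hF.aestronglyMeasurable M (Eventually.of_forall hM)),
    integral_map (hm t).aemeasurable]
  · refine integral_congr_ae (Eventually.of_forall fun ω => ?_)
    exact integral_runKernel (fun n : ℕ => h.measurable (t + 1 + n))
      (fun n => h.nonneg (t + 1 + n)) (fun n => h.sum_eq_one (t + 1 + n)) N hF hM _ _
  · exact (hF.stronglyMeasurable.integral_kernel).aestronglyMeasurable

/-- A functional of the recent responses does not distinguish two functionals of the covariates
with the same conditional expectation given the past of the covariates. -/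
lemma Forgetting.integral_indicator_mul_eq (hF : Forgetting p 𝒢 δ ρ) (h : HasTransition p Y Z μ)
    (h𝒢 : ∀ᵐ ω ∂μ, path Z ω ∈ 𝒢) {A : Set (ℕ → E)} (hAm : MeasurableSet A) {k : ℕ}
    (hA : ∀ y y' : ℕ → E, (∀ i < k, y i = y' i) → y ∈ A → y' ∈ A)
    {φ φ' : (ℤ → 𝒵) → ℝ} (hφ : Measurable φ) (hφ' : Measurable φ') (hφ1 : ∀ z, |φ z| ≤ 1)
    (hφ1' : ∀ z, |φ' z| ≤ 1)
    (heq : ∀ g : (ℕ → 𝒵) → ℝ, Measurable g → (∀ a, |g a| ≤ 1) →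
      ∫ ω, g (pastSeq (path Z ω) 0) * φ (path Z ω) ∂μ =
        ∫ ω, g (pastSeq (path Z ω) 0) * φ' (path Z ω) ∂μ) :
    ∫ ω, A.indicator 1 (pastSeq (path Y ω) 0) * φ (path Z ω) ∂μ =
      ∫ ω, A.indicator 1 (pastSeq (path Y ω) 0) * φ' (path Z ω) ∂μ := by
  have hZ := measurable_path h.measurable_exog
  have hYp := (measurable_pastSeq 0).comp (measurable_path h.measurable_resp)
  obtain ⟨w₀⟩ := ‹Nonempty E›
  let yc : ℕ → E := fun _ => w₀
  have hIm : Measurable (A.indicator (1 : (ℕ → E) → ℝ)) := measurable_one.indicator hAm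
  have hI1 : ∀ y, |A.indicator (1 : (ℕ → E) → ℝ) y| ≤ 1 := fun y => by
    by_cases hy : y ∈ A <;> simp [hy]
  -- The probability that the history at time `0` lies in `A` when the chain starts at time `-N`
  -- from `y` along the path `z`.
  let Ψ : ℕ → (ℕ → E) → (ℤ → 𝒵) → ℝ := fun N y z =>
    evol (fun n y w => p (-(N : ℤ) + 1 + n) (y, z) w) N (A.indicator 1) y
  have hΨ1 : ∀ N y z, |Ψ N y z| ≤ 1 := fun N y z =>
    abs_evol_le (p := fun n y w => p (-(N : ℤ) + 1 + n) (y, z) w) (fun n y w => h.nonneg _ _ _)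
      (fun n y => h.sum_eq_one _ _) N hI1 y
  have hΨm : ∀ N, Measurable fun s : (ℕ → E) × (ℤ → 𝒵) => Ψ N s.1 s.2 := by
    intro N
    have := isMarkovKernel_runKernel (fun n : ℕ => h.measurable (-(N : ℤ) + 1 + n))
      (fun n => h.nonneg _) (fun n => h.sum_eq_one _) N
    have hF0 : Measurable fun s : (ℕ → E) × (ℤ → 𝒵) => A.indicator (1 : (ℕ → E) → ℝ) s.1 :=
      hIm.comp measurable_fst
    have h1 := (hF0.stronglyMeasurable.integral_kernel
      (κ := runKernel _ (fun n : ℕ => h.measurable (-(N : ℤ) + 1 + n)) N)).measurable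
    convert h1 using 1
    funext s
    exact (integral_runKernel (fun n : ℕ => h.measurable (-(N : ℤ) + 1 + n))
      (fun n => h.nonneg _) (fun n => h.sum_eq_one _) N hF0 (fun s => hI1 s.1) s.1 s.2).symm
  -- replacing the past responses by a constant history
  have key : ∀ (N : ℕ), k ≤ N → ∀ χ : (ℤ → 𝒵) → ℝ, Measurable χ → (∀ z, |χ z| ≤ 1) →
      |∫ ω, A.indicator 1 (pastSeq (path Y ω) 0) * χ (path Z ω) ∂μ -
        ∫ ω, Ψ N yc (path Z ω) * χ (path Z ω) ∂μ| ≤ k * ρ ^ (N - k) := by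
    intro N hN χ hχ hχ1
    have h1 := h.integral_hist (-(N : ℤ)) N
      (F := fun s => A.indicator 1 s.1 * χ s.2) ((hIm.comp measurable_fst).mul
        (hχ.comp measurable_snd)) (M := 1) (fun s => by
          rw [abs_mul]; exact mul_le_one₀ (hI1 _) (abs_nonneg _) (hχ1 _))
    simp only [neg_add_cancel, hist, evol_mul_const] at h1
    rw [h1]
    have hm1 : Measurable fun ω => Ψ N (pastSeq (path Y ω) (-N)) (path Z ω) * χ (path Z ω) :=
      ((hΨm N).comp (measurable_hist h.measurable_resp h.measurable_exog (-N))).mul (hχ.comp hZ)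
    have hm2 : Measurable fun ω => Ψ N yc (path Z ω) * χ (path Z ω) :=
      ((hΨm N).comp (measurable_const.prodMk hZ)).mul (hχ.comp hZ)
    have hb : ∀ (y : ℕ → E) z, |Ψ N y z * χ z| ≤ 1 := fun y z => by
      rw [abs_mul]; exact mul_le_one₀ (hΨ1 _ _ _) (abs_nonneg _) (hχ1 _)
    change |∫ ω, Ψ N (pastSeq (path Y ω) (-N)) (path Z ω) * χ (path Z ω) ∂μ - _| ≤ _
    rw [← integral_sub]
    · have hbd : ∀ᵐ ω ∂μ, ‖Ψ N (pastSeq (path Y ω) (-N)) (path Z ω) * χ (path Z ω) -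
          Ψ N yc (path Z ω) * χ (path Z ω)‖ ≤ k * ρ ^ (N - k) := ?_
      · have h2 := norm_integral_le_of_norm_le_const hbd
        rwa [probReal_univ, mul_one] at h2
      filter_upwards [h𝒢] with ω hω
      rw [← sub_mul, norm_mul]
      refine (mul_le_mul (hF.abs_evol_sub_le h hω _ hN hA _ _) (hχ1 _) (abs_nonneg _) ?_).trans
        (le_of_eq (mul_one _))
      have := hF.pos
      positivity
    · exact Integrable.of_bound hm1.aestronglyMeasurable 1 (Eventually.of_forall fun ω => hb _ _)
    · exact Integrable.of_bound hm2.aestronglyMeasurable 1 (Eventually.of_forall fun ω => hb _ _)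
  have hmid : ∀ N, ∫ ω, Ψ N yc (path Z ω) * φ (path Z ω) ∂μ =
      ∫ ω, Ψ N yc (path Z ω) * φ' (path Z ω) ∂μ := by
    intro N
    -- By causality `Ψ N yc` sees no time after `0`, so any future may be glued to the past; the
    -- past itself serves, which makes `Ψ N yc` a function of the past alone and hence an admissible
    -- `g` in `heq`.
    have hg : ∀ z, Ψ N yc z = Ψ N yc (glue (pastSeq z 0) (pastSeq z 0)) := by
      intro z
      refine congrFun (evol_congr_left (fun n hn => ?_) _) yc
      funext y
      refine h.causal _ _ _ _ fun s hs => ?_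
      conv_lhs => rw [← glue_pastSeq_futSeq z]
      exact glue_congr_of_nonpos _ _ _ (by omega)
    have := heq (fun a => Ψ N yc (glue a a))
      ((hΨm N).comp (measurable_const.prodMk
        (measurable_glue.comp (measurable_id.prodMk measurable_id))))
      (fun a => hΨ1 _ _ _)
    simpa only [← hg] using this
  have hlim : Tendsto (fun N : ℕ => 2 * (k * ρ ^ (N - k))) atTop (𝓝 0) := by
    have h1 : Tendsto (fun N : ℕ => ρ ^ (N - k)) atTop (𝓝 0) :=
      (tendsto_pow_atTop_nhds_zero_of_lt_one hF.pos.le hF.lt_one).comp (tendsto_sub_atTop_nat k)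
    simpa using (h1.const_mul (k : ℝ)).const_mul 2
  -- The two middle terms coincide by `hmid`, so the difference is at most twice the error of the
  -- restart, which vanishes as `N → ∞`.
  have hle : |∫ ω, A.indicator 1 (pastSeq (path Y ω) 0) * φ (path Z ω) ∂μ -
      ∫ ω, A.indicator 1 (pastSeq (path Y ω) 0) * φ' (path Z ω) ∂μ| ≤ 0 := by
    refine ge_of_tendsto hlim ((eventually_ge_atTop k).mono fun N hN => ?_)
    have h1 := abs_le.1 (key N hN φ hφ hφ1)
    have h2 := abs_le.1 (key N hN φ' hφ' hφ1')
    rw [hmid N] at h1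
    exact abs_le.2 ⟨by linarith [h1.1, h2.2], by linarith [h1.2, h2.1]⟩
  exact sub_eq_zero.1 (abs_nonpos_iff.1 hle)

end Forgetting


/-! ### Conditional laws given the past -/

section CondLaw

variable {Ω : Type*} [MeasurableSpace Ω] {μ : Measure Ω} [IsProbabilityMeasure μ]
  {E : Type*} [Fintype E] [Nonempty E] [DecidableEq E] [MeasurableSpace E]
  [DiscreteMeasurableSpace E] {𝒵 : Type*} [MeasurableSpace 𝒵]
  {p : ℤ → (ℕ → E) × (ℤ → 𝒵) → E → ℝ} {Y : ℤ → Ω → E} {Z : ℤ → Ω → 𝒵}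
  {𝒢 : Set (ℤ → 𝒵)} {δ : ℤ → (ℤ → 𝒵) → (ℤ → 𝒵) → ℝ} {ρ : ℝ}

/-- The past of the responses and of the exogenous process at time `0`. -/
def pastPair (Y : ℤ → Ω → E) (Z : ℤ → Ω → 𝒵) (ω : Ω) : (ℕ → E) × (ℕ → 𝒵) :=
  (pastSeq (path Y ω) 0, pastSeq (path Z ω) 0)

lemma measurable_pastPair (hY : ∀ t, Measurable (Y t)) (hZ : ∀ t, Measurable (Z t)) :
    Measurable (pastPair Y Z) :=
  ((measurable_pastSeq 0).comp (measurable_path hY)).prodMk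
    ((measurable_pastSeq 0).comp (measurable_path hZ))

/-- The future of the exogenous process depends on the past of the responses only through the
past of the exogenous process. -/
lemma Forgetting.map_pastPair_futSeq (hF : Forgetting p 𝒢 δ ρ) (h : HasTransition p Y Z μ)
    (h𝒢 : ∀ᵐ ω ∂μ, path Z ω ∈ 𝒢) {Q : Kernel (ℕ → 𝒵) (ℕ → 𝒵)} [IsMarkovKernel Q]
    (hQ : μ.map (fun ω => (pastSeq (path Z ω) 0, futSeq (path Z ω))) =
      μ.map (fun ω => pastSeq (path Z ω) 0) ⊗ₘ Q) :
    μ.map (fun ω => (pastPair Y Z ω, futSeq (path Z ω))) =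
      μ.map (pastPair Y Z) ⊗ₘ Q.comap Prod.snd measurable_snd := by
  have hYp : Measurable fun ω => pastSeq (path Y ω) 0 :=
    (measurable_pastSeq 0).comp (measurable_path h.measurable_resp)
  have hZm := measurable_path h.measurable_exog
  have hZp : Measurable fun ω => pastSeq (path Z ω) 0 := (measurable_pastSeq 0).comp hZm
  have hZf : Measurable fun ω => futSeq (path Z ω) := measurable_futSeq.comp hZm
  have hYA : ∀ A, MeasurableSet A → MeasurableSet {ω | pastSeq (path Y ω) 0 ∈ A} :=
    fun A hA => hYp hA
  have hZB : ∀ B, MeasurableSet B → MeasurableSet {ω | pastSeq (path Z ω) 0 ∈ B} :=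
    fun B hB => hZp hB
  have hξ := measurable_pastPair h.measurable_resp h.measurable_exog
  have hpr := Measure.isProbabilityMeasure_map (μ := μ) hξ.aemeasurable
  have hpr' := Measure.isProbabilityMeasure_map (μ := μ) hZp.aemeasurable
  -- Conditional independence of past responses and future covariates, tested on rectangles.
  have hprod : ∀ (B C : Set (ℕ → 𝒵)), MeasurableSet B → MeasurableSet C →
      ∀ A : Set (ℕ → E), MeasurableSet A →
      μ ({ω | pastSeq (path Y ω) 0 ∈ A} ∩ ({ω | pastSeq (path Z ω) 0 ∈ B} ∩
        {ω | futSeq (path Z ω) ∈ C})) =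
      ∫⁻ ω in {ω | pastSeq (path Y ω) 0 ∈ A}, B.indicator (fun a => Q a C)
        (pastSeq (path Z ω) 0) ∂μ := by
    intro B C hB hC
    set T : Set (ℤ → 𝒵) := {z | pastSeq z 0 ∈ B} ∩ {z | futSeq z ∈ C} with hT
    have hTm : MeasurableSet T := (measurable_pastSeq 0 hB).inter (measurable_futSeq hC)
    have hQC : Measurable fun a => Q a C := Kernel.measurable_coe Q hC
    -- `φ` is the indicator of the event on the covariates and `φ'` its conditional probability
    -- given their past; forgetting shows that past responses cannot distinguish them.
    let φ : (ℤ → 𝒵) → ℝ := T.indicator 1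
    let ψ : (ℕ → 𝒵) → ℝ := B.indicator fun a => (Q a).real C
    let φ' : (ℤ → 𝒵) → ℝ := fun z => ψ (pastSeq z 0)
    have hφm : Measurable φ := measurable_one.indicator hTm
    have hψm : Measurable ψ := hQC.ennreal_toReal.indicator hB
    have hψ0 : ∀ a, 0 ≤ ψ a := fun a => Set.indicator_nonneg (fun _ _ => measureReal_nonneg) a
    have hψ1 : ∀ a, ψ a ≤ 1 := fun a =>
      Set.indicator_le' (fun _ _ => measureReal_le_one) (fun _ _ => zero_le_one) a
    have hφ'm : Measurable φ' := hψm.comp (measurable_pastSeq 0)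
    have hφ1 : ∀ z, |φ z| ≤ 1 := fun z => by by_cases hz : z ∈ T <;> simp [φ, hz]
    have hφ1' : ∀ z, |φ' z| ≤ 1 := fun z => abs_le.2 ⟨by linarith [hψ0 (pastSeq z 0)], hψ1 _⟩
    have heq : ∀ g : (ℕ → 𝒵) → ℝ, Measurable g → (∀ a, |g a| ≤ 1) →
        ∫ ω, g (pastSeq (path Z ω) 0) * φ (path Z ω) ∂μ =
          ∫ ω, g (pastSeq (path Z ω) 0) * φ' (path Z ω) ∂μ := by
      intro g hg hg1
      let K : (ℕ → 𝒵) × (ℕ → 𝒵) → ℝ := fun ab => (B ×ˢ C).indicator (fun ab => g ab.1) ab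
      have hK : Measurable K := (hg.comp measurable_fst).indicator (hB.prod hC)
      have h1 : ∀ ω, g (pastSeq (path Z ω) 0) * φ (path Z ω) =
          K (pastSeq (path Z ω) 0, futSeq (path Z ω)) := by
        intro ω
        by_cases hz : path Z ω ∈ T
        · simp only [φ, K, Set.indicator_of_mem hz]
          have hz' : (pastSeq (path Z ω) 0, futSeq (path Z ω)) ∈ B ×ˢ C := ⟨hz.1, hz.2⟩
          rw [Set.indicator_of_mem hz']
          simp
        · simp only [φ, K, Set.indicator_of_notMem hz]
          rw [Set.indicator_of_notMem (fun hm => hz ⟨hm.1, hm.2⟩), mul_zero]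
      simp only [h1]
      rw [← integral_map (hZp.prodMk hZf).aemeasurable hK.aestronglyMeasurable, hQ,
        Measure.integral_compProd, integral_map hZp.aemeasurable]
      · refine integral_congr_ae (Eventually.of_forall fun ω => ?_)
        set a := pastSeq (path Z ω) 0 with ha
        change ∫ b, K (a, b) ∂(Q a) = g a * ψ a
        by_cases haB : a ∈ B
        · have : (fun b => K (a, b)) = C.indicator fun _ => g a := by
            funext b
            by_cases hb : b ∈ C
            · rw [Set.indicator_of_mem hb]
              exact Set.indicator_of_mem (Set.mk_mem_prod haB hb) _
            · rw [Set.indicator_of_notMem hb]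
              exact Set.indicator_of_notMem (fun hm => hb hm.2) _
          rw [this, integral_indicator_const _ hC]
          simp only [ψ, Set.indicator_of_mem haB, smul_eq_mul, mul_comm]
        · have : (fun b => K (a, b)) = fun _ => 0 := by
            funext b
            exact Set.indicator_of_notMem (fun hm => haB hm.1) _
          rw [this, integral_zero]
          simp only [ψ, Set.indicator_of_notMem haB, mul_zero]
      · exact (hK.stronglyMeasurable.integral_kernel_prod_right').aestronglyMeasurable
      · refine Integrable.of_bound hK.aestronglyMeasurable 1 (Eventually.of_forall fun ab => ?_)
        by_cases hm : ab ∈ B ×ˢ C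
        · simp only [K, Set.indicator_of_mem hm]; exact hg1 _
        · simp only [K, Set.indicator_of_notMem hm]; simp
    -- comparison on cylinders
    let m₁ : Measure (ℕ → E) := (μ.restrict {ω | path Z ω ∈ T}).map fun ω => pastSeq (path Y ω) 0
    let m₂ : Measure (ℕ → E) := (μ.withDensity fun ω => ENNReal.ofReal (φ' (path Z ω))).map
      fun ω => pastSeq (path Y ω) 0
    have hm₁ : ∀ A, MeasurableSet A → m₁ A = ENNReal.ofReal
        (∫ ω, A.indicator 1 (pastSeq (path Y ω) 0) * φ (path Z ω) ∂μ) := by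
      intro A hA
      have hS : MeasurableSet ({ω | pastSeq (path Y ω) 0 ∈ A} ∩ {ω | path Z ω ∈ T}) :=
        (hYp hA).inter (hZm hTm)
      have h1 : (fun ω => A.indicator (1 : (ℕ → E) → ℝ) (pastSeq (path Y ω) 0) * φ (path Z ω)) =
          ({ω | pastSeq (path Y ω) 0 ∈ A} ∩ {ω | path Z ω ∈ T}).indicator 1 := by
        funext ω
        by_cases h1 : pastSeq (path Y ω) 0 ∈ A <;> by_cases h2 : path Z ω ∈ T <;>
          simp [φ, h1, h2]
      rw [h1, integral_indicator_one hS, ofReal_measureReal]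
      rw [Measure.map_apply hYp hA, Measure.restrict_apply (hYp hA)]
      rfl
    have hm₂' : ∀ A, MeasurableSet A → m₂ A = ∫⁻ ω in {ω | pastSeq (path Y ω) 0 ∈ A},
        ENNReal.ofReal (φ' (path Z ω)) ∂μ := by
      intro A hA
      rw [Measure.map_apply hYp hA, withDensity_apply _ (hYp hA)]
      rfl
    have hm₂ : ∀ A, MeasurableSet A → m₂ A = ENNReal.ofReal
        (∫ ω, A.indicator 1 (pastSeq (path Y ω) 0) * φ' (path Z ω) ∂μ) := by
      intro A hA
      have h1 : (fun ω => A.indicator (1 : (ℕ → E) → ℝ) (pastSeq (path Y ω) 0) * φ' (path Z ω)) =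
          {ω | pastSeq (path Y ω) 0 ∈ A}.indicator fun ω => φ' (path Z ω) := by
        funext ω
        by_cases h1 : pastSeq (path Y ω) 0 ∈ A <;> simp [h1]
      rw [h1, integral_indicator (hYA A hA), hm₂' A hA, ofReal_integral_eq_lintegral_ofReal]
      · exact Integrable.of_bound (hφ'm.comp hZm).aestronglyMeasurable 1
          (Eventually.of_forall fun ω => hφ1' _)
      · exact Eventually.of_forall fun ω => hψ0 _
    have hcyl : ∀ A ∈ measurableCylinders (fun _ : ℕ => E), m₁ A = m₂ A := by
      intro A hA
      have hAm := MeasurableSet.of_mem_measurableCylinders hA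
      rw [measurableCylinders_nat] at hA
      simp only [Set.mem_iUnion, Set.mem_singleton_iff] at hA
      obtain ⟨k, S, -, rfl⟩ := hA
      rw [hm₁ _ hAm, hm₂ _ hAm]
      congr 1
      refine hF.integral_indicator_mul_eq h h𝒢 hAm (k := k + 1) (fun y y' hyy' hy => ?_)
        hφm hφ'm hφ1 hφ1' heq
      rw [mem_cylinder] at hy ⊢
      convert hy using 1
      funext i
      exact (hyy' i.1 (Nat.lt_succ_of_le (Finset.mem_Iic.1 i.2))).symm
    have hm_eq : m₁ = m₂ :=
      ext_of_generate_finite _ generateFrom_measurableCylinders.symm isPiSystem_measurableCylinders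
        hcyl (hcyl _ (univ_mem_measurableCylinders _))
    intro A hA
    have h1 : m₁ A = μ ({ω | pastSeq (path Y ω) 0 ∈ A} ∩ ({ω | pastSeq (path Z ω) 0 ∈ B} ∩
        {ω | futSeq (path Z ω) ∈ C})) := by
      rw [Measure.map_apply hYp hA, Measure.restrict_apply (hYp hA)]
      rfl
    rw [← h1, hm_eq, hm₂' A hA]
    refine lintegral_congr fun ω => ?_
    simp only [φ', ψ]
    by_cases hb : pastSeq (path Z ω) 0 ∈ B
    · rw [Set.indicator_of_mem hb, Set.indicator_of_mem hb, ofReal_measureReal]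
    · rw [Set.indicator_of_notMem hb, Set.indicator_of_notMem hb, ENNReal.ofReal_zero]
  refine Measure.ext_prod fun {S C} hS hC => ?_
  rw [Measure.compProd_apply_prod hS hC, Measure.map_apply (hξ.prodMk hZf) (hS.prod hC)]
  have hQC : Measurable fun a : (ℕ → E) × (ℕ → 𝒵) => Q a.2 C :=
    (Kernel.measurable_coe Q hC).comp measurable_snd
  -- For a fixed future event `C`, agreement on rectangles of pasts extends to all measurable sets
  -- of pasts.
  have hν : (μ.restrict {ω | futSeq (path Z ω) ∈ C}).map (pastPair Y Z) =
      (μ.map (pastPair Y Z)).withDensity fun a => Q a.2 C := by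
    refine Measure.ext_prod fun {A B} hA hB => ?_
    rw [Measure.map_apply hξ (hA.prod hB), Measure.restrict_apply (hξ (hA.prod hB)),
      withDensity_apply _ (hA.prod hB), setLIntegral_map (hA.prod hB) hQC hξ]
    have h1 : pastPair Y Z ⁻¹' A ×ˢ B ∩ {ω | futSeq (path Z ω) ∈ C} =
        {ω | pastSeq (path Y ω) 0 ∈ A} ∩ ({ω | pastSeq (path Z ω) 0 ∈ B} ∩
        {ω | futSeq (path Z ω) ∈ C}) := by
      rw [← Set.inter_assoc]; rfl
    rw [h1, hprod B C hB hC A hA]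
    have h2 : pastPair Y Z ⁻¹' A ×ˢ B =
        {ω | pastSeq (path Z ω) 0 ∈ B} ∩ {ω | pastSeq (path Y ω) 0 ∈ A} := by
      rw [Set.inter_comm]; rfl
    rw [h2, ← Measure.restrict_restrict (hZB B hB), ← lintegral_indicator (hZB B hB)]
    rfl
  have h3 := DFunLike.congr_fun hν S
  rw [Measure.map_apply hξ hS, Measure.restrict_apply (hξ hS), withDensity_apply _ hS] at h3
  exact h3

end CondLaw


/-! ### Comparison of the conditional law of a block with its law -/

lemma ofReal_integral_le_lintegral_ofReal {α : Type*} [MeasurableSpace α] {ν : Measure α}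
    {f : α → ℝ} (hf : Integrable f ν) :
    ENNReal.ofReal (∫ a, f a ∂ν) ≤ ∫⁻ a, ENNReal.ofReal (f a) ∂ν := by
  rw [integral_eq_lintegral_pos_part_sub_lintegral_neg_part hf]
  refine (ENNReal.ofReal_le_ofReal (sub_le_self _ ENNReal.toReal_nonneg)).trans ?_
  exact ENNReal.ofReal_toReal_le

lemma abs_integral_le_of_abs_le {α : Type*} [MeasurableSpace α] {ν : Measure α}
    [IsProbabilityMeasure ν] {f : α → ℝ} {M : ℝ} (hf : ∀ a, |f a| ≤ M) : |∫ a, f a ∂ν| ≤ M := by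
  have h := norm_integral_le_of_norm_le_const (μ := ν) (f := f) (Eventually.of_forall hf)
  rwa [probReal_univ, mul_one] at h

section Block

variable {Ω : Type*} [MeasurableSpace Ω] {μ : Measure Ω} [IsProbabilityMeasure μ]
  {E : Type*} [Fintype E] [Nonempty E] [DecidableEq E] [MeasurableSpace E]
  [DiscreteMeasurableSpace E] {𝒵 : Type*} [MeasurableSpace 𝒵]
  {p : ℤ → (ℕ → E) × (ℤ → 𝒵) → E → ℝ} {Y : ℤ → Ω → E} {Z : ℤ → Ω → 𝒵}
  {𝒢 : Set (ℤ → 𝒵)} {δ : ℤ → (ℤ → 𝒵) → (ℤ → 𝒵) → ℝ} {ρ : ℝ} {d ℓ : ℕ}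

/-- The block `(V_{j_1}, …, V_{j_ℓ})` as a function of the history at time `N` and the
exogenous path. -/
def blockMap (h : 𝒵 → Vec d) (N : ℕ) (J : Fin ℓ → ℤ) (s : (ℕ → E) × (ℤ → 𝒵)) :
    Fin ℓ → E × Vec d :=
  fun i => (s.1 (N - J i).toNat, h (s.2 (J i)))

lemma measurable_blockMap {h : 𝒵 → Vec d} (hh : Measurable h) (N : ℕ) (J : Fin ℓ → ℤ) :
    Measurable (blockMap (E := E) h N J) :=
  measurable_pi_iff.2 fun i => ((measurable_pi_apply _).comp measurable_fst).prodMk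
    (hh.comp ((measurable_pi_apply (J i)).comp measurable_snd))

lemma blockMap_hist (h : 𝒵 → Vec d) {N : ℕ} {J : Fin ℓ → ℤ} (hJ : ∀ i, J i ≤ N) (ω : Ω) :
    blockMap h N J (hist Y Z N ω) = fun i => (Y (J i) ω, h (Z (J i) ω)) := by
  funext i
  simp only [blockMap, hist, pastSeq, path]
  have := hJ i
  congr 2
  omega

/-- The conditional law of a block given the past of the responses and of the exogenous
process. -/
def blockKernel (p : ℤ → (ℕ → E) × (ℤ → 𝒵) → E → ℝ) (hp : ∀ t w, Measurable fun s => p t s w)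
    (Q : Kernel (ℕ → 𝒵) (ℕ → 𝒵)) (h : 𝒵 → Vec d) (N : ℕ) (J : Fin ℓ → ℤ) :
    Kernel ((ℕ → E) × (ℕ → 𝒵)) (Fin ℓ → E × Vec d) :=
  ((runKernel (fun n => p (0 + 1 + n)) (fun n => hp (0 + 1 + n)) N).map (blockMap h N J)) ∘ₖ
    ((Kernel.id ×ₖ Q.comap Prod.snd measurable_snd).map
      fun ab : ((ℕ → E) × (ℕ → 𝒵)) × (ℕ → 𝒵) => (ab.1.1, glue ab.1.2 ab.2))

lemma measurable_glue_pair :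
    Measurable fun ab : ((ℕ → E) × (ℕ → 𝒵)) × (ℕ → 𝒵) => (ab.1.1, glue ab.1.2 ab.2) :=
  (measurable_fst.comp measurable_fst).prodMk
    (measurable_glue.comp ((measurable_snd.comp measurable_fst).prodMk measurable_snd))

lemma HasTransition.isMarkovKernel_run (hT : HasTransition p Y Z μ) (t : ℤ) (N : ℕ) :
    IsMarkovKernel (runKernel (fun n => p (t + 1 + n)) (fun n => hT.measurable (t + 1 + n)) N) :=
  isMarkovKernel_runKernel _ (fun n => hT.nonneg (t + 1 + n))
    (fun n => hT.sum_eq_one (t + 1 + n)) N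

lemma HasTransition.isMarkovKernel_block (hT : HasTransition p Y Z μ)
    (Q : Kernel (ℕ → 𝒵) (ℕ → 𝒵)) [IsMarkovKernel Q] {h : 𝒵 → Vec d} (hh : Measurable h)
    (N : ℕ) (J : Fin ℓ → ℤ) : IsMarkovKernel (blockKernel p hT.measurable Q h N J) := by
  have := hT.isMarkovKernel_run 0 N
  have h1 := Kernel.IsMarkovKernel.map
    (runKernel (fun n => p (0 + 1 + n)) (fun n => hT.measurable (0 + 1 + n)) N)
    (measurable_blockMap (E := E) hh N J)
  have h2 := Kernel.IsMarkovKernel.map (Kernel.id ×ₖ Q.comap Prod.snd measurable_snd)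
    (measurable_glue_pair (E := E) (𝒵 := 𝒵))
  unfold blockKernel
  infer_instance

lemma blockKernel_apply' (hT : HasTransition p Y Z μ) (Q : Kernel (ℕ → 𝒵) (ℕ → 𝒵))
    [IsMarkovKernel Q] {h : 𝒵 → Vec d} (hh : Measurable h) (N : ℕ) (J : Fin ℓ → ℤ)
    (a : (ℕ → E) × (ℕ → 𝒵)) {B : Set (Fin ℓ → E × Vec d)} (hB : MeasurableSet B) :
    blockKernel p hT.measurable Q h N J a B =
      ∫⁻ b, runKernel (fun n => p (0 + 1 + n)) (fun n => hT.measurable (0 + 1 + n)) N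
        (a.1, glue a.2 b) (blockMap h N J ⁻¹' B) ∂(Q a.2) := by
  have hBm := measurable_blockMap (E := E) hh N J
  have hg := measurable_glue_pair (E := E) (𝒵 := 𝒵)
  let K : (ℕ → E) × (ℤ → 𝒵) → ℝ≥0∞ := fun s =>
    ((runKernel (fun n => p (0 + 1 + n)) (fun n => hT.measurable (0 + 1 + n)) N).map
      (blockMap h N J)) s B
  have hK : Measurable K := Kernel.measurable_coe _ hB
  have hKg : Measurable fun ab : ((ℕ → E) × (ℕ → 𝒵)) × (ℕ → 𝒵) => K (ab.1.1, glue ab.1.2 ab.2) :=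
    hK.comp hg
  rw [blockKernel, Kernel.comp_apply' _ _ _ hB]
  change ∫⁻ s, K s ∂_ = _
  rw [Kernel.lintegral_map _ hg _ hK, Kernel.prod_apply, Kernel.id_apply,
    lintegral_prod _ hKg.aemeasurable, lintegral_dirac' _ hKg.lintegral_prod_right']
  simp only [Kernel.comap_apply, K, Kernel.map_apply' _ hBm _ hB]

/-- The kernel `blockKernel` is the conditional law of the block. -/
lemma Forgetting.condDistrib_block (hF : Forgetting p 𝒢 δ ρ) (hT : HasTransition p Y Z μ)
    (h𝒢 : ∀ᵐ ω ∂μ, path Z ω ∈ 𝒢) {Q : Kernel (ℕ → 𝒵) (ℕ → 𝒵)} [IsMarkovKernel Q]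
    (hQ : μ.map (fun ω => (pastSeq (path Z ω) 0, futSeq (path Z ω))) =
      μ.map (fun ω => pastSeq (path Z ω) 0) ⊗ₘ Q)
    {h : 𝒵 → Vec d} (hh : Measurable h) {N : ℕ} {J : Fin ℓ → ℤ} (hJ : ∀ i, J i ≤ N) :
    μ.map (fun ω => (pastPair Y Z ω, fun i => (Y (J i) ω, h (Z (J i) ω)))) =
      μ.map (pastPair Y Z) ⊗ₘ blockKernel p hT.measurable Q h N J := by
  have hξ := measurable_pastPair hT.measurable_resp hT.measurable_exog
  have hZm := measurable_path hT.measurable_exog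
  have hZf : Measurable fun ω => futSeq (path Z ω) := measurable_futSeq.comp hZm
  have hBm := measurable_blockMap (E := E) hh N J
  have hhist := measurable_hist hT.measurable_resp hT.measurable_exog
  have hblock : (fun ω => fun i => (Y (J i) ω, h (Z (J i) ω))) =
      fun ω => blockMap h N J (hist Y Z N ω) := by
    funext ω
    exact (blockMap_hist h hJ ω).symm
  have hU : Measurable (fun ω => fun i => (Y (J i) ω, h (Z (J i) ω))) := by
    rw [hblock]
    exact hBm.comp (hhist N)
  have := hT.isMarkovKernel_block Q hh N J
  have := hT.isMarkovKernel_run 0 N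
  have hpr := Measure.isProbabilityMeasure_map (μ := μ) hξ.aemeasurable
  have hprU := Measure.isProbabilityMeasure_map (μ := μ) (hξ.prodMk hU).aemeasurable
  refine Measure.ext_prod fun {A B} hA hB => ?_
  rw [Measure.compProd_apply_prod hA hB, Measure.map_apply (hξ.prodMk hU) (hA.prod hB)]
  set R := runKernel (fun n => p (0 + 1 + n)) (fun n => hT.measurable (0 + 1 + n)) N with hR
  -- The event on the past, read from the history at time `0`; it is recovered from the history at
  -- time `N` by dropping the `N` newest responses.
  let g : (ℕ → E) × (ℤ → 𝒵) → ℝ≥0∞ := fun s => A.indicator 1 (s.1, pastSeq s.2 0)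
  have hgm : Measurable g := (measurable_one.indicator hA).comp
    (measurable_fst.prodMk ((measurable_pastSeq 0).comp measurable_snd))
  let F : (ℕ → E) × (ℤ → 𝒵) → ℝ≥0∞ := fun s => (blockMap h N J ⁻¹' B).indicator 1 s
  have hFm : Measurable F := measurable_one.indicator (hBm hB)
  have hdrop : Measurable fun a : (ℕ → E) × (ℤ → 𝒵) => ((fun i => a.1 (i + N), a.2) :
      (ℕ → E) × (ℤ → 𝒵)) :=
    (measurable_pi_iff.2 fun i => (measurable_pi_apply (i + N)).comp measurable_fst).prodMk
      measurable_snd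
  have hgF : Measurable fun a : (ℕ → E) × (ℤ → 𝒵) => g (fun i => a.1 (i + N), a.2) * F a :=
    (hgm.comp hdrop).mul hFm
  have hset : MeasurableSet ((fun ω => (pastPair Y Z ω, fun i => (Y (J i) ω, h (Z (J i) ω)))) ⁻¹'
      A ×ˢ B) := (hξ.prodMk hU) (hA.prod hB)
  have h1 : μ ((fun ω => (pastPair Y Z ω, fun i => (Y (J i) ω, h (Z (J i) ω)))) ⁻¹' A ×ˢ B) =
      ∫⁻ ω, g (fun i => (hist Y Z (0 + N) ω).1 (i + N), (hist Y Z (0 + N) ω).2) *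
        F (hist Y Z (0 + N) ω) ∂μ := by
    rw [← lintegral_indicator_one hset]
    refine lintegral_congr fun ω => ?_
    rw [zero_add]
    have e1 : ((fun i => (hist Y Z N ω).1 (i + N), pastSeq (hist Y Z N ω).2 0) :
        (ℕ → E) × (ℕ → 𝒵)) = pastPair Y Z ω := by
      refine Prod.ext ?_ rfl
      funext i
      simp only [hist, pastSeq, path, pastPair]
      congr 1
      push_cast
      ring
    have e2 : (hist Y Z N ω ∈ blockMap h N J ⁻¹' B) ↔
        (fun i => (Y (J i) ω, h (Z (J i) ω))) ∈ B := by
      rw [Set.mem_preimage, blockMap_hist h hJ]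
    simp only [g, F, e1]
    by_cases ha : pastPair Y Z ω ∈ A <;>
      by_cases hb : (fun i => (Y (J i) ω, h (Z (J i) ω))) ∈ B <;>
      simp [ha, hb, Set.indicator, e2]
  have h2 : ∫⁻ ω, g (fun i => (hist Y Z (0 + N) ω).1 (i + N), (hist Y Z (0 + N) ω).2) *
        F (hist Y Z (0 + N) ω) ∂μ =
      ∫⁻ ω, g (hist Y Z 0 ω) * R (hist Y Z 0 ω) (blockMap h N J ⁻¹' B) ∂μ := by
    -- The history at `N` is obtained by running the chain from time `0`, and the factor `g` is
    -- known at the start, so it leaves the expectation over the run.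
    have hRB : Measurable fun s => g s * R s (blockMap h N J ⁻¹' B) :=
      hgm.mul (Kernel.measurable_coe _ (hBm hB))
    rw [← lintegral_map (f := fun a => g (fun i => a.1 (i + N), a.2) * F a) hgF (hhist _),
      hT.map_hist_run, Measure.lintegral_bind (Kernel.aemeasurable _) hgF.aemeasurable]
    simp only [lintegral_runKernel_mul _ N hgm hFm]
    rw [lintegral_map _ (hhist 0)]
    · refine lintegral_congr fun ω => ?_
      rw [← lintegral_indicator_one (hBm hB)]
    · exact hgm.mul (hFm.lintegral_kernel)
  let K : ((ℕ → E) × (ℕ → 𝒵)) × (ℕ → 𝒵) → ℝ≥0∞ := fun ab =>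
    A.indicator 1 ab.1 * R (ab.1.1, glue ab.1.2 ab.2) (blockMap h N J ⁻¹' B)
  have hK : Measurable K := ((measurable_one.indicator hA).comp measurable_fst).mul
    ((Kernel.measurable_coe _ (hBm hB)).comp measurable_glue_pair)
  have h3 : ∀ ω, g (hist Y Z 0 ω) * R (hist Y Z 0 ω) (blockMap h N J ⁻¹' B) =
      K (pastPair Y Z ω, futSeq (path Z ω)) := by
    intro ω
    simp only [K, g, pastPair, hist, glue_pastSeq_futSeq]
  rw [h1, h2]
  simp only [h3]
  rw [← lintegral_map hK (hξ.prodMk hZf), hF.map_pastPair_futSeq hT h𝒢 hQ,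
    Measure.lintegral_compProd hK, ← lintegral_indicator hA]
  refine lintegral_congr fun a => ?_
  simp only [K, Kernel.comap_apply]
  by_cases ha : a ∈ A
  · rw [Set.indicator_of_mem ha, Set.indicator_of_mem ha, blockKernel_apply' hT Q hh N J a hB]
    simp [hR]
  · rw [Set.indicator_of_notMem ha, Set.indicator_of_notMem ha]
    simp

lemma integral_blockKernel (hT : HasTransition p Y Z μ) (Q : Kernel (ℕ → 𝒵) (ℕ → 𝒵))
    [IsMarkovKernel Q] {h : 𝒵 → Vec d} (hh : Measurable h) (N : ℕ) (J : Fin ℓ → ℤ)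
    (a : (ℕ → E) × (ℕ → 𝒵)) {F : (Fin ℓ → E × Vec d) → ℝ} (hF : Measurable F) {M : ℝ}
    (hM : ∀ v, |F v| ≤ M) :
    ∫ v, F v ∂(blockKernel p hT.measurable Q h N J a) =
      ∫ b, ∫ s, F (blockMap h N J s)
        ∂(runKernel (fun n => p (0 + 1 + n)) (fun n => hT.measurable (0 + 1 + n)) N
          (a.1, glue a.2 b)) ∂(Q a.2) := by
  have hBm := measurable_blockMap (E := E) hh N J
  have hg := measurable_glue_pair (E := E) (𝒵 := 𝒵)
  have := hT.isMarkovKernel_block Q hh N J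
  have := hT.isMarkovKernel_run 0 N
  have hint : Integrable F (blockKernel p hT.measurable Q h N J a) :=
    Integrable.of_bound hF.aestronglyMeasurable M (Eventually.of_forall hM)
  have hΦ : StronglyMeasurable fun s => ∫ s', F (blockMap h N J s')
      ∂(runKernel (fun n => p (0 + 1 + n)) (fun n => hT.measurable (0 + 1 + n)) N s) :=
    (hF.comp hBm).stronglyMeasurable.integral_kernel
  rw [blockKernel] at hint ⊢
  rw [Kernel.integral_comp hint]
  simp only [Kernel.map_apply _ hBm, integral_map hBm.aemeasurable hF.aestronglyMeasurable]
  rw [Kernel.map_apply _ hg, integral_map hg.aemeasurable hΦ.aestronglyMeasurable,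
    Kernel.prod_apply, Kernel.id_apply, integral_prod, integral_dirac', Kernel.comap_apply]
  · exact (hΦ.comp_measurable hg).integral_prod_right'
  · refine Integrable.of_bound (hΦ.comp_measurable hg).aestronglyMeasurable M
      (Eventually.of_forall fun ab => ?_)
    exact abs_integral_le_of_abs_le fun s => hM _

/-- The coupling bound for the distance between a block for two exogenous paths. -/
def blockCost (γ : Vec d → Vec d → ℝ≥0∞) (h : 𝒵 → Vec d) (ρ : ℝ)
    (δ : ℤ → (ℤ → 𝒵) → (ℤ → 𝒵) → ℝ) (t : ℤ) (z z' : ℤ → 𝒵) : ℝ≥0∞ :=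
  γ (h (z t)) (h (z' t)) +
    ENNReal.ofReal (accum ρ (fun n => δ (0 + 1 + n) z z') t.toNat)

/-- Once both exogenous paths are fixed, the covariate costs are a constant `e` and only the
responses remain random; `Forgetting.evol_sub_le` bounds their disagreements from arbitrary initial
histories. -/
lemma Forgetting.integral_run_sub_le (hF : Forgetting p 𝒢 δ ρ) (hT : HasTransition p Y Z μ)
    {h : 𝒵 → Vec d} (hh : Measurable h) {N : ℕ} {J : Fin ℓ → ℤ} (hJ : ∀ i, J i ≤ N)
    (hJ1 : ∀ i, 1 ≤ J i) {γ : Vec d → Vec d → ℝ≥0∞}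
    {F : (Fin ℓ → E × Vec d) → ℝ} (hFm : Measurable F) {M : ℝ} (hM : ∀ v, |F v| ≤ M)
    (hLip : ∀ v v', ENNReal.ofReal (F v - F v') ≤
      ∑ i, ((if (v i).1 = (v' i).1 then 0 else 1) + γ (v i).2 (v' i).2))
    {z z' : ℤ → 𝒵} (hz : z ∈ 𝒢) (hz' : z' ∈ 𝒢) (y y' : ℕ → E) :
    ENNReal.ofReal
      (∫ s, F (blockMap h N J s)
        ∂(runKernel (fun n => p (0 + 1 + n)) (fun n => hT.measurable (0 + 1 + n)) N (y, z)) -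
      ∫ s, F (blockMap h N J s)
        ∂(runKernel (fun n => p (0 + 1 + n)) (fun n => hT.measurable (0 + 1 + n)) N (y', z'))) ≤
      ∑ i, blockCost γ h ρ δ (J i) z z' := by
  have hBm := measurable_blockMap (E := E) hh N J
  have hFB : Measurable fun s : (ℕ → E) × (ℤ → 𝒵) => F (blockMap h N J s) := hFm.comp hBm
  rw [integral_runKernel _ (fun n => hT.nonneg _) (fun n => hT.sum_eq_one _) N hFB
    (fun s => hM _), integral_runKernel _ (fun n => hT.nonneg _) (fun n => hT.sum_eq_one _) N
    hFB (fun s => hM _)]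
  simp only [blockCost, Finset.sum_add_distrib]
  set e := ∑ i, γ (h (z (J i))) (h (z' (J i)))
  -- An infinite covariate cost makes the bound trivial; otherwise the comparison takes place in the
  -- reals.
  by_cases het : e = ∞
  · rw [het, top_add]
    exact le_top
  have hu : ∀ s, 0 ≤ accum ρ (fun n => δ (0 + 1 + n) z z') s :=
    accum_nonneg hF.pos.le fun n => hF.nonneg _ _ _
  rw [← ENNReal.ofReal_toReal het, ← ENNReal.ofReal_sum_of_nonneg fun i _ => hu _,
    ← ENNReal.ofReal_add ENNReal.toReal_nonneg (Finset.sum_nonneg fun i _ => hu _)]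
  refine ENNReal.ofReal_le_ofReal ?_
  -- The response at time `J i` is `N - J i` steps behind the newest one, so its disagreement is
  -- accumulated over `J i` steps. The inequality is strict because `J i ≥ 1`.
  have hk : ∀ i, ((N : ℤ) - J i).toNat < N ∧ N - ((N : ℤ) - J i).toNat = (J i).toNat := by
    intro i
    have h1 := hJ i
    have h2 := hJ1 i
    omega
  refine (hF.evol_sub_le hT hz hz' 0 N _ _ e.toReal Finset.univ
    (fun i => ((N : ℤ) - J i).toNat) (fun i _ => (hk i).1) ?_ y y').trans (le_of_eq ?_)
  · intro y y'
    have h1 := hLip (blockMap h N J (y, z)) (blockMap h N J (y', z'))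
    rw [Finset.sum_add_distrib] at h1
    change _ ≤ ∑ i : Fin ℓ, (if y ((N : ℤ) - J i).toNat = y' ((N : ℤ) - J i).toNat
      then (0 : ℝ≥0∞) else 1) + e at h1
    rw [← ENNReal.ofReal_toReal het] at h1
    have h2 : ∑ i : Fin ℓ, (if y ((N : ℤ) - J i).toNat = y' ((N : ℤ) - J i).toNat
        then (0 : ℝ≥0∞) else 1) = ENNReal.ofReal (∑ i : Fin ℓ,
        (if y ((N : ℤ) - J i).toNat = y' ((N : ℤ) - J i).toNat then (0 : ℝ) else 1)) := by
      rw [ENNReal.ofReal_sum_of_nonneg]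
      · refine Finset.sum_congr rfl fun i _ => ?_
        split_ifs <;> simp
      · intro i _
        split_ifs <;> norm_num
    have h3 : (0 : ℝ) ≤ ∑ i : Fin ℓ,
        (if y ((N : ℤ) - J i).toNat = y' ((N : ℤ) - J i).toNat then (0 : ℝ) else 1) :=
      Finset.sum_nonneg fun i _ => by split_ifs <;> norm_num
    rw [h2, add_comm, ← ENNReal.ofReal_add ENNReal.toReal_nonneg h3,
      ENNReal.ofReal_le_ofReal_iff (add_nonneg ENNReal.toReal_nonneg h3)] at h1
    exact h1
  · simp only [(hk _).2]

/-- Expected cost when the exogenous process is continued from the pasts `a` and `a'` by the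
coupling `Qt`. -/
def pastCost (Qt : Kernel ((ℕ → 𝒵) × (ℕ → 𝒵)) ((ℕ → 𝒵) × (ℕ → 𝒵)))
    (c : (ℤ → 𝒵) × (ℤ → 𝒵) → ℝ≥0∞) (aa : (ℕ → 𝒵) × (ℕ → 𝒵)) : ℝ≥0∞ :=
  ∫⁻ b, c (glue aa.1 b.1, glue aa.2 b.2) ∂(Qt aa)

/-- The law of two exogenous paths with independent pasts of law `ν`, coupled in the future. -/
def coupledLaw (Qt : Kernel ((ℕ → 𝒵) × (ℕ → 𝒵)) ((ℕ → 𝒵) × (ℕ → 𝒵))) (ν : Measure (ℕ → 𝒵)) :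
    Measure ((ℤ → 𝒵) × (ℤ → 𝒵)) :=
  ((ν.prod ν) ⊗ₘ Qt).map fun s => (glue s.1.1 s.2.1, glue s.1.2 s.2.2)

lemma measurable_glue_glue :
    Measurable fun s : ((ℕ → 𝒵) × (ℕ → 𝒵)) × ((ℕ → 𝒵) × (ℕ → 𝒵)) =>
      (glue s.1.1 s.2.1, glue s.1.2 s.2.2) :=
  (measurable_glue.comp ((measurable_fst.comp measurable_fst).prodMk
    (measurable_fst.comp measurable_snd))).prodMk
  (measurable_glue.comp ((measurable_snd.comp measurable_fst).prodMk
    (measurable_snd.comp measurable_snd)))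

lemma measurable_pastCost (Qt : Kernel ((ℕ → 𝒵) × (ℕ → 𝒵)) ((ℕ → 𝒵) × (ℕ → 𝒵)))
    [IsMarkovKernel Qt] {c : (ℤ → 𝒵) × (ℤ → 𝒵) → ℝ≥0∞} (hc : Measurable c) :
    Measurable (pastCost Qt c) :=
  (hc.comp measurable_glue_glue).lintegral_kernel_prod_right'

lemma lintegral_coupledLaw (Qt : Kernel ((ℕ → 𝒵) × (ℕ → 𝒵)) ((ℕ → 𝒵) × (ℕ → 𝒵)))
    [IsMarkovKernel Qt] (ν : Measure (ℕ → 𝒵)) [IsProbabilityMeasure ν]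
    {c : (ℤ → 𝒵) × (ℤ → 𝒵) → ℝ≥0∞} (hc : Measurable c) :
    ∫⁻ a, ∫⁻ a', pastCost Qt c (a, a') ∂ν ∂ν = ∫⁻ zz, c zz ∂(coupledLaw Qt ν) := by
  have hcg : Measurable fun s : ((ℕ → 𝒵) × (ℕ → 𝒵)) × ((ℕ → 𝒵) × (ℕ → 𝒵)) =>
    c (glue s.1.1 s.2.1, glue s.1.2 s.2.2) := hc.comp measurable_glue_glue
  rw [coupledLaw, lintegral_map hc measurable_glue_glue, Measure.lintegral_compProd hcg,
    ← lintegral_prod _ (measurable_pastCost Qt hc).aemeasurable]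
  rfl

/-- The conditional law of a block is compared with its law, uniformly over the test functions
that are Lipschitz for the sum of the discrete distances of the responses and the costs `γ` of the
covariates. -/
lemma Forgetting.integral_condLaw_sub_le (hF : Forgetting p 𝒢 δ ρ) (hT : HasTransition p Y Z μ)
    (h𝒢 : ∀ᵐ ω ∂μ, path Z ω ∈ 𝒢) {Q : Kernel (ℕ → 𝒵) (ℕ → 𝒵)} [IsMarkovKernel Q]
    (hQ : μ.map (fun ω => (pastSeq (path Z ω) 0, futSeq (path Z ω))) =
      μ.map (fun ω => pastSeq (path Z ω) 0) ⊗ₘ Q)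
    {Qt : Kernel ((ℕ → 𝒵) × (ℕ → 𝒵)) ((ℕ → 𝒵) × (ℕ → 𝒵))} [IsMarkovKernel Qt]
    (hQt : ∀ s, (Qt s).map Prod.fst = Q s.1 ∧ (Qt s).map Prod.snd = Q s.2)
    {h : 𝒵 → Vec d} (hh : Measurable h) {N : ℕ} {J : Fin ℓ → ℤ} (hJ : ∀ i, J i ≤ N)
    (hJ1 : ∀ i, 1 ≤ J i) {γ : Vec d → Vec d → ℝ≥0∞} {c : (ℤ → 𝒵) × (ℤ → 𝒵) → ℝ≥0∞}
    (hc : Measurable c) (hcost : ∀ z z', ∑ i, blockCost γ h ρ δ (J i) z z' ≤ c (z, z')) :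
    ∀ᵐ ω ∂μ, ∀ F : (Fin ℓ → E × Vec d) → ℝ, Measurable F → (∃ M, ∀ v, |F v| ≤ M) →
      (∀ v v', ENNReal.ofReal (F v - F v') ≤
        ∑ i, ((if (v i).1 = (v' i).1 then 0 else 1) + γ (v i).2 (v' i).2)) →
      ENNReal.ofReal (∫ v, F v ∂(blockKernel p hT.measurable Q h N J (pastPair Y Z ω)) -
        ∫ v, F v ∂(μ.map fun ω i => (Y (J i) ω, h (Z (J i) ω)))) ≤
      ∫⁻ a, pastCost Qt c (pastSeq (path Z ω) 0, a) ∂(μ.map fun ω => pastSeq (path Z ω) 0) := by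
  have hξ := measurable_pastPair hT.measurable_resp hT.measurable_exog
  have hZm := measurable_path hT.measurable_exog
  have hZp : Measurable fun ω => pastSeq (path Z ω) 0 := (measurable_pastSeq 0).comp hZm
  have hZf : Measurable fun ω => futSeq (path Z ω) := measurable_futSeq.comp hZm
  have hBm := measurable_blockMap (E := E) hh N J
  have := hT.isMarkovKernel_block Q hh N J
  have := hT.isMarkovKernel_run 0 N
  have hpr := Measure.isProbabilityMeasure_map (μ := μ) hξ.aemeasurable
  have hpr' := Measure.isProbabilityMeasure_map (μ := μ) hZp.aemeasurable
  set κ := blockKernel p hT.measurable Q h N J with hκ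
  have hU : Measurable (fun ω => fun i => (Y (J i) ω, h (Z (J i) ω))) :=
    measurable_pi_iff.2 fun i =>
      (hT.measurable_resp (J i)).prodMk (hh.comp (hT.measurable_exog (J i)))
  -- almost every past is continued by good paths
  have hgood : ∀ᵐ ω ∂μ, ∀ᵐ b ∂(Q (pastSeq (path Z ω) 0)), glue (pastSeq (path Z ω) 0) b ∈ 𝒢 := by
    refine ae_of_ae_map (f := fun ω => pastSeq (path Z ω) 0)
      (p := fun a => ∀ᵐ b ∂(Q a), glue a b ∈ 𝒢) hZp.aemeasurable ?_
    have h1 : ∀ᵐ ab ∂(μ.map (fun ω => pastSeq (path Z ω) 0) ⊗ₘ Q), glue ab.1 ab.2 ∈ 𝒢 := by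
      rw [← hQ, ae_map_iff (hZp.prodMk hZf).aemeasurable (measurable_glue hF.measurableSet)]
      simpa only [glue_pastSeq_futSeq] using h𝒢
    exact Measure.ae_ae_of_ae_compProd h1
  -- The law of the block is the mixture of its conditional laws, so it suffices to compare the
  -- conditional laws for two pasts and to average over the second one.
  have hlaw : μ.map (fun ω i => (Y (J i) ω, h (Z (J i) ω))) = κ ∘ₘ μ.map (pastPair Y Z) := by
    have h1 := hF.condDistrib_block hT h𝒢 hQ hh hJ
    rw [← Measure.snd_compProd, ← h1, Measure.snd, Measure.map_map measurable_snd (hξ.prodMk hU)]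
    rfl
  -- The exceptional set is chosen before `F`, so the bound holds for all test functions
  -- simultaneously. This is needed for the supremum under the expectation in the coefficients.
  filter_upwards [hgood] with ω hω F hFm hMF hLip
  obtain ⟨M, hM⟩ := hMF
  have hpair : ∀ᵐ ω' ∂μ, ENNReal.ofReal (∫ v, F v ∂(κ (pastPair Y Z ω)) -
      ∫ v, F v ∂(κ (pastPair Y Z ω'))) ≤
      pastCost Qt c (pastSeq (path Z ω) 0, pastSeq (path Z ω') 0) := by
    filter_upwards [hgood] with ω' hω'
    set a := pastPair Y Z ω with ha
    set a' := pastPair Y Z ω' with ha'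
    let R := runKernel (fun n => p (0 + 1 + n)) (fun n => hT.measurable (0 + 1 + n)) N
    let Φ : (ℕ → E) × (ℤ → 𝒵) → ℝ := fun s => ∫ s', F (blockMap h N J s') ∂(R s)
    have hΦ : Measurable Φ := (hFm.comp hBm).stronglyMeasurable.integral_kernel.measurable
    have hΦM : ∀ s, |Φ s| ≤ M := fun s =>
      abs_integral_le_of_abs_le fun s' => hM _
    have hΦa : ∀ a : (ℕ → E) × (ℕ → 𝒵), Measurable fun b => Φ (a.1, glue a.2 b) := fun a =>
      hΦ.comp (measurable_const.prodMk
        (measurable_glue.comp (measurable_const.prodMk measurable_id)))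
    rw [hκ, integral_blockKernel hT Q hh N J a hFm hM, integral_blockKernel hT Q hh N J a' hFm hM]
    change ENNReal.ofReal (∫ b, Φ (a.1, glue a.2 b) ∂(Q a.2) -
      ∫ b, Φ (a'.1, glue a'.2 b) ∂(Q a'.2)) ≤ _
    -- Both futures are realized under the coupling `Qt`, where the two conditional expectations
    -- become a single integral of a difference.
    obtain ⟨hQ1, hQ2⟩ := hQt (a.2, a'.2)
    simp only at hQ1 hQ2
    have hg1 : ∀ᵐ b ∂(Qt (a.2, a'.2)), glue a.2 b.1 ∈ 𝒢 :=
      ae_of_ae_map (p := fun b => glue a.2 b ∈ 𝒢) measurable_fst.aemeasurable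
        (by rw [hQ1]; exact hω)
    have hg2 : ∀ᵐ b ∂(Qt (a.2, a'.2)), glue a'.2 b.2 ∈ 𝒢 :=
      ae_of_ae_map (p := fun b => glue a'.2 b ∈ 𝒢) measurable_snd.aemeasurable
        (by rw [hQ2]; exact hω')
    have hi1 : Integrable (fun b : (ℕ → 𝒵) × (ℕ → 𝒵) => Φ (a.1, glue a.2 b.1))
        (Qt (a.2, a'.2)) :=
      Integrable.of_bound ((hΦa a).comp measurable_fst).aestronglyMeasurable M
        (Eventually.of_forall fun b => hΦM _)
    have hi2 : Integrable (fun b : (ℕ → 𝒵) × (ℕ → 𝒵) => Φ (a'.1, glue a'.2 b.2))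
        (Qt (a.2, a'.2)) :=
      Integrable.of_bound ((hΦa a').comp measurable_snd).aestronglyMeasurable M
        (Eventually.of_forall fun b => hΦM _)
    rw [← hQ1, ← hQ2, integral_map measurable_fst.aemeasurable (hΦa a).aestronglyMeasurable,
      integral_map measurable_snd.aemeasurable (hΦa a').aestronglyMeasurable, ← integral_sub]
    · refine (ofReal_integral_le_lintegral_ofReal (Integrable.sub ?_ ?_)).trans
        (lintegral_mono_ae ?_)
      · exact hi1
      · exact hi2
      filter_upwards [hg1, hg2] with b hb1 hb2
      exact (hF.integral_run_sub_le hT hh hJ hJ1 hFm hM hLip hb1 hb2 _ _).trans (hcost _ _)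
    · exact hi1
    · exact hi2
  have hFκ : Measurable fun a => ∫ v, F v ∂(κ a) :=
    hFm.stronglyMeasurable.integral_kernel.measurable
  have hFκM : ∀ a, |∫ v, F v ∂(κ a)| ≤ M := fun a =>
    abs_integral_le_of_abs_le hM
  rw [hlaw, integral_measure_comp
    (Integrable.of_bound hFm.aestronglyMeasurable M (Eventually.of_forall hM)),
    integral_map hξ.aemeasurable hFκ.aestronglyMeasurable]
  have hconst : ∫ v, F v ∂(κ (pastPair Y Z ω)) = ∫ _ω', ∫ v, F v ∂(κ (pastPair Y Z ω)) ∂μ := by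
    simp
  have hi : Integrable (fun ω' => ∫ v, F v ∂(κ (pastPair Y Z ω'))) μ :=
    Integrable.of_bound (hFκ.comp hξ).aestronglyMeasurable M (Eventually.of_forall fun b => hFκM _)
  have hcm : Measurable fun a => pastCost Qt c (pastSeq (path Z ω) 0, a) :=
    (measurable_pastCost Qt hc).comp (measurable_const.prodMk measurable_id)
  rw [hconst, ← integral_sub (integrable_const _) hi, lintegral_map hcm hZp]
  exact (ofReal_integral_le_lintegral_ofReal ((integrable_const _).sub hi)).trans
    (lintegral_mono_ae hpair)

end Block


/-! ### Bounds for the dependence coefficients -/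

section Coefficients

lemma compProd_map_comap {α α' β : Type*} [MeasurableSpace α] [MeasurableSpace α']
    [MeasurableSpace β] {ν : Measure α} [IsFiniteMeasure ν] {κ : Kernel α β} [IsMarkovKernel κ]
    {e : α → α'} (he : Measurable e) {e' : α' → α} (he' : Measurable e')
    (hee' : ∀ a, e' (e a) = a) :
    (ν ⊗ₘ κ).map (Prod.map e id) = ν.map e ⊗ₘ κ.comap e' he' := by
  refine Measure.ext_prod fun {A B} hA hB => ?_
  rw [Measure.map_apply (he.prodMap measurable_id) (hA.prod hB),
    Measure.compProd_apply_prod hA hB, setLIntegral_map hA (Kernel.measurable_coe _ hB) he]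
  have : Prod.map e id ⁻¹' A ×ˢ B = (e ⁻¹' A) ×ˢ B := rfl
  rw [this, Measure.compProd_apply_prod (he hA) hB]
  simp only [Kernel.comap_apply, hee']

variable {Ω : Type*} [MeasurableSpace Ω] {μ : Measure Ω} [IsProbabilityMeasure μ]
  {E : Type*} [Fintype E] [Nonempty E] [DecidableEq E] [MeasurableSpace E]
  [DiscreteMeasurableSpace E] {𝒵 : Type*} [MeasurableSpace 𝒵]
  {p : ℤ → (ℕ → E) × (ℤ → 𝒵) → E → ℝ} {Y : ℤ → Ω → E} {Z : ℤ → Ω → 𝒵}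
  {𝒢 : Set (ℤ → 𝒵)} {δ : ℤ → (ℤ → 𝒵) → (ℤ → 𝒵) → ℝ} {ρ : ℝ} {d ℓ : ℕ}

/-- Almost sure uniqueness of conditional distributions. The maps `e` and `e'` translate between a
pair of sequences and a sequence of pairs, the form in which the coefficients condition. -/
lemma Forgetting.condDistrib_ae_eq (hF : Forgetting p 𝒢 δ ρ) (hT : HasTransition p Y Z μ)
    (h𝒢 : ∀ᵐ ω ∂μ, path Z ω ∈ 𝒢) {Q : Kernel (ℕ → 𝒵) (ℕ → 𝒵)} [IsMarkovKernel Q]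
    (hQ : μ.map (fun ω => (pastSeq (path Z ω) 0, futSeq (path Z ω))) =
      μ.map (fun ω => pastSeq (path Z ω) 0) ⊗ₘ Q)
    {h : 𝒵 → Vec d} (hh : Measurable h) {N : ℕ} {J : Fin ℓ → ℤ} (hJ : ∀ i, J i ≤ N) :
    ∀ᵐ ω ∂μ, condDistrib (fun ω i => (Y (J i) ω, h (Z (J i) ω)))
      (fun ω => pastSeq (fun t => (Y t ω, Z t ω)) 0) μ (pastSeq (fun t => (Y t ω, Z t ω)) 0) =
      blockKernel p hT.measurable Q h N J (pastPair Y Z ω) := by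
  have hξ := measurable_pastPair hT.measurable_resp hT.measurable_exog
  have hU : Measurable (fun ω => fun i => (Y (J i) ω, h (Z (J i) ω))) :=
    measurable_pi_iff.2 fun i =>
      (hT.measurable_resp (J i)).prodMk (hh.comp (hT.measurable_exog (J i)))
  have := hT.isMarkovKernel_block Q hh N J
  let e : (ℕ → E) × (ℕ → 𝒵) → ℕ → E × 𝒵 := fun a i => (a.1 i, a.2 i)
  let e' : (ℕ → E × 𝒵) → (ℕ → E) × (ℕ → 𝒵) := fun a => (fun i => (a i).1, fun i => (a i).2)
  have he : Measurable e := measurable_pi_iff.2 fun i =>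
    ((measurable_pi_apply i).comp measurable_fst).prodMk
      ((measurable_pi_apply i).comp measurable_snd)
  have he' : Measurable e' :=
    (measurable_pi_iff.2 fun i => measurable_fst.comp (measurable_pi_apply i)).prodMk
      (measurable_pi_iff.2 fun i => measurable_snd.comp (measurable_pi_apply i))
  have hpr := Measure.isProbabilityMeasure_map (μ := μ) hξ.aemeasurable
  have h1 := congrArg (Measure.map (Prod.map e id)) (hF.condDistrib_block hT h𝒢 hQ hh hJ)
  rw [compProd_map_comap he he' (fun a => rfl), Measure.map_map he hξ,
    Measure.map_map (he.prodMap measurable_id) (hξ.prodMk hU)] at h1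
  exact ae_of_ae_map (he.comp hξ).aemeasurable
    (condDistrib_ae_eq_of_measure_eq_compProd _ hU.aemeasurable h1)

lemma measurable_blockCost {γ : Vec d → Vec d → ℝ≥0∞}
    (hγ : Measurable fun x : Vec d × Vec d => γ x.1 x.2) {h : 𝒵 → Vec d} (hh : Measurable h)
    (hδ : ∀ t, Measurable fun zz : (ℤ → 𝒵) × (ℤ → 𝒵) => δ t zz.1 zz.2) (t : ℤ) :
    Measurable fun zz : (ℤ → 𝒵) × (ℤ → 𝒵) => blockCost γ h ρ δ t zz.1 zz.2 := by
  have h1 : ∀ s, Measurable fun zz : (ℤ → 𝒵) × (ℤ → 𝒵) =>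
      accum ρ (fun n => δ (0 + 1 + n) zz.1 zz.2) s := by
    intro s
    induction s with
    | zero => exact measurable_const
    | succ s ih => exact (ih.const_mul ρ).add (hδ _)
  refine Measurable.add ?_ (h1 _).ennreal_ofReal
  exact hγ.comp ((hh.comp ((measurable_pi_apply t).comp measurable_fst)).prodMk
    (hh.comp ((measurable_pi_apply t).comp measurable_snd)))

/-- The supremum in `wasserstein` runs over all Lipschitz functions, without a measurability
condition. For fixed responses such a function is continuous in the covariates, and there are
finitely many response patterns. -/
lemma measurable_of_pairDist_lipschitz {f : (Fin ℓ → E × Vec d) → ℝ}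
    (hf : ∀ w w', |f w - f w'| ≤ ∑ i, pairDist (w i) (w' i)) : Measurable f := by
  let F : (Fin ℓ → E) → (Fin ℓ → Vec d) → ℝ := fun y x => f fun i => (y i, x i)
  have hFm : ∀ y, Measurable (F y) := by
    intro y
    refine Continuous.measurable ?_
    rw [continuous_iff_continuousAt]
    intro x
    rw [ContinuousAt, tendsto_iff_dist_tendsto_zero]
    have hlim : Tendsto (fun x' : Fin ℓ → Vec d => ∑ i, ‖x' i - x i‖) (𝓝 x) (𝓝 0) := by
      have : Continuous fun x' : Fin ℓ → Vec d => ∑ i, ‖x' i - x i‖ := by fun_prop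
      simpa using this.tendsto x
    refine squeeze_zero (fun _ => dist_nonneg) (fun x' => ?_) hlim
    rw [Real.dist_eq]
    refine (hf _ _).trans (le_of_eq ?_)
    simp [pairDist]
  have hFF : Measurable fun s : (Fin ℓ → E) × (Fin ℓ → Vec d) => F s.1 s.2 :=
    measurable_from_prod_countable_right hFm
  exact hFF.comp ((measurable_pi_iff.2 fun i => measurable_fst.comp (measurable_pi_apply i)).prodMk
    (measurable_pi_iff.2 fun i => measurable_snd.comp (measurable_pi_apply i)))

lemma pairDist_nonneg (v v' : E × Vec d) : 0 ≤ pairDist v v' := by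
  unfold pairDist
  split_ifs <;> positivity

lemma ofReal_pairDist (v v' : E × Vec d) :
    ENNReal.ofReal (pairDist v v') = (if v.1 = v'.1 then 0 else 1) + normCost v.2 v'.2 := by
  unfold pairDist normCost
  rw [ENNReal.ofReal_add (by split_ifs <;> norm_num) (norm_nonneg _)]
  split_ifs <;> simp

lemma abs_clamp_sub_clamp_le (M a b : ℝ) :
    |max (-M) (min M a) - max (-M) (min M b)| ≤ |a - b| := by
  refine (abs_max_sub_max_le_max _ _ _ _).trans ?_
  rw [sub_self, abs_zero, max_eq_right (abs_nonneg _)]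
  refine (abs_min_sub_min_le_max _ _ _ _).trans ?_
  rw [sub_self, abs_zero, max_eq_right (abs_nonneg _)]

/-- The comparison of conditional laws is for bounded test functions. Truncation preserves the
Lipschitz condition, by `abs_clamp_sub_clamp_le`, and this limit removes it. -/
lemma tendsto_integral_clamp {α : Type*} [MeasurableSpace α] {ν : Measure α} {f : α → ℝ}
    (hf : Integrable f ν) :
    Tendsto (fun M : ℕ => ∫ a, max (-(M : ℝ)) (min M (f a)) ∂ν) atTop (𝓝 (∫ a, f a ∂ν)) := by
  refine tendsto_integral_of_dominated_convergence (fun a => |f a|) ?_ hf.abs ?_ ?_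
  · intro M
    exact (aestronglyMeasurable_const.sup (aestronglyMeasurable_const.inf hf.1))
  · intro M
    refine Eventually.of_forall fun a => ?_
    have h1 := abs_clamp_sub_clamp_le M (f a) 0
    have hM : (0 : ℝ) ≤ M := Nat.cast_nonneg M
    rw [min_eq_right hM, max_eq_right (neg_nonpos.2 hM), sub_zero, sub_zero] at h1
    exact h1
  · refine Eventually.of_forall fun a => ?_
    refine tendsto_const_nhds.congr' ?_
    obtain ⟨m, hm⟩ := exists_nat_ge |f a|
    filter_upwards [eventually_ge_atTop m] with M hM
    have hM' : |f a| ≤ M := hm.trans (Nat.cast_le.2 hM)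
    rw [min_eq_right (abs_le.1 hM').2, max_eq_right (abs_le.1 hM').1]

/-- Bound for the coefficient `τ` of a block. -/
lemma Forgetting.tauBlock_le (hF : Forgetting p 𝒢 δ ρ) (hT : HasTransition p Y Z μ)
    (h𝒢 : ∀ᵐ ω ∂μ, path Z ω ∈ 𝒢) {Q : Kernel (ℕ → 𝒵) (ℕ → 𝒵)} [IsMarkovKernel Q]
    (hQ : μ.map (fun ω => (pastSeq (path Z ω) 0, futSeq (path Z ω))) =
      μ.map (fun ω => pastSeq (path Z ω) 0) ⊗ₘ Q)
    {Qt : Kernel ((ℕ → 𝒵) × (ℕ → 𝒵)) ((ℕ → 𝒵) × (ℕ → 𝒵))} [IsMarkovKernel Qt]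
    (hQt : ∀ s, (Qt s).map Prod.fst = Q s.1 ∧ (Qt s).map Prod.snd = Q s.2)
    {h : 𝒵 → Vec d} (hh : Measurable h)
    (hδ : ∀ t, Measurable fun zz : (ℤ → 𝒵) × (ℤ → 𝒵) => δ t zz.1 zz.2)
    (hint : ∀ t, Integrable (fun ω => h (Z t ω)) μ) {J : Fin ℓ → ℤ} (hJ1 : ∀ i, 1 ≤ J i) :
    tauBlock (fun t ω => (Y t ω, h (Z t ω))) (fun ω => pastSeq (fun t => (Y t ω, Z t ω)) 0) μ J ≤
      ∑ i, ∫⁻ zz, blockCost normCost h ρ δ (J i) zz.1 zz.2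
        ∂(coupledLaw Qt (μ.map fun ω => pastSeq (path Z ω) 0)) := by
  obtain ⟨N, hJ⟩ : ∃ N : ℕ, ∀ i, J i ≤ N := by
    refine ⟨∑ i, (J i).toNat, fun i => ?_⟩
    have h1 : (J i).toNat ≤ ∑ i, (J i).toNat :=
      Finset.single_le_sum (f := fun i => (J i).toNat) (fun _ _ => Nat.zero_le _)
        (Finset.mem_univ i)
    omega
  have hZp : Measurable fun ω => pastSeq (path Z ω) 0 :=
    (measurable_pastSeq 0).comp (measurable_path hT.measurable_exog)
  have hU : Measurable (fun ω => fun i => (Y (J i) ω, h (Z (J i) ω))) :=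
    measurable_pi_iff.2 fun i =>
      (hT.measurable_resp (J i)).prodMk (hh.comp (hT.measurable_exog (J i)))
  have hYZ : Measurable fun ω => pastSeq (fun t => (Y t ω, Z t ω)) 0 :=
    measurable_pi_iff.2 fun i => (hT.measurable_resp _).prodMk (hT.measurable_exog _)
  have hprp := Measure.isProbabilityMeasure_map (μ := μ) hYZ.aemeasurable
  have hpr' := Measure.isProbabilityMeasure_map (μ := μ) hZp.aemeasurable
  have hnc : Measurable fun x : Vec d × Vec d => normCost x.1 x.2 := by
    unfold normCost
    exact (measurable_fst.sub measurable_snd).norm.ennreal_ofReal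
  have hbc := measurable_blockCost (ρ := ρ) hnc hh hδ
  set c : (ℤ → 𝒵) × (ℤ → 𝒵) → ℝ≥0∞ := fun zz =>
    ∑ i, blockCost normCost h ρ δ (J i) zz.1 zz.2 with hcdef
  have hc : Measurable c := Finset.measurable_sum _ fun i _ => hbc (J i)
  rw [← lintegral_finsetSum _ fun i _ => hbc (J i), ← hcdef, ← lintegral_coupledLaw Qt _ hc,
    lintegral_map (measurable_pastCost Qt hc).lintegral_prod_right' hZp]
  refine lintegral_mono_ae ?_
  -- a function dominating all test functions
  obtain ⟨w₀⟩ := ‹Nonempty E›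
  let v₀ : Fin ℓ → E × Vec d := fun _ => (w₀, 0)
  have hD : Integrable (fun v : Fin ℓ → E × Vec d => ∑ i, pairDist (v i) (v₀ i))
      (μ.map fun ω i => (Y (J i) ω, h (Z (J i) ω))) := by
    have hDm : Measurable fun v : Fin ℓ → E × Vec d => ∑ i, pairDist (v i) (v₀ i) := by
      refine Finset.measurable_sum _ fun i _ => Measurable.add ?_ ?_
      · exact (measurable_of_finite fun w => if w = w₀ then (0 : ℝ) else 1).comp
          (measurable_fst.comp (measurable_pi_apply i))
      · exact ((measurable_snd.comp (measurable_pi_apply i)).sub measurable_const).norm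
    rw [integrable_map_measure hDm.aestronglyMeasurable hU.aemeasurable]
    refine integrable_finsetSum _ fun i _ => Integrable.add ?_ ?_
    · refine Integrable.of_bound (Measurable.aestronglyMeasurable ?_) 1
        (Eventually.of_forall fun ω => ?_)
      · exact (measurable_of_finite fun w => if w = w₀ then (0 : ℝ) else 1).comp
          (hT.measurable_resp (J i))
      · split_ifs <;> simp
    · simpa [v₀] using (hint (J i)).norm
  have hDκ : ∀ᵐ ω ∂μ, Integrable (fun v : Fin ℓ → E × Vec d => ∑ i, pairDist (v i) (v₀ i))
      (condDistrib (fun ω i => (Y (J i) ω, h (Z (J i) ω)))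
        (fun ω => pastSeq (fun t => (Y t ω, Z t ω)) 0) μ
        (pastSeq (fun t => (Y t ω, Z t ω)) 0)) := by
    -- The law of the block is the mixture of its conditional laws, so integrability under it passes
    -- to almost every conditional law.
    rw [← condDistrib_comp_map hYZ.aemeasurable hU.aemeasurable] at hD
    exact ae_of_ae_map hYZ.aemeasurable (Measure.ae_integrable_of_integrable_comp hD)
  filter_upwards [hDκ, hF.condDistrib_ae_eq hT h𝒢 hQ hh hJ,
    hF.integral_condLaw_sub_le hT h𝒢 hQ hQt hh hJ hJ1 hc (fun z z' => le_rfl)] with ω hω1 hω2 hω3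
  refine iSup₂_le fun f hf => ?_
  have hfm := measurable_of_pairDist_lipschitz hf
  have hfint : ∀ {ν : Measure (Fin ℓ → E × Vec d)} [IsFiniteMeasure ν],
      Integrable (fun v : Fin ℓ → E × Vec d => ∑ i, pairDist (v i) (v₀ i)) ν → Integrable f ν := by
    intro ν _ hν
    refine Integrable.mono' (hν.add (integrable_const |f v₀|)) hfm.aestronglyMeasurable
      (Eventually.of_forall fun v => ?_)
    have h1 := hf v v₀
    have h2 := abs_sub_abs_le_abs_sub (f v) (f v₀)
    simp only [Pi.add_apply, Real.norm_eq_abs]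
    linarith
  have hprU := Measure.isProbabilityMeasure_map (μ := μ) hU.aemeasurable
  -- The bound is uniform in the truncation level, so it passes to the limit.
  have hl := (tendsto_integral_clamp (hfint hω1)).sub (tendsto_integral_clamp (hfint hD))
  refine le_of_tendsto (ENNReal.continuous_ofReal.continuousAt.tendsto.comp hl)
    (Eventually.of_forall fun M => ?_)
  simp only [Function.comp_apply]
  rw [hω2]
  refine hω3 (fun v => max (-(M : ℝ)) (min M (f v)))
    (measurable_const.max (measurable_const.min hfm)) ⟨M, fun v => ?_⟩ fun v v' => ?_
  · have hM : (0 : ℝ) ≤ M := Nat.cast_nonneg M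
    exact abs_le.2 ⟨le_max_left _ _, max_le (by linarith) (min_le_left _ _)⟩
  · have h1 : max (-(M : ℝ)) (min M (f v)) - max (-(M : ℝ)) (min M (f v')) ≤
        ∑ i, pairDist (v i) (v' i) :=
      (le_abs_self _).trans ((abs_clamp_sub_clamp_le _ _ _).trans (hf v v'))
    refine (ENNReal.ofReal_le_ofReal h1).trans (le_of_eq ?_)
    rw [ENNReal.ofReal_sum_of_nonneg fun i _ => pairDist_nonneg _ _]
    exact Finset.sum_congr rfl fun i _ => ofReal_pairDist _ _

/-- A bound for the differences of two probability measures on the cylinders extends to all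
measurable sets. -/
lemma abs_measureReal_sub_le_of_cylinder {T : Type*} [MeasurableSpace T] {ν ν' : Measure (ℕ → T)}
    [IsProbabilityMeasure ν] [IsProbabilityMeasure ν'] {b : ℝ}
    (hb : ∀ A ∈ measurableCylinders (fun _ : ℕ => T), |ν.real A - ν'.real A| ≤ b)
    {A : Set (ℕ → T)} (hA : MeasurableSet A) : |ν.real A - ν'.real A| ≤ b := by
  refine le_of_forall_pos_le_add fun ε hε => ?_
  -- The approximating cylinder is chosen for `ν + ν'`, hence is good for both measures.
  obtain ⟨B, hB, hAB⟩ := exists_measure_symmDiff_lt_of_generateFrom_isSetRing (μ := ν + ν')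
    isSetRing_measurableCylinders
    ⟨{Set.univ}, Set.countable_singleton _,
      by simpa using univ_mem_measurableCylinders (fun _ : ℕ => T),
      by simp⟩ generateFrom_measurableCylinders.symm hA (ε := ENNReal.ofReal ε)
      (by simpa using hε)
  have hBm := MeasurableSet.of_mem_measurableCylinders hB
  have h1 : ν.real (symmDiff B A) + ν'.real (symmDiff B A) ≤ ε := by
    have h2 : (ν + ν').real (symmDiff B A) ≤ ε := ENNReal.toReal_le_of_le_ofReal hε.le hAB.le
    rwa [measureReal_add_apply] at h2
  have h2 := abs_measureReal_sub_le_measureReal_symmDiff (μ := ν) hBm.nullMeasurableSet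
    hA.nullMeasurableSet
  have h3 := abs_measureReal_sub_le_measureReal_symmDiff (μ := ν') hBm.nullMeasurableSet
    hA.nullMeasurableSet
  have h4 := abs_le.1 (hb B hB)
  rw [abs_le] at h2 h3
  exact abs_le.2 ⟨by linarith [h2.1, h2.2, h3.1, h3.2], by linarith [h2.1, h2.2, h3.1, h3.2]⟩

/-- Bound for the coefficient of absolute regularity. -/
lemma Forgetting.betaCoeff_le {p : ℤ → (ℕ → E) × (ℤ → Vec d) → E → ℝ} {X : ℤ → Ω → Vec d}
    {𝒢 : Set (ℤ → Vec d)} {δ : ℤ → (ℤ → Vec d) → (ℤ → Vec d) → ℝ}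
    (hF : Forgetting p 𝒢 δ ρ) (hT : HasTransition p Y X μ)
    (h𝒢 : ∀ᵐ ω ∂μ, path X ω ∈ 𝒢) {Q : Kernel (ℕ → Vec d) (ℕ → Vec d)} [IsMarkovKernel Q]
    (hQ : μ.map (fun ω => (pastSeq (path X ω) 0, futSeq (path X ω))) =
      μ.map (fun ω => pastSeq (path X ω) 0) ⊗ₘ Q)
    {Qt : Kernel ((ℕ → Vec d) × (ℕ → Vec d)) ((ℕ → Vec d) × (ℕ → Vec d))} [IsMarkovKernel Qt]
    (hQt : ∀ s, (Qt s).map Prod.fst = Q s.1 ∧ (Qt s).map Prod.snd = Q s.2)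
    (hδ : ∀ t, Measurable fun zz : (ℤ → Vec d) × (ℤ → Vec d) => δ t zz.1 zz.2)
    {n : ℕ} (hn : 1 ≤ n) :
    betaCoeff (fun t ω => (Y t ω, X t ω)) μ n ≤
      ∑' i : ℕ, ∫⁻ zz, blockCost discreteCost id ρ δ (n + i) zz.1 zz.2
        ∂(coupledLaw Qt (μ.map fun ω => pastSeq (path X ω) 0)) := by
  have hXp : Measurable fun ω => pastSeq (path X ω) 0 :=
    (measurable_pastSeq 0).comp (measurable_path hT.measurable_exog)
  have hpr' := Measure.isProbabilityMeasure_map (μ := μ) hXp.aemeasurable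
  have hVm : ∀ t, Measurable fun ω => (Y t ω, X t ω) := fun t =>
    (hT.measurable_resp t).prodMk (hT.measurable_exog t)
  let fut : Ω → ℕ → E × Vec d := fun ω i => (Y (n + i) ω, X (n + i) ω)
  have hfut : Measurable fut := measurable_pi_iff.2 fun i => hVm _
  let ξ : Ω → ℕ → E × Vec d := fun ω => pastSeq (fun t => (Y t ω, X t ω)) 0
  have hξ : Measurable ξ := measurable_pi_iff.2 fun i => hVm _
  have hprf := Measure.isProbabilityMeasure_map (μ := μ) hfut.aemeasurable
  have hdc : Measurable fun x : Vec d × Vec d => discreteCost x.1 x.2 := by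
    unfold discreteCost
    exact Measurable.ite (measurableSet_eq_fun measurable_fst measurable_snd) measurable_const
      measurable_const
  have hbc := measurable_blockCost (ρ := ρ) hdc measurable_id hδ
  set c : (ℤ → Vec d) × (ℤ → Vec d) → ℝ≥0∞ := fun zz =>
    ∑' i : ℕ, blockCost discreteCost id ρ δ (n + i) zz.1 zz.2 with hcdef
  have hc : Measurable c := Measurable.tsum fun i => hbc _
  rw [← lintegral_tsum fun i => (hbc _).aemeasurable, ← hcdef, ← lintegral_coupledLaw Qt _ hc,
    lintegral_map (measurable_pastCost Qt hc).lintegral_prod_right' hXp]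
  refine lintegral_mono_ae ?_
  -- The conditional law of a finite window is the marginal of the conditional law of the infinite
  -- future, outside one null set for all windows.
  have hcomp : ∀ᵐ ω ∂μ, ∀ k : ℕ, condDistrib (fun ω (i : Fin k) => fut ω i) ξ μ (ξ ω) =
      (condDistrib fut ξ μ (ξ ω)).map fun v (i : Fin k) => v i := by
    rw [ae_all_iff]
    intro k
    have hr : Measurable fun (v : ℕ → E × Vec d) (i : Fin k) => v i :=
      measurable_pi_iff.2 fun i => measurable_pi_apply _
    have h1 := ae_of_ae_map hξ.aemeasurable (condDistrib_comp (μ := μ) ξ hfut.aemeasurable hr)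
    filter_upwards [h1] with ω hω
    rw [← Kernel.map_apply _ hr, ← hω]
    rfl
  let J : ∀ k : ℕ, Fin k → ℤ := fun k i => (n : ℤ) + (i : ℕ)
  have hJ1 : ∀ k i, 1 ≤ J k i := fun k i => by simp only [J]; omega
  have hJ : ∀ k i, J k i ≤ ((n + k : ℕ) : ℤ) := fun k i => by
    have := i.2
    simp only [J]
    omega
  have hae : ∀ᵐ ω ∂μ, ∀ k : ℕ, condDistrib (fun ω (i : Fin k) => fut ω i) ξ μ (ξ ω) =
      blockKernel p hT.measurable Q id (n + k) (J k) (pastPair Y X ω) := by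
    rw [ae_all_iff]
    exact fun k => hF.condDistrib_ae_eq hT h𝒢 hQ measurable_id (hJ k)
  -- The whole series is used as the cost for every window, so the bound is independent of the
  -- window length `k`.
  have hbound := fun k => hF.integral_condLaw_sub_le hT h𝒢 hQ hQt measurable_id (hJ k) (hJ1 k)
    (γ := discreteCost) hc (fun z z' => by
      rw [hcdef]
      simp only [J]
      rw [Fin.sum_univ_eq_sum_range
        (fun i : ℕ => blockCost discreteCost id ρ δ ((n : ℤ) + i) z z') k]
      exact ENNReal.sum_le_tsum _)
  rw [← ae_all_iff] at hbound
  filter_upwards [hcomp, hae, hbound] with ω hω1 hω2 hω3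
  set b := ∫⁻ a, pastCost Qt c (pastSeq (path X ω) 0, a) ∂(μ.map fun ω => pastSeq (path X ω) 0)
    with hb
  refine iSup₂_le fun A hA => ?_
  change ENNReal.ofReal |(condDistrib fut ξ μ (ξ ω)).real A - (μ.map fut).real A| ≤ b
  by_cases hbt : b = ∞
  · rw [hbt]; exact le_top
  refine ENNReal.ofReal_le_of_le_toReal (abs_measureReal_sub_le_of_cylinder ?_ hA)
  have hone : ∀ B ∈ measurableCylinders (fun _ : ℕ => E × Vec d),
      (condDistrib fut ξ μ (ξ ω)).real B - (μ.map fut).real B ≤ b.toReal := by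
    intro B hB
    rw [measurableCylinders_nat] at hB
    simp only [Set.mem_iUnion, Set.mem_singleton_iff] at hB
    obtain ⟨k, S, hS, rfl⟩ := hB
    let r : (ℕ → E × Vec d) → Fin (k + 1) → E × Vec d := fun v i => v i
    have hr : Measurable r := measurable_pi_iff.2 fun i => measurable_pi_apply _
    let r' : (Fin (k + 1) → E × Vec d) → (∀ _ : Finset.Iic k, E × Vec d) :=
      fun v i => v ⟨i.1, Nat.lt_succ_of_le (Finset.mem_Iic.1 i.2)⟩
    have hr' : Measurable r' := measurable_pi_iff.2 fun i => measurable_pi_apply _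
    let B := r' ⁻¹' S
    have hBm : MeasurableSet B := hr' hS
    have hcyl : cylinder (Finset.Iic k) S = r ⁻¹' B := rfl
    have h1 : (condDistrib fut ξ μ (ξ ω)).real (r ⁻¹' B) =
        ∫ v, B.indicator 1 v
          ∂(blockKernel p hT.measurable Q id (n + (k + 1)) (J (k + 1)) (pastPair Y X ω)) := by
      rw [← hω2 (k + 1), hω1 (k + 1), integral_indicator_one hBm, map_measureReal_apply hr hBm]
    have h2 : (μ.map fut).real (r ⁻¹' B) = ∫ v, B.indicator 1 v
        ∂(μ.map fun ω i => (Y (J (k + 1) i) ω, id (X (J (k + 1) i) ω))) := by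
      have hmm : μ.map (fun ω i => (Y (J (k + 1) i) ω, id (X (J (k + 1) i) ω))) =
          (μ.map fut).map r := by
        rw [Measure.map_map hr hfut]
        rfl
      rw [hmm, integral_indicator_one hBm, map_measureReal_apply hr hBm]
    rw [hcyl, h1, h2]
    refine (ENNReal.ofReal_le_iff_le_toReal hbt).1 (hω3 (k + 1) (B.indicator 1)
      (measurable_one.indicator hBm) ⟨1, fun v => ?_⟩ fun v v' => ?_)
    · by_cases hv : v ∈ B <;> simp [hv]
    -- Two distinct blocks differ in some entry, which already costs at least one; hence every
    -- indicator is an admissible test function.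
    · by_cases hvv : v = v'
      · subst hvv; simp
      · obtain ⟨i, hi⟩ := Function.ne_iff.1 hvv
        have hle : B.indicator (1 : (Fin (k + 1) → E × Vec d) → ℝ) v - B.indicator 1 v' ≤ 1 := by
          by_cases h1 : v ∈ B <;> by_cases h2 : v' ∈ B <;> simp [h1, h2]
        refine (ENNReal.ofReal_le_ofReal hle).trans ?_
        rw [ENNReal.ofReal_one]
        refine le_trans ?_ (Finset.single_le_sum (f := fun i =>
          (if (v i).1 = (v' i).1 then (0 : ℝ≥0∞) else 1) + discreteCost (v i).2 (v' i).2)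
          (fun _ _ => zero_le) (Finset.mem_univ i))
        by_cases h1 : (v i).1 = (v' i).1
        · have h2 : (v i).2 ≠ (v' i).2 := fun h2 => hi (Prod.ext h1 h2)
          simp [discreteCost, h2]
        · simp [h1]
  intro B hB
  refine abs_le.2 ⟨?_, hone B hB⟩
  -- The complement of the cylinder supplies the bound from below.
  have h1 := hone Bᶜ (compl_mem_measurableCylinders hB)
  have hBm := MeasurableSet.of_mem_measurableCylinders hB
  rw [probReal_compl_eq_one_sub hBm, probReal_compl_eq_one_sub hBm] at h1
  linarith

end Coefficients


/-! ### Observation-driven models -/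

section Model

variable {E : Type*} [Fintype E] [Nonempty E] [DecidableEq E] [MeasurableSpace E]
  [DiscreteMeasurableSpace E] {d : ℕ}
  {Λ : Type*} [NormedAddCommGroup Λ] [NormedSpace ℝ Λ] [FiniteDimensional ℝ Λ]
  [MeasurableSpace Λ] [BorelSpace Λ]

/-- The transitions `q(w | H(y, x_t^-))` of the model. -/
def respProb (q : Λ → E → ℝ) (G : E → Vec d → Λ → Λ) (t : ℤ) (s : (ℕ → E) × (ℤ → Vec d)) (w : E) :
    ℝ := q (latent G s.1 (pastSeq s.2 t)) w

/-- The error due to different covariates. -/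
def covError (K θ : ℝ) (t : ℤ) (x x' : ℤ → Vec d) : ℝ :=
  min 1 (K * ∑' i : ℕ, θ ^ i * ‖x (t - i) - x' (t - i)‖)

lemma IsLipschitzKernel.measurable {q : Λ → E → ℝ} (hq : IsLipschitzKernel q) (w : E) :
    Measurable fun z => q z w := by
  obtain ⟨-, -, K, hK⟩ := hq
  refine Continuous.measurable ?_
  rw [continuous_iff_continuousAt]
  intro z
  rw [ContinuousAt, tendsto_iff_dist_tendsto_zero]
  have hlim : Tendsto (fun z' => 2 * (K * ‖z' - z‖)) (𝓝 z) (𝓝 0) := by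
    have : Continuous fun z' => 2 * (K * ‖z' - z‖) := by fun_prop
    simpa using this.tendsto z
  refine squeeze_zero (fun _ => dist_nonneg) (fun z' => ?_) hlim
  rw [Real.dist_eq]
  have h1 : |q z' w - q z w| ≤ ∑ w, |q z' w - q z w| :=
    Finset.single_le_sum (f := fun w => |q z' w - q z w|) (fun _ _ => abs_nonneg _)
      (Finset.mem_univ w)
  have h2 := hK z' z
  unfold dTV at h2
  linarith

/-- Convergence is not needed: `limUnder` of a sequence of measurable maps is measurable even where
the limit fails to exist. -/
lemma IsContractiveFamily.measurable_latent {G : E → Vec d → Λ → Λ} (hG : IsContractiveFamily G) :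
    Measurable fun s : (ℕ → E) × (ℕ → Vec d) => latent G s.1 s.2 := by
  obtain ⟨⟨L, -, hL⟩, -⟩ := hG
  have hGm : Measurable fun s : E × (Vec d × Λ) => G s.1 s.2.1 s.2.2 := by
    refine measurable_from_prod_countable_right fun y => ?_
    refine Continuous.measurable ?_
    rw [continuous_iff_continuousAt]
    intro s
    rw [ContinuousAt, tendsto_iff_dist_tendsto_zero]
    have hlim : Tendsto (fun s' : Vec d × Λ => L * (0 + ‖s'.1 - s.1‖ + ‖s'.2 - s.2‖)) (𝓝 s)
        (𝓝 0) := by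
      have : Continuous fun s' : Vec d × Λ => L * (0 + ‖s'.1 - s.1‖ + ‖s'.2 - s.2‖) := by fun_prop
      simpa using this.tendsto s
    refine squeeze_zero (fun _ => dist_nonneg) (fun s' => ?_) hlim
    rw [dist_eq_norm]
    simpa using hL y y s'.1 s.1 s'.2 s.2
  have hback : ∀ n, Measurable fun s : ((ℕ → E) × (ℕ → Vec d)) × Λ =>
      backIter G s.1.1 s.1.2 n s.2 := by
    intro n
    induction n with
    | zero => exact measurable_snd
    | succ n ih =>
      have h1 : Measurable fun s : ((ℕ → E) × (ℕ → Vec d)) × Λ =>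
          (s.1, G (s.1.1 n) (s.1.2 n) s.2) := by
        refine measurable_fst.prodMk (hGm.comp (Measurable.prodMk ?_ (Measurable.prodMk ?_ ?_)))
        · exact (measurable_pi_apply n).comp (measurable_fst.comp measurable_fst)
        · exact (measurable_pi_apply n).comp (measurable_snd.comp measurable_fst)
        · exact measurable_snd
      exact ih.comp h1
  have : CompleteSpace Λ := FiniteDimensional.complete ℝ Λ
  have hs : ∀ n, StronglyMeasurable fun s : (ℕ → E) × (ℕ → Vec d) =>
      backIter G s.1 s.2 (n + 1) 0 := fun n =>
    ((hback (n + 1)).comp (measurable_id.prodMk measurable_const)).stronglyMeasurable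
  exact (StronglyMeasurable.limUnder hs).measurable

lemma IsContractiveFamily.measurable_latent_pastSeq {G : E → Vec d → Λ → Λ}
    (hG : IsContractiveFamily G) (t : ℤ) :
    Measurable fun s : (ℕ → E) × (ℤ → Vec d) => latent G s.1 (pastSeq s.2 t) := by
  refine hG.measurable_latent.comp (f := fun s : (ℕ → E) × (ℤ → Vec d) => (s.1, pastSeq s.2 t)) ?_
  exact measurable_fst.prodMk ((measurable_pastSeq t).comp measurable_snd)

lemma measurable_respProb {q : Λ → E → ℝ} (hq : IsLipschitzKernel q) {G : E → Vec d → Λ → Λ}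
    (hG : IsContractiveFamily G) (t : ℤ) (w : E) :
    Measurable fun s : (ℕ → E) × (ℤ → Vec d) => respProb q G t s w := by
  unfold respProb
  exact (hq.measurable w).comp (hG.measurable_latent_pastSeq t)

lemma measurable_covError (K θ : ℝ) (t : ℤ) :
    Measurable fun xx : (ℤ → Vec d) × (ℤ → Vec d) => covError K θ t xx.1 xx.2 := by
  refine measurable_const.min (Measurable.const_mul (Measurable.tsum fun i => ?_) K)
  refine Measurable.const_mul (Measurable.norm (Measurable.sub ?_ ?_)) _
  · exact (measurable_pi_apply _).comp measurable_fst
  · exact (measurable_pi_apply _).comp measurable_snd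

/-- Covariate paths that are summable against `θ ^ i`. -/
def summablePaths (d : ℕ) (θ : ℝ) : Set (ℤ → Vec d) :=
  {x | ∀ t : ℤ, ∑' i : ℕ, ENNReal.ofReal (θ ^ i * ‖x (t - i)‖) ≠ ∞}

lemma measurableSet_summablePaths (θ : ℝ) : MeasurableSet (summablePaths d θ) := by
  have hset : summablePaths d θ = ⋂ t : ℤ,
      {x | ∑' i : ℕ, ENNReal.ofReal (θ ^ i * ‖x (t - i)‖) = ∞}ᶜ := by
    ext x
    simp [summablePaths]
  rw [hset]
  refine MeasurableSet.iInter fun t => ?_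
  have : Measurable fun x : ℤ → Vec d => ∑' i : ℕ, ENNReal.ofReal (θ ^ i * ‖x (t - i)‖) :=
    Measurable.tsum fun i => ((measurable_pi_apply _).norm.const_mul _).ennreal_ofReal
  exact (this (measurableSet_singleton ∞)).compl

lemma summable_of_mem_summablePaths {θ : ℝ} (hθ : 0 < θ) {x : ℤ → Vec d}
    (hx : x ∈ summablePaths d θ) (t : ℤ) : Summable fun i => θ ^ i * ‖pastSeq x t i‖ := by
  have h1 := ENNReal.summable_toReal (hx t)
  refine h1.congr fun i => ?_
  rw [ENNReal.toReal_ofReal (by positivity)]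
  rfl

/-- By Tonelli's theorem the weighted sum has mean at most `m / (1 - θ)`, so it is almost surely
finite. -/
lemma ae_mem_summablePaths {Ω : Type*} [MeasurableSpace Ω] {μ : Measure Ω}
    {X : ℤ → Ω → Vec d} (hX : ∀ t, Measurable (X t)) {θ : ℝ} (hθ0 : 0 < θ) (hθ1 : θ < 1)
    {m : ℝ≥0∞} (hm : m ≠ ∞) (hXm : ∀ t, ∫⁻ ω, ENNReal.ofReal ‖X t ω‖ ∂μ ≤ m) :
    ∀ᵐ ω ∂μ, path X ω ∈ summablePaths d θ := by
  simp only [summablePaths, Set.mem_ofPred_eq]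
  rw [ae_all_iff]
  intro t
  have hmeas : ∀ i : ℕ, Measurable fun ω => ENNReal.ofReal (θ ^ i * ‖X (t - i) ω‖) := fun i =>
    ((hX _).norm.const_mul _).ennreal_ofReal
  have h1 : ∫⁻ ω, ∑' i : ℕ, ENNReal.ofReal (θ ^ i * ‖X (t - i) ω‖) ∂μ ≠ ∞ := by
    rw [lintegral_tsum fun i => (hmeas i).aemeasurable]
    have h2 : ∀ i : ℕ, ∫⁻ ω, ENNReal.ofReal (θ ^ i * ‖X (t - i) ω‖) ∂μ ≤
        ENNReal.ofReal θ ^ i * m := by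
      intro i
      simp only [ENNReal.ofReal_mul (pow_nonneg hθ0.le i), ENNReal.ofReal_pow hθ0.le]
      rw [lintegral_const_mul _ (hX _).norm.ennreal_ofReal]
      gcongr
      exact hXm _
    refine ne_top_of_le_ne_top ?_ (ENNReal.tsum_le_tsum h2)
    rw [ENNReal.tsum_mul_right, ENNReal.tsum_geometric]
    refine ENNReal.mul_ne_top (ENNReal.inv_ne_top.2 ?_) hm
    exact (tsub_pos_of_lt (ENNReal.ofReal_lt_one.2 hθ1)).ne'
  exact (ae_lt_top (Measurable.tsum hmeas) h1).mono fun ω hω => hω.ne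

lemma dTV_self (p : E → ℝ) : dTV p p = 0 := by simp [dTV]

/-- An observation-driven model with contracting latent maps and overlapping conditional laws
loses its memory. -/
lemma exists_forgetting {Ω : Type*} [MeasurableSpace Ω] {μ : Measure Ω} {X : ℤ → Ω → Vec d}
    {G : E → Vec d → Λ → Λ} (hG : IsContractiveFamily G) {q : Λ → E → ℝ}
    (hq : IsLipschitzKernel q) (hb : HasUniformOverlap q G X μ) :
    ∃ K C θ ρ : ℝ, 0 ≤ K ∧ 0 ≤ C ∧ 0 < θ ∧ θ < 1 ∧
      (∀ (n : ℕ) (y : ℕ → E) (x : ℕ → Vec d) (z z' : Λ),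
        ‖backIter G y x n z - backIter G y x n z'‖ ≤ C * θ ^ n * ‖z - z'‖) ∧
      (∀ x ∈ summablePaths d θ, ∀ (t : ℤ) (y : ℕ → E),
        Tendsto (fun n => backIter G y (pastSeq x t) n 0) atTop (𝓝 (latent G y (pastSeq x t)))) ∧
      ∃ D : Set (ℤ → Vec d), (∀ᵐ ω ∂μ, path X ω ∈ D) ∧
        Forgetting (respProb q G) (D ∩ summablePaths d θ) (covError K θ) ρ := by
  have : CompleteSpace Λ := FiniteDimensional.complete ℝ Λ
  obtain ⟨L, C, θ, hL1, hC, hθ0, hθ1, hL, hcon⟩ := hG.exists_contraction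
  obtain ⟨hq0, hq1, K₀, hK₀⟩ := hq
  obtain ⟨D, hDm, hD, c₀, hc₀, hDc⟩ := hb
  have hL0 : 0 ≤ L := by linarith
  set K := |K₀| * (C * L) with hK
  have hK0 : 0 ≤ K := by positivity
  set c := max c₀ 0
  have hc1 : c < 1 := max_lt hc₀ one_pos
  have hθ' : 0 ≤ (1 - θ)⁻¹ := inv_nonneg.2 (by linarith)
  -- The constant `K / (1 - θ)` is the one that `tsum_disagree_le` yields for histories with a given
  -- agreement.
  obtain ⟨ρ, hρ0, hρ1, f, hf0, hf, hstep⟩ := exists_lyapunov (le_max_right c₀ 0) hc1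
    (mul_nonneg hK0 hθ') hθ0 hθ1
  have hlat : ∀ x ∈ summablePaths d θ, ∀ x' ∈ summablePaths d θ, ∀ t y y',
      dTV (q (latent G y (pastSeq x t))) (q (latent G y' (pastSeq x' t))) ≤
        K * ∑' i, θ ^ i * ((if y i = y' i then 0 else 1) + ‖pastSeq x t i - pastSeq x' t i‖) := by
    intro x hx x' hx' t y y'
    refine (hK₀ _ _).trans ?_
    refine (mul_le_mul_of_nonneg_right (le_abs_self K₀) (norm_nonneg _)).trans ?_
    rw [hK, mul_assoc]
    exact mul_le_mul_of_nonneg_left (norm_latent_sub_le hL0 hC hθ0 hθ1 hL hcon y y'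
      (summable_of_mem_summablePaths hθ0 hx t) (summable_of_mem_summablePaths hθ0 hx' t))
      (abs_nonneg _)
  refine ⟨K, C, θ, ρ, hK0, hC, hθ0, hθ1, hcon, fun x hx t y =>
    tendsto_backIter_latent hL0 hC hθ0 hθ1 hL hcon y (summable_of_mem_summablePaths hθ0 hx t),
    D, hD, ?_⟩
  refine ⟨hρ0, hρ1, hDm.inter (measurableSet_summablePaths θ), fun t x x' => ?_, fun t x => ?_,
    f, c, K * (1 - θ)⁻¹, θ, hf0, hf, hstep, ?_⟩
  · refine le_min zero_le_one (mul_nonneg hK0 (tsum_nonneg fun i => by positivity))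
  · simp [covError]
  · rintro x ⟨hxD, hx⟩ x' ⟨hxD', hx'⟩ t y y'
    -- The history is exchanged first, along the same covariates, where the overlap `c` is
    -- available; then the covariates are exchanged at a fixed history, which produces `covError`.
    refine (dTV_triangle _ (q (latent G y' (pastSeq x t))) _).trans (add_le_add ?_ ?_)
    · by_cases hyy : y = y'
      · subst hyy
        rw [agreeFun_self]
        exact (dTV_self _).le
      · have h1 := hDc x hxD t y y'
        have h2 := hlat x hx x hx t y y'
        have h3 := (tsum_disagree_le hθ0 hθ1 y y').2
        simp only [sub_self, norm_zero, add_zero] at h2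
        rw [agreeFun, if_neg hyy] at h3 ⊢
        refine le_min (h1.trans (le_max_left _ _)) (h2.trans ?_)
        exact (mul_le_mul_of_nonneg_left h3 hK0).trans_eq (by ring)
    · refine le_min (dTV_le_one (hq0 _) (hq0 _) (hq1 _) (hq1 _)) ?_
      have h2 := hlat x hx x' hx' t y' y'
      simp only [if_true, zero_add] at h2
      exact h2

lemma map_eq_of_isStationary {Ω α : Type*} [MeasurableSpace Ω] [MeasurableSpace α] {μ : Measure Ω}
    {Z : ℤ → Ω → α} (hZ : ∀ t, Measurable (Z t)) (hst : IsStationary Z μ) (t : ℤ) :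
    μ.map (Z t) = μ.map (Z 0) := by
  have hstep : ∀ s : ℤ, μ.map (Z (s + 1)) = μ.map (Z s) := by
    intro s
    have hp := measurable_path hZ
    have h1 := congrArg (Measure.map fun z : ℤ → α => z s) hst.map_eq
    rw [Measure.map_map (measurable_pi_apply s) hst.measurable,
      Measure.map_map ((measurable_pi_apply s).comp hst.measurable) hp,
      Measure.map_map (measurable_pi_apply s) hp] at h1
    exact h1
  induction t using Int.induction_on with
  | zero => rfl
  | succ i ih => rw [hstep, ih]
  | pred i ih => rw [← ih, ← hstep (-i - 1), sub_add_cancel]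

/-- A stationary solution of the latent recursion is the latent value of the past. -/
lemma lam_eq_latent {Ω : Type*} [MeasurableSpace Ω] {μ : Measure Ω} [IsProbabilityMeasure μ]
    {X : ℤ → Ω → Vec d} {G : E → Vec d → Λ → Λ} {C θ : ℝ} (hC : 0 ≤ C) (hθ0 : 0 < θ) (hθ1 : θ < 1)
    (hcon : ∀ (n : ℕ) (y : ℕ → E) (x : ℕ → Vec d) (z z' : Λ),
      ‖backIter G y x n z - backIter G y x n z'‖ ≤ C * θ ^ n * ‖z - z'‖)
    (hlim : ∀ x ∈ summablePaths d θ, ∀ (t : ℤ) (y : ℕ → E),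
      Tendsto (fun n => backIter G y (pastSeq x t) n 0) atTop (𝓝 (latent G y (pastSeq x t))))
    (hX : ∀ᵐ ω ∂μ, path X ω ∈ summablePaths d θ)
    {Y : ℤ → Ω → E} {lam : ℤ → Ω → Λ} (hlam_meas : ∀ t, Measurable (lam t))
    (hlam_stat : IsStationary lam μ)
    (hlam : ∀ t, ∀ᵐ ω ∂μ, lam t ω = G (Y (t - 1) ω) (X t ω) (lam (t - 1) ω)) (t : ℤ) :
    ∀ᵐ ω ∂μ, lam t ω = latent G (pastSeq (path Y ω) (t - 1)) (pastSeq (path X ω) t) := by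
  have hiter : ∀ᵐ ω ∂μ, ∀ n : ℕ, lam t ω =
      backIter G (pastSeq (path Y ω) (t - 1)) (pastSeq (path X ω) t) n (lam (t - n) ω) := by
    rw [← ae_all_iff] at hlam
    filter_upwards [hlam] with ω hω n
    induction n with
    | zero => simp [backIter]
    | succ n ih =>
      rw [ih, hω (t - n)]
      simp only [backIter, Function.comp_apply, pastSeq, path]
      congr 2
      · congr 1; ring
      · push_cast; congr 1; ring
  have hlaw0 : ∀ n : ℕ, μ.map (lam (t - n)) = μ.map (lam t) := fun n => by
    rw [map_eq_of_isStationary hlam_meas hlam_stat, map_eq_of_isStationary hlam_meas hlam_stat t]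
  -- By stationarity the law of `lam (t - n)` is the same for all `n`, so the factor `θ ^ n` forces
  -- convergence to zero in probability; no moment of `lam` is needed.
  have hmeas : TendstoInMeasure μ (fun (n : ℕ) ω => C * θ ^ n * ‖lam (t - n) ω‖) atTop
      (fun _ => (0 : ℝ)) := by
    rw [tendstoInMeasure_iff_norm]
    intro ε hε
    have h1 : ∀ n : ℕ, μ {ω | ε ≤ ‖C * θ ^ n * ‖lam (t - n) ω‖ - 0‖} =
        μ.map (lam t) {z | ε ≤ C * θ ^ n * ‖z‖} := by
      intro n
      rw [← hlaw0 n, Measure.map_apply (hlam_meas _)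
        (measurableSet_le measurable_const (measurable_norm.const_mul _))]
      congr 1
      ext ω
      have : 0 ≤ C * θ ^ n * ‖lam (t - n) ω‖ := by positivity
      simp only [sub_zero, Real.norm_of_nonneg this, Set.mem_preimage, Set.mem_ofPred_eq]
    simp only [h1]
    have hprl := Measure.isProbabilityMeasure_map (μ := μ) (hlam_meas t).aemeasurable
    have hanti : Antitone fun n : ℕ => {z : Λ | ε ≤ C * θ ^ n * ‖z‖} := by
      intro m n hmn z hz
      have hz' : ε ≤ C * θ ^ n * ‖z‖ := hz
      refine hz'.trans ?_
      refine mul_le_mul_of_nonneg_right (mul_le_mul_of_nonneg_left ?_ hC) (norm_nonneg z)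
      exact pow_le_pow_of_le_one hθ0.le hθ1.le hmn
    have h2 := tendsto_measure_iInter_atTop (μ := μ.map (lam t))
      (s := fun n : ℕ => {z : Λ | ε ≤ C * θ ^ n * ‖z‖})
      (fun n => (measurableSet_le measurable_const
        (measurable_norm.const_mul _)).nullMeasurableSet) hanti ⟨0, measure_ne_top _ _⟩
    have h3 : ⋂ n : ℕ, {z : Λ | ε ≤ C * θ ^ n * ‖z‖} = ∅ := by
      rw [Set.eq_empty_iff_forall_notMem]
      intro z hz
      have h4 : Tendsto (fun n : ℕ => C * θ ^ n * ‖z‖) atTop (𝓝 (C * 0 * ‖z‖)) :=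
        ((tendsto_pow_atTop_nhds_zero_of_lt_one hθ0.le hθ1).const_mul C).mul_const _
      rw [mul_zero, zero_mul] at h4
      obtain ⟨n, hn⟩ := (h4.eventually_lt_const hε).exists
      exact absurd (Set.mem_iInter.1 hz n) (not_le.2 hn)
    rw [h3, measure_empty] at h2
    exact h2
  -- Almost sure convergence along a subsequence is enough, since the iterations started at `0`
  -- converge along the full sequence.
  obtain ⟨ns, hns, hsub⟩ := hmeas.exists_seq_tendsto_ae
  filter_upwards [hiter, hX, hsub] with ω hω1 hω2 hω3
  have h1 := (hlim _ hω2 t (pastSeq (path Y ω) (t - 1))).comp hns.tendsto_atTop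
  refine tendsto_nhds_unique ?_ h1
  rw [tendsto_iff_norm_sub_tendsto_zero]
  refine squeeze_zero (fun _ => norm_nonneg _) (fun k => ?_) hω3
  have h2 := hcon (ns k) (pastSeq (path Y ω) (t - 1)) (pastSeq (path X ω) t) 0 (lam (t - ns k) ω)
  rw [← hω1 (ns k), zero_sub, norm_neg] at h2
  exact h2

variable {Ω : Type*} [MeasurableSpace Ω] {μ : Measure Ω} {𝒵 : Type*} [MeasurableSpace 𝒵]

/-- The transitions of the model as functions of an exogenous process that determines the
covariates. -/
lemma hasTransition_respProb {q : Λ → E → ℝ} (hq : IsLipschitzKernel q) {G : E → Vec d → Λ → Λ}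
    (hG : IsContractiveFamily G) {X : ℤ → Ω → Vec d} {Y : ℤ → Ω → E} (hY : ∀ t, Measurable (Y t))
    {Z : ℤ → Ω → 𝒵} (hZ : ∀ t, Measurable (Z t)) {h : 𝒵 → Vec d} (hh : Measurable h)
    (hX : ∀ t ω, X t ω = h (Z t ω)) {lam : ℤ → Ω → Λ}
    (hlam : ∀ t, ∀ᵐ ω ∂μ,
      lam t ω = latent G (pastSeq (path Y ω) (t - 1)) (pastSeq (path X ω) t))
    (hlaw : HasConditionalLaw q lam Y Z μ) :
    HasTransition (fun t s w => respProb q G t (s.1, fun r => h (s.2 r)) w) Y Z μ where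
  measurable_resp := hY
  measurable_exog := hZ
  measurable t w := (measurable_respProb hq hG t w).comp (measurable_fst.prodMk
    (measurable_pi_iff.2 fun r => hh.comp ((measurable_pi_apply r).comp measurable_snd)))
  nonneg t s w := hq.1 _ _
  sum_eq_one t s := hq.2.1 _
  causal t y z z' hzz := by
    funext w
    simp only [respProb]
    congr 2
    funext i
    simp only [pastSeq]
    rw [hzz _ (by omega)]
  condExp t w := by
    refine (hlaw t w).trans ?_
    filter_upwards [hlam t] with ω hω
    simp only [respProb, hist]
    rw [hω]
    congr 2
    funext i
    simp only [pastSeq, path, hX]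

lemma hasTransition_respProb_covariate {q : Λ → E → ℝ} (hq : IsLipschitzKernel q)
    {G : E → Vec d → Λ → Λ} (hG : IsContractiveFamily G) {X : ℤ → Ω → Vec d} {Y : ℤ → Ω → E}
    (hY : ∀ t, Measurable (Y t)) (hX : ∀ t, Measurable (X t)) {lam : ℤ → Ω → Λ}
    (hlam : ∀ t, ∀ᵐ ω ∂μ,
      lam t ω = latent G (pastSeq (path Y ω) (t - 1)) (pastSeq (path X ω) t))
    (hlaw : HasConditionalLaw q lam Y X μ) : HasTransition (respProb q G) Y X μ :=
  hasTransition_respProb hq hG hY hX measurable_id (fun _ _ => rfl) hlam hlaw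

/-- Covariates that are a function of a larger exogenous process retain the memory loss; this serves
for conditioning on the states of the chain. -/
lemma Forgetting.comap {p : ℤ → (ℕ → E) × (ℤ → Vec d) → E → ℝ} {𝒢 : Set (ℤ → Vec d)}
    {δ : ℤ → (ℤ → Vec d) → (ℤ → Vec d) → ℝ} {ρ : ℝ} (hF : Forgetting p 𝒢 δ ρ) {h : 𝒵 → Vec d}
    (hh : Measurable h) :
    Forgetting (fun t s w => p t (s.1, fun r => h (s.2 r)) w)
      ((fun (z : ℤ → 𝒵) r => h (z r)) ⁻¹' 𝒢)
      (fun t z z' => δ t (fun r => h (z r)) fun r => h (z' r)) ρ where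
  pos := hF.pos
  lt_one := hF.lt_one
  measurableSet := (measurable_pi_iff.2 fun r => hh.comp (measurable_pi_apply r)) hF.measurableSet
  nonneg t z z' := hF.nonneg _ _ _
  self_eq_zero t z := hF.self_eq_zero _ _
  dTV_le := by
    obtain ⟨f, c, C, θ, hf0, hf, hstep, hd⟩ := hF.dTV_le
    exact ⟨f, c, C, θ, hf0, hf, hstep, fun z hz z' hz' t y y' => hd _ hz _ hz' t y y'⟩

end Model


/-! ### Couplings of the exogenous process -/

section Couplings

variable {Ω : Type*} [MeasurableSpace Ω] {μ : Measure Ω} [IsProbabilityMeasure μ]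
  {𝒵 : Type*} [MeasurableSpace 𝒵] {𝒮 : Type*} [MeasurableSpace 𝒮] {d : ℕ}

/-- Independent pasts followed by independent draws of the present states give independent present
states; so averaging over the pasts restores `π ⊗ π`, the initial law in (C). -/
lemma parallelComp_comp_prod_measure {α β : Type*} [MeasurableSpace α] [MeasurableSpace β]
    (ν : Measure α) [IsProbabilityMeasure ν] (κ : Kernel α β) [IsMarkovKernel κ] :
    (κ ∥ₖ κ) ∘ₘ ν.prod ν = (κ ∘ₘ ν).prod (κ ∘ₘ ν) := by
  refine (Measure.prod_eq fun s t hs ht => ?_).symm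
  rw [Measure.bind_apply (hs.prod ht) (Kernel.aemeasurable _),
    Measure.bind_apply hs (Kernel.aemeasurable _), Measure.bind_apply ht (Kernel.aemeasurable _),
    ← lintegral_prod_mul (Kernel.measurable_coe κ hs).aemeasurable
      (Kernel.measurable_coe κ ht).aemeasurable]
  refine lintegral_congr fun a => ?_
  rw [Kernel.parallelComp_apply_prod]

lemma lintegral_coupledLaw_eq {Qt : Kernel ((ℕ → 𝒵) × (ℕ → 𝒵)) ((ℕ → 𝒵) × (ℕ → 𝒵))}
    [IsMarkovKernel Qt] (ν : Measure (ℕ → 𝒵)) [IsProbabilityMeasure ν]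
    {c : (ℤ → 𝒵) × (ℤ → 𝒵) → ℝ≥0∞} (hc : Measurable c) :
    ∫⁻ zz, c zz ∂(coupledLaw Qt ν) =
      ∫⁻ s, ∫⁻ p, c (glue s.1 p.1, glue s.2 p.2) ∂(Qt s) ∂(ν.prod ν) := by
  have hcg : Measurable fun s : ((ℕ → 𝒵) × (ℕ → 𝒵)) × ((ℕ → 𝒵) × (ℕ → 𝒵)) =>
    c (glue s.1.1 s.2.1, glue s.1.2 s.2.2) := hc.comp measurable_glue_glue
  rw [coupledLaw, lintegral_map hc measurable_glue_glue, Measure.lintegral_compProd hcg]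

lemma isProbabilityMeasure_coupledLaw
    (Qt : Kernel ((ℕ → 𝒵) × (ℕ → 𝒵)) ((ℕ → 𝒵) × (ℕ → 𝒵)))
    [IsMarkovKernel Qt] (ν : Measure (ℕ → 𝒵)) [IsProbabilityMeasure ν] :
    IsProbabilityMeasure (coupledLaw Qt ν) :=
  Measure.isProbabilityMeasure_map measurable_glue_glue.aemeasurable

lemma lintegral_compProd_glue {Z : ℤ → Ω → 𝒵} (hZ : ∀ t, Measurable (Z t))
    {Q : Kernel (ℕ → 𝒵) (ℕ → 𝒵)} [IsMarkovKernel Q]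
    (hQ : μ.map (fun ω => (pastSeq (path Z ω) 0, futSeq (path Z ω))) =
      μ.map (fun ω => pastSeq (path Z ω) 0) ⊗ₘ Q) {f : (ℤ → 𝒵) → ℝ≥0∞} (hf : Measurable f) :
    ∫⁻ a, ∫⁻ b, f (glue a b) ∂(Q a) ∂(μ.map fun ω => pastSeq (path Z ω) 0) =
      ∫⁻ ω, f (path Z ω) ∂μ := by
  have hZp : Measurable fun ω => pastSeq (path Z ω) 0 :=
    (measurable_pastSeq 0).comp (measurable_path hZ)
  have hZf : Measurable fun ω => futSeq (path Z ω) := measurable_futSeq.comp (measurable_path hZ)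
  have hfg : Measurable fun s : (ℕ → 𝒵) × (ℕ → 𝒵) => f (glue s.1 s.2) := hf.comp measurable_glue
  have hpr := Measure.isProbabilityMeasure_map (μ := μ) hZp.aemeasurable
  rw [← Measure.lintegral_compProd hfg, ← hQ, lintegral_map hfg (hZp.prodMk hZf)]
  simp only [glue_pastSeq_futSeq]

/-- The first marginal of the coupled law is the law of the exogenous process. -/
lemma lintegral_coupledLaw_fst {Z : ℤ → Ω → 𝒵} (hZ : ∀ t, Measurable (Z t))
    {Q : Kernel (ℕ → 𝒵) (ℕ → 𝒵)} [IsMarkovKernel Q]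
    (hQ : μ.map (fun ω => (pastSeq (path Z ω) 0, futSeq (path Z ω))) =
      μ.map (fun ω => pastSeq (path Z ω) 0) ⊗ₘ Q)
    {Qt : Kernel ((ℕ → 𝒵) × (ℕ → 𝒵)) ((ℕ → 𝒵) × (ℕ → 𝒵))} [IsMarkovKernel Qt]
    (hQt : ∀ s, (Qt s).map Prod.fst = Q s.1 ∧ (Qt s).map Prod.snd = Q s.2)
    {f : (ℤ → 𝒵) → ℝ≥0∞} (hf : Measurable f) :
    ∫⁻ zz, f zz.1 ∂(coupledLaw Qt (μ.map fun ω => pastSeq (path Z ω) 0)) =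
      ∫⁻ ω, f (path Z ω) ∂μ := by
  have hZp : Measurable fun ω => pastSeq (path Z ω) 0 :=
    (measurable_pastSeq 0).comp (measurable_path hZ)
  have hpr := Measure.isProbabilityMeasure_map (μ := μ) hZp.aemeasurable
  have hfg : Measurable fun s : (ℕ → 𝒵) × (ℕ → 𝒵) => f (glue s.1 s.2) := hf.comp measurable_glue
  rw [lintegral_coupledLaw_eq (c := fun zz => f zz.1) _ (hf.comp measurable_fst),
    ← lintegral_compProd_glue hZ hQ hf]
  have h1 : ∀ s : (ℕ → 𝒵) × (ℕ → 𝒵), ∫⁻ p, f (glue s.1 p.1) ∂(Qt s) =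
      ∫⁻ b, f (glue s.1 b) ∂(Q s.1) := by
    intro s
    have hfs : Measurable fun b => f (glue s.1 b) :=
      hfg.comp (measurable_const.prodMk measurable_id)
    rw [← (hQt s).1, lintegral_map hfs measurable_fst]
  simp only [h1]
  have h2 : Measurable fun a => ∫⁻ b, f (glue a b) ∂(Q a) := hfg.lintegral_kernel_prod_right'
  exact measurePreserving_fst.lintegral_comp h2

/-- The second marginal of the coupled law is the law of the exogenous process. -/
lemma lintegral_coupledLaw_snd {Z : ℤ → Ω → 𝒵} (hZ : ∀ t, Measurable (Z t))
    {Q : Kernel (ℕ → 𝒵) (ℕ → 𝒵)} [IsMarkovKernel Q]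
    (hQ : μ.map (fun ω => (pastSeq (path Z ω) 0, futSeq (path Z ω))) =
      μ.map (fun ω => pastSeq (path Z ω) 0) ⊗ₘ Q)
    {Qt : Kernel ((ℕ → 𝒵) × (ℕ → 𝒵)) ((ℕ → 𝒵) × (ℕ → 𝒵))} [IsMarkovKernel Qt]
    (hQt : ∀ s, (Qt s).map Prod.fst = Q s.1 ∧ (Qt s).map Prod.snd = Q s.2)
    {f : (ℤ → 𝒵) → ℝ≥0∞} (hf : Measurable f) :
    ∫⁻ zz, f zz.2 ∂(coupledLaw Qt (μ.map fun ω => pastSeq (path Z ω) 0)) =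
      ∫⁻ ω, f (path Z ω) ∂μ := by
  have hZp : Measurable fun ω => pastSeq (path Z ω) 0 :=
    (measurable_pastSeq 0).comp (measurable_path hZ)
  have hpr := Measure.isProbabilityMeasure_map (μ := μ) hZp.aemeasurable
  have hfg : Measurable fun s : (ℕ → 𝒵) × (ℕ → 𝒵) => f (glue s.1 s.2) := hf.comp measurable_glue
  rw [lintegral_coupledLaw_eq (c := fun zz => f zz.2) _ (hf.comp measurable_snd),
    ← lintegral_compProd_glue hZ hQ hf]
  have h1 : ∀ s : (ℕ → 𝒵) × (ℕ → 𝒵), ∫⁻ p, f (glue s.2 p.2) ∂(Qt s) =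
      ∫⁻ b, f (glue s.2 b) ∂(Q s.2) := by
    intro s
    have hfs : Measurable fun b => f (glue s.2 b) :=
      hfg.comp (measurable_const.prodMk measurable_id)
    rw [← (hQt s).2, lintegral_map hfs measurable_snd]
  simp only [h1]
  have h2 : Measurable fun a => ∫⁻ b, f (glue a b) ∂(Q a) := hfg.lintegral_kernel_prod_right'
  exact measurePreserving_snd.lintegral_comp h2

lemma glue_natCast (a b : ℕ → 𝒵) {t : ℕ} (ht : 1 ≤ t) : glue a b t = b (t - 1) := by
  rw [glue, if_neg (by omega)]
  congr 1
  omega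

/-- The coupling of the futures of the chain depends on the present states only. -/
lemma exists_coupling_chain {S : ℤ → Ω → 𝒮} (hS : ∀ t, Measurable (S t))
    {P : Kernel 𝒮 (ℕ → 𝒮)} [IsMarkovKernel P] (hM : IsMarkovChain S P μ)
    {Pt : Kernel (𝒮 × 𝒮) ((ℕ → 𝒮) × (ℕ → 𝒮))} [IsMarkovKernel Pt] (hPt : IsPathCoupling P Pt)
    {g : 𝒮 → Vec d} (hg : Measurable g) :
    ∃ (Q : Kernel (ℕ → 𝒮) (ℕ → 𝒮)) (Qt : Kernel ((ℕ → 𝒮) × (ℕ → 𝒮)) ((ℕ → 𝒮) × (ℕ → 𝒮)))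
      (_ : IsMarkovKernel Q) (_ : IsMarkovKernel Qt),
      μ.map (fun ω => (pastSeq (path S ω) 0, futSeq (path S ω))) =
        μ.map (fun ω => pastSeq (path S ω) 0) ⊗ₘ Q ∧
      (∀ s, (Qt s).map Prod.fst = Q s.1 ∧ (Qt s).map Prod.snd = Q s.2) ∧
      ∀ γ : Vec d → Vec d → ℝ≥0∞, (Measurable fun x : Vec d × Vec d => γ x.1 x.2) →
        ∀ t : ℕ, 1 ≤ t →
        ∫⁻ zz, γ (g (zz.1 t)) (g (zz.2 t))
          ∂(coupledLaw Qt (μ.map fun ω => pastSeq (path S ω) 0)) =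
          couplingRate γ g (μ.map (S 0)) Pt t := by
  have h0 : Measurable fun s : ℕ → 𝒮 => s 0 := measurable_pi_apply 0
  have h00 : Measurable (Prod.map (fun s : ℕ → 𝒮 => s 0) (fun s : ℕ → 𝒮 => s 0)) := h0.prodMap h0
  have hSp : Measurable fun ω => pastSeq (path S ω) 0 :=
    (measurable_pastSeq 0).comp (measurable_path hS)
  have hpr := Measure.isProbabilityMeasure_map (μ := μ) hSp.aemeasurable
  refine ⟨P.comap _ h0, Pt.comap _ h00, inferInstance, inferInstance, ?_, ?_, ?_⟩
  · exact hM 0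
  · intro s
    exact hPt (s.1 0, s.2 0)
  · intro γ hγ t ht
    have hc : Measurable fun zz : (ℤ → 𝒮) × (ℤ → 𝒮) => γ (g (zz.1 t)) (g (zz.2 t)) :=
      hγ.comp ((hg.comp ((measurable_pi_apply _).comp measurable_fst)).prodMk
        (hg.comp ((measurable_pi_apply _).comp measurable_snd)))
    have hc' : Measurable fun p : (ℕ → 𝒮) × (ℕ → 𝒮) => γ (g (p.1 (t - 1))) (g (p.2 (t - 1))) :=
      hγ.comp ((hg.comp ((measurable_pi_apply _).comp measurable_fst)).prodMk
        (hg.comp ((measurable_pi_apply _).comp measurable_snd)))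
    rw [lintegral_coupledLaw_eq _ hc, couplingRate]
    have hlaw : μ.map (S 0) = (μ.map fun ω => pastSeq (path S ω) 0).map fun s => s 0 := by
      rw [Measure.map_map h0 hSp]
      rfl
    rw [hlaw, Measure.map_prod_map _ _ h0 h0, lintegral_map hc'.lintegral_kernel h00]
    refine lintegral_congr fun s => ?_
    simp only [Kernel.comap_apply, glue_natCast _ _ ht]

/-- The coupling of the futures of the covariates given their pasts: the present states of the
chain are drawn independently given the pasts of the covariates. -/
lemma exists_coupling_covariate [StandardBorelSpace 𝒮] {S : ℤ → Ω → 𝒮}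
    (hS : ∀ t, Measurable (S t))
    {P : Kernel 𝒮 (ℕ → 𝒮)} [IsMarkovKernel P] (hM : IsMarkovChain S P μ)
    {Pt : Kernel (𝒮 × 𝒮) ((ℕ → 𝒮) × (ℕ → 𝒮))} [IsMarkovKernel Pt] (hPt : IsPathCoupling P Pt)
    {g : 𝒮 → Vec d} (hg : Measurable g) {X : ℤ → Ω → Vec d} (hX : ∀ t ω, X t ω = g (S t ω)) :
    ∃ (Q : Kernel (ℕ → Vec d) (ℕ → Vec d))
      (Qt : Kernel ((ℕ → Vec d) × (ℕ → Vec d)) ((ℕ → Vec d) × (ℕ → Vec d)))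
      (_ : IsMarkovKernel Q) (_ : IsMarkovKernel Qt),
      μ.map (fun ω => (pastSeq (path X ω) 0, futSeq (path X ω))) =
        μ.map (fun ω => pastSeq (path X ω) 0) ⊗ₘ Q ∧
      (∀ s, (Qt s).map Prod.fst = Q s.1 ∧ (Qt s).map Prod.snd = Q s.2) ∧
      ∀ γ : Vec d → Vec d → ℝ≥0∞, (Measurable fun x : Vec d × Vec d => γ x.1 x.2) →
        ∀ t : ℕ, 1 ≤ t →
        ∫⁻ zz, γ (zz.1 t) (zz.2 t) ∂(coupledLaw Qt (μ.map fun ω => pastSeq (path X ω) 0)) =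
          couplingRate γ g (μ.map (S 0)) Pt t := by
  obtain ⟨ω₀⟩ : Nonempty Ω := nonempty_of_isProbabilityMeasure μ
  have : Nonempty 𝒮 := ⟨S 0 ω₀⟩
  have hXm : ∀ t, Measurable (X t) := fun t => by
    have : X t = g ∘ S t := funext (hX t)
    rw [this]
    exact hg.comp (hS t)
  have hSp : Measurable fun ω => pastSeq (path S ω) 0 :=
    (measurable_pastSeq 0).comp (measurable_path hS)
  have hXp : Measurable fun ω => pastSeq (path X ω) 0 :=
    (measurable_pastSeq 0).comp (measurable_path hXm)
  have hSf : Measurable fun ω => futSeq (path S ω) := measurable_futSeq.comp (measurable_path hS)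
  have hXf : Measurable fun ω => futSeq (path X ω) := measurable_futSeq.comp (measurable_path hXm)
  have hprS := Measure.isProbabilityMeasure_map (μ := μ) hSp.aemeasurable
  have hprX := Measure.isProbabilityMeasure_map (μ := μ) hXp.aemeasurable
  let gs : (ℕ → 𝒮) → ℕ → Vec d := fun s i => g (s i)
  have hgs : Measurable gs := measurable_pi_iff.2 fun i => hg.comp (measurable_pi_apply i)
  -- The past of the covariates does not determine the state at time `0`, so the state is drawn from
  -- its conditional law.
  let κ : Kernel (ℕ → Vec d) 𝒮 := condDistrib (S 0) (fun ω => pastSeq (path X ω) 0) μ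
  have hκ : κ ∘ₘ (μ.map fun ω => pastSeq (path X ω) 0) = μ.map (S 0) :=
    condDistrib_comp_map hXp.aemeasurable (hS 0).aemeasurable
  have hκ' : (μ.map fun ω => pastSeq (path X ω) 0) ⊗ₘ κ =
      μ.map fun ω => (pastSeq (path X ω) 0, S 0 ω) :=
    compProd_map_condDistrib (hS 0).aemeasurable
  have hPm := Kernel.IsMarkovKernel.map P hgs
  have hPtm := Kernel.IsMarkovKernel.map Pt (hgs.prodMap hgs)
  have hQt : IsMarkovKernel ((Pt.map (Prod.map gs gs)) ∘ₖ (κ ∥ₖ κ)) := inferInstance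
  refine ⟨(P.map gs) ∘ₖ κ, (Pt.map (Prod.map gs gs)) ∘ₖ (κ ∥ₖ κ), inferInstance, hQt, ?_, ?_, ?_⟩
  · refine Measure.ext_of_lintegral _ fun f hf => ?_
    rw [lintegral_map hf (hXp.prodMk hXf), Measure.lintegral_compProd hf]
    have hfa : ∀ a, Measurable fun b => f (a, b) := fun a =>
      hf.comp (measurable_const.prodMk measurable_id)
    have h1 : ∀ a, ∫⁻ b, f (a, b) ∂((P.map gs ∘ₖ κ) a) =
        ∫⁻ s, ∫⁻ b, f (a, gs b) ∂(P s) ∂(κ a) := by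
      intro a
      rw [Kernel.lintegral_comp _ _ _ (hfa a)]
      refine lintegral_congr fun s => ?_
      rw [Kernel.map_apply _ hgs, lintegral_map (hfa a) hgs]
    simp only [h1]
    have hm1 : Measurable fun as : ((ℕ → Vec d) × 𝒮) × (ℕ → 𝒮) => f (as.1.1, gs as.2) :=
      hf.comp ((measurable_fst.comp measurable_fst).prodMk (hgs.comp measurable_snd))
    have hm2 : Measurable fun as : (ℕ → Vec d) × 𝒮 => ∫⁻ b, f (as.1, gs b) ∂(P as.2) :=
      hm1.lintegral_kernel_prod_right' (κ := P.comap Prod.snd measurable_snd)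
    rw [← Measure.lintegral_compProd hm2, hκ', lintegral_map hm2 (hXp.prodMk (hS 0))]
    have hm3 : Measurable fun ab : (ℕ → 𝒮) × (ℕ → 𝒮) => f (gs ab.1, gs ab.2) :=
      hf.comp ((hgs.comp measurable_fst).prodMk (hgs.comp measurable_snd))
    -- The Markov property at time `0`, tested on functions of the covariates, whose past is a
    -- function of the past states.
    have h2 := congrArg (fun m => ∫⁻ ab, f (gs ab.1, gs ab.2) ∂m) (hM 0)
    have hSf' : Measurable fun ω => (fun i : ℕ => S (0 + 1 + i) ω) := hSf
    rw [lintegral_map hm3 (hSp.prodMk hSf'), Measure.lintegral_compProd hm3,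
      lintegral_map hm3.lintegral_kernel_prod_right' hSp] at h2
    have hgp : ∀ ω, pastSeq (path X ω) 0 = gs (pastSeq (path S ω) 0) := fun ω => by
      funext i
      exact hX _ _
    have hgf : ∀ ω, futSeq (path X ω) = gs (futSeq (path S ω)) := fun ω => by
      funext i
      exact hX _ _
    simp only [hgp, hgf]
    exact h2
  · intro s
    constructor
    · refine Measure.ext_of_lintegral _ fun f hf => ?_
      have hf' : Measurable fun b : (ℕ → Vec d) × (ℕ → Vec d) => f b.1 := hf.comp measurable_fst
      rw [lintegral_map hf measurable_fst, Kernel.lintegral_comp _ _ _ hf',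
        Kernel.lintegral_comp _ _ _ hf, Kernel.parallelComp_apply]
      have h1 : ∀ r : 𝒮 × 𝒮, ∫⁻ b, f b.1 ∂(Pt.map (Prod.map gs gs) r) =
          ∫⁻ b, f b ∂(P.map gs r.1) := by
        intro r
        have hfs : Measurable fun b => f (gs b) := hf.comp hgs
        rw [Kernel.map_apply _ (hgs.prodMap hgs), Kernel.map_apply _ hgs, lintegral_map hf hgs,
          lintegral_map hf' (hgs.prodMap hgs), ← (hPt r).1,
          lintegral_map hfs measurable_fst]
        rfl
      simp only [h1]
      exact measurePreserving_fst.lintegral_comp (hf.lintegral_kernel (κ := P.map gs))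
    · refine Measure.ext_of_lintegral _ fun f hf => ?_
      have hf' : Measurable fun b : (ℕ → Vec d) × (ℕ → Vec d) => f b.2 := hf.comp measurable_snd
      rw [lintegral_map hf measurable_snd, Kernel.lintegral_comp _ _ _ hf',
        Kernel.lintegral_comp _ _ _ hf, Kernel.parallelComp_apply]
      have h1 : ∀ r : 𝒮 × 𝒮, ∫⁻ b, f b.2 ∂(Pt.map (Prod.map gs gs) r) =
          ∫⁻ b, f b ∂(P.map gs r.2) := by
        intro r
        have hfs : Measurable fun b => f (gs b) := hf.comp hgs
        rw [Kernel.map_apply _ (hgs.prodMap hgs), Kernel.map_apply _ hgs, lintegral_map hf hgs,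
          lintegral_map hf' (hgs.prodMap hgs), ← (hPt r).2,
          lintegral_map hfs measurable_snd]
        rfl
      simp only [h1]
      exact measurePreserving_snd.lintegral_comp (hf.lintegral_kernel (κ := P.map gs))
  · intro γ hγ t ht
    have hc : Measurable fun zz : (ℤ → Vec d) × (ℤ → Vec d) => γ (zz.1 t) (zz.2 t) :=
      hγ.comp (f := fun zz : (ℤ → Vec d) × (ℤ → Vec d) => (zz.1 t, zz.2 t))
        (((measurable_pi_apply (t : ℤ)).comp measurable_fst).prodMk
        ((measurable_pi_apply (t : ℤ)).comp measurable_snd))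
    have hc1 : Measurable fun zz : (ℕ → Vec d) × (ℕ → Vec d) => γ (zz.1 (t - 1)) (zz.2 (t - 1)) :=
      hγ.comp (f := fun zz : (ℕ → Vec d) × (ℕ → Vec d) => (zz.1 (t - 1), zz.2 (t - 1)))
        (((measurable_pi_apply (t - 1)).comp measurable_fst).prodMk
        ((measurable_pi_apply (t - 1)).comp measurable_snd))
    have hc' : Measurable fun p : (ℕ → 𝒮) × (ℕ → 𝒮) => γ (g (p.1 (t - 1))) (g (p.2 (t - 1))) :=
      hγ.comp ((hg.comp ((measurable_pi_apply _).comp measurable_fst)).prodMk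
        (hg.comp ((measurable_pi_apply _).comp measurable_snd)))
    -- The coupling of (C) is started from states drawn separately by `κ`; over independent pasts
    -- their joint law is `π ⊗ π`, which gives exactly the rate of (C).
    rw [lintegral_coupledLaw_eq _ hc, couplingRate, ← hκ, ← parallelComp_comp_prod_measure,
      Measure.lintegral_bind (Kernel.aemeasurable _) hc'.lintegral_kernel.aemeasurable]
    refine lintegral_congr fun s => ?_
    simp only [glue_natCast _ _ ht]
    rw [Kernel.lintegral_comp _ _ _ hc1]
    refine lintegral_congr fun r => ?_
    rw [Kernel.map_apply _ (hgs.prodMap hgs), lintegral_map hc1 (hgs.prodMap hgs)]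
    rfl

end Couplings

/-! ### Rates of decay -/

section Rates

lemma IsBigORate.mono_left {u u' : ℕ → ℝ≥0∞} {v : ℕ → ℝ} (h : IsBigORate u v)
    (hu : ∀ᶠ n in atTop, u' n ≤ u n) : IsBigORate u' v := by
  obtain ⟨C, hC⟩ := h
  exact ⟨C, by filter_upwards [hC, hu] with n h1 h2 using h2.trans h1⟩

lemma IsBigORate.trans_le {u : ℕ → ℝ≥0∞} {v w : ℕ → ℝ} (h : IsBigORate u v)
    (hv : ∀ᶠ n in atTop, v n ≤ w n) : IsBigORate u w := by
  obtain ⟨C, hC⟩ := h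
  refine ⟨C, ?_⟩
  filter_upwards [hC, hv] with n h1 h2
  exact h1.trans (by gcongr)

lemma IsBigORate.add {u u' : ℕ → ℝ≥0∞} {v : ℕ → ℝ} (h : IsBigORate u v) (h' : IsBigORate u' v) :
    IsBigORate (fun n => u n + u' n) v := by
  obtain ⟨C, hC⟩ := h
  obtain ⟨C', hC'⟩ := h'
  refine ⟨C + C', ?_⟩
  filter_upwards [hC, hC'] with n h1 h2
  rw [ENNReal.coe_add, add_mul]
  exact add_le_add h1 h2

lemma IsBigORate.const_mul {u : ℕ → ℝ≥0∞} {v : ℕ → ℝ} (h : IsBigORate u v) {c : ℝ≥0∞}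
    (hc : c ≠ ∞) : IsBigORate (fun n => c * u n) v := by
  obtain ⟨C, hC⟩ := h
  lift c to ℝ≥0 using hc
  refine ⟨c * C, ?_⟩
  filter_upwards [hC] with n h1
  rw [ENNReal.coe_mul, mul_assoc]
  gcongr

lemma IsBigORate.rpow {u : ℕ → ℝ≥0∞} {v : ℕ → ℝ} (h : IsBigORate u v) (hv : ∀ n, 0 ≤ v n) {r : ℝ}
    (hr : 0 ≤ r) : IsBigORate (fun n => u n ^ r) (fun n => v n ^ r) := by
  obtain ⟨C, hC⟩ := h
  refine ⟨C ^ r, ?_⟩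
  filter_upwards [hC] with n h1
  rw [← ENNReal.ofReal_rpow_of_nonneg (hv n) hr, ENNReal.coe_rpow_of_nonneg _ hr,
    ← ENNReal.mul_rpow_of_nonneg _ _ hr]
  exact ENNReal.rpow_le_rpow h1 hr

/-- A geometric recursion does not change the order of an input that decays more slowly. -/
lemma IsBigORate.of_recursion {u α : ℕ → ℝ≥0∞} {v : ℕ → ℝ} {r r' : ℝ} (hr : 0 ≤ r) (hrr' : r < r')
    (hu0 : u 0 ≠ ∞) (hu : ∀ s, u (s + 1) ≤ ENNReal.ofReal r * u s + α (s + 1))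
    (hα : ∀ s, α s ≠ ∞) (hαv : IsBigORate α v)
    (hv : ∀ᶠ s in atTop, 0 < v s ∧ r' * v s ≤ v (s + 1)) : IsBigORate u v := by
  have hfin : ∀ s, u s ≠ ∞ := by
    intro s
    induction s with
    | zero => exact hu0
    | succ s ih =>
      exact ne_top_of_le_ne_top (ENNReal.add_ne_top.2
        ⟨ENNReal.mul_ne_top ENNReal.ofReal_ne_top ih, hα _⟩) (hu s)
  obtain ⟨C, hC⟩ := hαv
  obtain ⟨N, hN⟩ := eventually_atTop.1 (hC.and hv)
  have hr'0 : 0 < r' := hr.trans_lt hrr'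
  have hvN := (hN N le_rfl).2.1
  -- The first entry covers the start at `N`; the second is the fixed point of `B ↦ (r / r') B + C`,
  -- so the recursion preserves `u s ≤ B v s`.
  set B : ℝ := max ((u N).toReal / v N) (C / (1 - r / r')) with hB
  have hrr1 : r / r' < 1 := (div_lt_one hr'0).2 hrr'
  have hB0 : 0 ≤ B := le_max_of_le_left (div_nonneg ENNReal.toReal_nonneg hvN.le)
  have hBC : r / r' * B + C ≤ B := by
    have h1 : (C : ℝ) / (1 - r / r') ≤ B := le_max_right _ _
    rw [div_le_iff₀ (by linarith)] at h1
    linarith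
  have key : ∀ s, N ≤ s → u s ≤ ENNReal.ofReal (B * v s) := by
    intro s hs
    induction s, hs using Nat.le_induction with
    | base =>
      rw [← ENNReal.ofReal_toReal (hfin N)]
      refine ENNReal.ofReal_le_ofReal ?_
      have h1 : (u N).toReal / v N ≤ B := le_max_left _ _
      rwa [div_le_iff₀ hvN] at h1
    | succ s hs ih =>
      have h1 := (hN s hs).2
      have h2 := (hN (s + 1) (by omega)).1
      have h3 := (hN (s + 1) (by omega)).2.1
      calc u (s + 1) ≤ ENNReal.ofReal r * u s + α (s + 1) := hu s
        _ ≤ ENNReal.ofReal r * ENNReal.ofReal (B * v s) + C * ENNReal.ofReal (v (s + 1)) := by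
          gcongr
        _ = ENNReal.ofReal (r * (B * v s) + C * v (s + 1)) := by
          rw [ENNReal.ofReal_add (mul_nonneg hr (mul_nonneg hB0 h1.1.le))
            (mul_nonneg C.coe_nonneg h3.le), ENNReal.ofReal_mul hr,
            ENNReal.ofReal_mul C.coe_nonneg, ENNReal.ofReal_coe_nnreal]
        _ ≤ ENNReal.ofReal (B * v (s + 1)) := by
          refine ENNReal.ofReal_le_ofReal ?_
          have h4 : v s ≤ v (s + 1) / r' := (le_div_iff₀ hr'0).2 (by linarith [h1.2])
          calc r * (B * v s) + C * v (s + 1) ≤ r * (B * (v (s + 1) / r')) + C * v (s + 1) := by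
                gcongr
            _ = (r / r' * B + C) * v (s + 1) := by ring
            _ ≤ B * v (s + 1) := by gcongr
  refine ⟨B.toNNReal, eventually_atTop.2 ⟨N, fun s hs => (key s hs).trans ?_⟩⟩
  rw [ENNReal.ofReal_mul hB0]
  rfl

/-- Geometric convolutions satisfy the recursion of `IsBigORate.of_recursion`. All terms at
nonpositive times are carried along inside the value at `s = 0`. -/
lemma tsum_geometric_step (a : ℝ≥0∞) (f : ℤ → ℝ≥0∞) (s : ℕ) :
    ∑' i : ℕ, a ^ i * f ((s + 1 : ℕ) - i) = a * ∑' i : ℕ, a ^ i * f (s - i) + f (s + 1 : ℕ) := by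
  rw [tsum_eq_zero_add' ENNReal.summable, add_comm, ← ENNReal.tsum_mul_left]
  congr 1
  · refine tsum_congr fun i => ?_
    rw [pow_succ', mul_assoc]
    congr 3
    push_cast
    ring
  · simp

/-- The means of accumulated errors decay like those of the inputs. -/
lemma isBigORate_lintegral_accum {Θ : Type*} [MeasurableSpace Θ] {π : Measure Θ}
    [IsProbabilityMeasure π] {δ : ℕ → Θ → ℝ} (hδm : ∀ n, Measurable (δ n))
    {D : ℤ → Θ → ℝ≥0∞} (hDm : ∀ t, Measurable (D t)) {K M : ℝ≥0∞} (hK : K ≠ ∞) (hM : M ≠ ∞)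
    {θ ρ r : ℝ} (hθ0 : 0 ≤ θ) (hθ1 : θ < 1) (hρ : 0 ≤ ρ) (hθr : θ < r) (hρr : ρ < r)
    (hδ : ∀ (n : ℕ) x, ENNReal.ofReal (δ n x) ≤
      K * ∑' i : ℕ, ENNReal.ofReal θ ^ i * D ((n + 1 : ℕ) - i) x)
    (hDM : ∀ t, ∫⁻ x, D t x ∂π ≤ M) {v : ℕ → ℝ}
    (hv : ∀ᶠ s in atTop, 0 < v s ∧ r * v s ≤ v (s + 1))
    (hD : IsBigORate (fun s => ∫⁻ x, D s x ∂π) v) :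
    IsBigORate (fun s => ∫⁻ x, ENNReal.ofReal (accum ρ (fun n => δ n x) s) ∂π) v := by
  set α : ℤ → ℝ≥0∞ := fun t => ∫⁻ x, D t x ∂π with hα
  set e : ℕ → ℝ≥0∞ := fun s => ∑' i : ℕ, ENNReal.ofReal θ ^ i * α (s - i) with he
  have he_le : ∀ s, e s ≤ (1 - ENNReal.ofReal θ)⁻¹ * M := by
    intro s
    rw [← ENNReal.tsum_geometric, ← ENNReal.tsum_mul_right]
    exact ENNReal.tsum_le_tsum fun i => by gcongr; exact hDM _
  have he_fin : ∀ s, e s ≠ ∞ := fun s => ne_top_of_le_ne_top (ENNReal.mul_ne_top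
    (ENNReal.inv_ne_top.2 (tsub_pos_of_lt (ENNReal.ofReal_lt_one.2 hθ1)).ne') hM) (he_le s)
  -- Two geometric recursions are nested: first the discounted sum of past differences with rate
  -- `θ`, then the accumulation with rate `ρ`.
  have heO : IsBigORate e v := by
    refine IsBigORate.of_recursion (α := fun s : ℕ => α s) hθ0 hθr (he_fin 0)
      (fun s => (tsum_geometric_step _ α s).le)
      (fun s => ne_top_of_le_ne_top hM (hDM s)) hD hv
  have hacc : ∀ s, Measurable fun x => accum ρ (fun n => δ n x) s := by
    intro s
    induction s with
    | zero => exact measurable_const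
    | succ s ih => exact (ih.const_mul ρ).add (hδm s)
  refine IsBigORate.of_recursion (α := fun s => K * e s) hρ hρr ?_ (fun s => ?_)
    (fun s => ENNReal.mul_ne_top hK (he_fin s)) (heO.const_mul hK) hv
  · simp [accum]
  · have h1 : ∀ x, ENNReal.ofReal (accum ρ (fun n => δ n x) (s + 1)) ≤
        ENNReal.ofReal ρ * ENNReal.ofReal (accum ρ (fun n => δ n x) s) +
          K * ∑' i : ℕ, ENNReal.ofReal θ ^ i * D ((s + 1 : ℕ) - i) x := by
      intro x
      refine (ENNReal.ofReal_add_le).trans ?_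
      rw [ENNReal.ofReal_mul hρ]
      gcongr
      exact hδ s x
    have hm : ∀ i : ℕ, Measurable fun x => ENNReal.ofReal θ ^ i * D ((s + 1 : ℕ) - i) x :=
      fun i => (hDm _).const_mul _
    refine (lintegral_mono h1).trans_eq ?_
    rw [lintegral_add_left ((hacc s).ennreal_ofReal.const_mul _),
      lintegral_const_mul _ (hacc s).ennreal_ofReal, lintegral_const_mul _ (Measurable.tsum hm),
      lintegral_tsum fun i => (hm i).aemeasurable]
    congr 2
    refine tsum_congr fun i => ?_
    rw [lintegral_const_mul _ (hDm _)]

/-- Polynomial rates decay more slowly than any geometric sequence, since the ratio of consecutive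
values tends to one. -/
lemma eventually_rpow_ratio {κ r : ℝ} (hr : r < 1) :
    ∀ᶠ s : ℕ in atTop, 0 < (s : ℝ) ^ (-κ) ∧ r * (s : ℝ) ^ (-κ) ≤ ((s + 1 : ℕ) : ℝ) ^ (-κ) := by
  have h1 : Tendsto (fun s : ℕ => (((s + 1 : ℕ) : ℝ) / s) ^ (-κ)) atTop (𝓝 1) := by
    have h2 : Tendsto (fun s : ℕ => ((s + 1 : ℕ) : ℝ) / s) atTop (𝓝 1) := by
      have h3 : Tendsto (fun s : ℕ => 1 + (1 : ℝ) / s) atTop (𝓝 (1 + 0)) :=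
        tendsto_const_nhds.add (tendsto_const_div_atTop_nhds_zero_nat 1)
      rw [add_zero] at h3
      refine h3.congr' ?_
      filter_upwards [eventually_gt_atTop 0] with s hs
      have : (s : ℝ) ≠ 0 := by positivity
      push_cast
      field_simp
    have h4 := h2.rpow_const (p := -κ) (Or.inl one_ne_zero)
    rwa [Real.one_rpow] at h4
  filter_upwards [h1.eventually_const_le hr, eventually_gt_atTop 0] with s hs h0
  have h0' : (0 : ℝ) < s := by exact_mod_cast h0
  have hp : 0 < (s : ℝ) ^ (-κ) := Real.rpow_pos_of_pos h0' _
  refine ⟨hp, ?_⟩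
  rwa [Real.div_rpow (by positivity) h0'.le, le_div_iff₀ hp] at hs

/-- The comparison of `x ^ (-(c + 1))` at `s + 1` with its integral over `[s, s + 1]`, obtained from
`exp t ≥ 1 + t` and `log y ≥ 1 - 1 / y` with `y = (s + 1) / s`. -/
lemma rpow_neg_le_sub {c : ℝ} (hc : 0 < c) {s : ℕ} (hs : 1 ≤ s) :
    ((s + 1 : ℕ) : ℝ) ^ (-(c + 1)) ≤ c⁻¹ * ((s : ℝ) ^ (-c) - ((s + 1 : ℕ) : ℝ) ^ (-c)) := by
  have hs0 : (0 : ℝ) < s := by exact_mod_cast hs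
  have hs1 : (0 : ℝ) < (s + 1 : ℕ) := by positivity
  set y : ℝ := ((s + 1 : ℕ) : ℝ) / s with hy
  have hy0 : 0 < y := div_pos hs1 hs0
  have h1 : 1 + c * ((s + 1 : ℕ) : ℝ)⁻¹ ≤ y ^ c := by
    rw [Real.rpow_def_of_pos hy0]
    have h2 := Real.add_one_le_exp (Real.log y * c)
    have h3 := Real.one_sub_inv_le_log_of_pos hy0
    have h4 : 1 - y⁻¹ = ((s + 1 : ℕ) : ℝ)⁻¹ := by
      rw [hy]
      push_cast
      field_simp
      ring
    rw [h4] at h3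
    nlinarith
  have h5 : (s : ℝ) ^ (-c) = y ^ c * ((s + 1 : ℕ) : ℝ) ^ (-c) := by
    rw [hy, Real.div_rpow hs1.le hs0.le, Real.rpow_neg hs1.le, Real.rpow_neg hs0.le]
    have : ((s + 1 : ℕ) : ℝ) ^ c ≠ 0 := (Real.rpow_pos_of_pos hs1 c).ne'
    field_simp
  have h6 : ((s + 1 : ℕ) : ℝ) ^ (-(c + 1)) =
      ((s + 1 : ℕ) : ℝ) ^ (-c) * ((s + 1 : ℕ) : ℝ)⁻¹ := by
    rw [neg_add, Real.rpow_add hs1, Real.rpow_neg_one]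
  have h7 : 0 ≤ ((s + 1 : ℕ) : ℝ) ^ (-c) := Real.rpow_nonneg hs1.le _
  rw [h6, h5, inv_mul_eq_div, le_div_iff₀ hc]
  nlinarith

/-- Telescoping `rpow_neg_le_sub` gives a tail of order `(n - 1) ^ (-κ + 1)`; since `n ≤ 2 (n - 1)`
for `n ≥ 2`, returning to `n` costs `2 ^ (κ - 1)`. -/
lemma tsum_rpow_le {κ : ℝ} (hκ : 1 < κ) {n : ℕ} (hn : 2 ≤ n) :
    ∑' i : ℕ, ENNReal.ofReal (((n + i : ℕ) : ℝ) ^ (-κ)) ≤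
      ENNReal.ofReal ((κ - 1)⁻¹ * 2 ^ (κ - 1)) * ENNReal.ofReal ((n : ℝ) ^ (-κ + 1)) := by
  obtain ⟨c, hc, rfl⟩ : ∃ c : ℝ, 0 < c ∧ κ = c + 1 := ⟨κ - 1, by linarith, by ring⟩
  obtain ⟨k, hk, rfl⟩ : ∃ k : ℕ, 1 ≤ k ∧ n = k + 1 := ⟨n - 1, by omega, by omega⟩
  have hk0 : (0 : ℝ) < k := by exact_mod_cast hk
  rw [add_sub_cancel_right, ← ENNReal.ofReal_mul (by positivity)]
  refine ENNReal.tsum_le_of_sum_range_le fun m => ?_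
  rw [← ENNReal.ofReal_sum_of_nonneg fun i _ => by positivity]
  refine ENNReal.ofReal_le_ofReal ?_
  have h1 : ∀ m : ℕ, ∑ i ∈ Finset.range m, ((k + 1 + i : ℕ) : ℝ) ^ (-(c + 1)) ≤
      c⁻¹ * ((k : ℝ) ^ (-c) - ((k + m : ℕ) : ℝ) ^ (-c)) := by
    intro m
    induction m with
    | zero => simp
    | succ m ih =>
      rw [Finset.sum_range_succ]
      have h2 := rpow_neg_le_sub hc (s := k + m) (by omega)
      have h3 : k + 1 + m = k + m + 1 := by ring
      rw [h3, ← add_assoc k m 1]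
      calc _ ≤ c⁻¹ * ((k : ℝ) ^ (-c) - ((k + m : ℕ) : ℝ) ^ (-c)) +
            c⁻¹ * (((k + m : ℕ) : ℝ) ^ (-c) - ((k + m + 1 : ℕ) : ℝ) ^ (-c)) := add_le_add ih h2
        _ = _ := by ring
  refine (h1 m).trans ?_
  rw [mul_assoc]
  refine mul_le_mul_of_nonneg_left ?_ (inv_nonneg.2 hc.le)
  have h4 : 0 ≤ ((k + m : ℕ) : ℝ) ^ (-c) := by positivity
  have h5 : (k : ℝ) ^ (-c) ≤ 2 ^ c * ((k + 1 : ℕ) : ℝ) ^ (-(c + 1) + 1) := by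
    have h6 : -(c + 1) + 1 = -c := by ring
    have h7 : (2 : ℝ) ^ c = (1 / 2 : ℝ) ^ (-c) := by
      rw [one_div, Real.inv_rpow zero_le_two, Real.rpow_neg zero_le_two, inv_inv]
    rw [h6, h7, ← Real.mul_rpow (by norm_num) (by positivity)]
    refine Real.rpow_le_rpow_of_nonpos (by positivity) ?_ (by linarith)
    have : (1 : ℝ) ≤ k := by exact_mod_cast hk
    push_cast
    linarith
  linarith

lemma tsum_ofReal_pow {ρ : ℝ} (h0 : 0 ≤ ρ) (n : ℕ) :
    ∑' i : ℕ, ENNReal.ofReal (ρ ^ (n + i)) =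
      (1 - ENNReal.ofReal ρ)⁻¹ * ENNReal.ofReal (ρ ^ n) := by
  rw [← ENNReal.tsum_geometric, ← ENNReal.tsum_mul_right]
  refine tsum_congr fun i => ?_
  rw [← ENNReal.ofReal_pow h0, ← ENNReal.ofReal_mul (by positivity), ← pow_add, add_comm]

/-- Tail sums of a sequence of order `v`. -/
lemma IsBigORate.tsum {u β : ℕ → ℝ≥0∞} {v w : ℕ → ℝ} (hu : IsBigORate u v)
    (hβ : ∀ᶠ n in atTop, β n ≤ ∑' i : ℕ, u (n + i)) {C : ℝ≥0∞} (hC : C ≠ ∞)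
    (hw : ∀ᶠ n in atTop, ∑' i : ℕ, ENNReal.ofReal (v (n + i)) ≤ C * ENNReal.ofReal (w n)) :
    IsBigORate β w := by
  obtain ⟨c, hc⟩ := hu
  obtain ⟨N, hN⟩ := eventually_atTop.1 hc
  lift C to ℝ≥0 using hC
  refine ⟨c * C, ?_⟩
  filter_upwards [hβ, hw, eventually_ge_atTop N] with n h1 h2 h3
  calc β n ≤ ∑' i : ℕ, u (n + i) := h1
    _ ≤ ∑' i : ℕ, c * ENNReal.ofReal (v (n + i)) :=
      ENNReal.tsum_le_tsum fun i => hN _ (by omega)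
    _ = c * ∑' i : ℕ, ENNReal.ofReal (v (n + i)) := ENNReal.tsum_mul_left
    _ ≤ c * (C * ENNReal.ofReal (w n)) := by gcongr
    _ = _ := by rw [ENNReal.coe_mul, mul_assoc]

lemma IsBigORate.tendsto_zero {u : ℕ → ℝ≥0∞} {v : ℕ → ℝ} (hu : IsBigORate u v)
    (hv : Tendsto v atTop (𝓝 0)) : Tendsto u atTop (𝓝 0) := by
  obtain ⟨C, hC⟩ := hu
  have h1 : Tendsto (fun n => (C : ℝ≥0∞) * ENNReal.ofReal (v n)) atTop (𝓝 (C * 0)) := by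
    refine ENNReal.Tendsto.const_mul ?_ (Or.inr ENNReal.coe_ne_top)
    simpa using ENNReal.tendsto_ofReal hv
  rw [mul_zero] at h1
  exact tendsto_of_tendsto_of_tendsto_of_le_of_le' tendsto_const_nhds h1
    (Eventually.of_forall fun _ => zero_le) hC

/-- The coefficient `τ` is of the order of the contributions of the single times. -/
lemma isBigORate_tauCoeff {Ω E T : Type*} [MeasurableSpace Ω] [Fintype E] [Nonempty E]
    [DecidableEq E] [MeasurableSpace E] [DiscreteMeasurableSpace E] [MeasurableSpace T] {d : ℕ}
    {V : ℤ → Ω → E × Vec d} {ξ : Ω → T} {μ : Measure Ω} [IsFiniteMeasure μ]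
    {u : ℕ → ℝ≥0∞} {v : ℕ → ℝ} (hu : IsBigORate u v) {n₀ : ℕ}
    (hv : ∀ m n, n₀ ≤ m → m ≤ n → v n ≤ v m)
    (hτ : ∀ (ℓ : ℕ) (J : Fin ℓ → ℤ), (∀ i, 1 ≤ J i) →
      tauBlock V ξ μ J ≤ ∑ i, u (J i).toNat) :
    IsBigORate (tauCoeff V ξ μ) v := by
  obtain ⟨C, hC⟩ := hu
  obtain ⟨N, hN⟩ := eventually_atTop.1 hC
  refine ⟨C, ?_⟩
  filter_upwards [eventually_ge_atTop N, eventually_ge_atTop n₀, eventually_ge_atTop 1]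
    with n h1 h2 h3
  refine iSup₂_le fun k hk => iSup₂_le fun ℓ hℓ => ?_
  have hℓ1 : 1 ≤ ℓ := (Finset.mem_Icc.1 hℓ).1
  -- Each of the `ℓ` times is at least `n`, where `v` is already nonincreasing; the factor `ℓ` is
  -- removed by the normalization.
  have h4 : (⨆ (J : Fin ℓ → ℤ) (_ : StrictMono J) (_ : ∀ i, (n : ℤ) ≤ J i), tauBlock V ξ μ J) ≤
      ℓ * (C * ENNReal.ofReal (v n)) := by
    refine iSup_le fun J => iSup₂_le fun _ hJ => ?_
    refine (hτ ℓ J fun i => by have := hJ i; omega).trans ?_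
    calc ∑ i, u (J i).toNat ≤ ∑ _i : Fin ℓ, C * ENNReal.ofReal (v n) := by
          refine Finset.sum_le_sum fun i _ => ?_
          have h5 := hJ i
          refine (hN _ (by omega)).trans ?_
          gcongr
          exact hv _ _ h2 (by omega)
      _ = _ := by simp
  have hℓ0 : (ℓ : ℝ≥0∞) ≠ 0 := by exact_mod_cast (by omega : ℓ ≠ 0)
  calc (ℓ : ℝ≥0∞)⁻¹ * _ ≤ (ℓ : ℝ≥0∞)⁻¹ * (ℓ * (C * ENNReal.ofReal (v n))) := by gcongr
    _ = C * ENNReal.ofReal (v n) := by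
      rw [← mul_assoc, ENNReal.inv_mul_cancel hℓ0 (ENNReal.natCast_ne_top ℓ), one_mul]

end Rates

/-! ### Moments under the coupled law -/

section Moments

variable {d : ℕ}

/-- Hölder's inequality on the support of `f`. Applied to the difference of two coupled vectors, it
lets the probability that they differ appear as a factor. -/
lemma eLpNorm_le_mul_measure_support {Θ F : Type*} [MeasurableSpace Θ] {π : Measure Θ}
    [NormedAddCommGroup F] [MeasurableSpace F] [BorelSpace F] [SecondCountableTopology F]
    {f : Θ → F} (hf : Measurable f) {r p : ℝ≥0∞} (hrp : r ≤ p) :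
    eLpNorm f r π ≤ eLpNorm f p π * π {x | f x ≠ 0} ^ (1 / r.toReal - 1 / p.toReal) := by
  have hA : MeasurableSet {x | f x ≠ 0} := (hf (measurableSet_singleton 0)).compl
  have h1 : Set.indicator {x | f x ≠ 0} f = f := by
    funext x
    by_cases hx : f x = 0
    · simp [Set.indicator, hx]
    · simp [Set.indicator, hx]
  calc eLpNorm f r π = eLpNorm f r (π.restrict {x | f x ≠ 0}) := by
        rw [← eLpNorm_indicator_eq_eLpNorm_restrict hA, h1]
    _ ≤ _ := eLpNorm_le_eLpNorm_mul_rpow_measure_univ hrp hf.aestronglyMeasurable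
    _ ≤ _ := by
      rw [Measure.restrict_apply_univ]
      gcongr
      exact Measure.restrict_le_self

lemma lintegral_discreteCost {Θ : Type*} [MeasurableSpace Θ] {π : Measure Θ} {x x' : Θ → Vec d}
    (hx : Measurable x) (hx' : Measurable x') :
    ∫⁻ s, discreteCost (x s) (x' s) ∂π = π {s | x s - x' s ≠ 0} := by
  have hA : MeasurableSet {s | x s - x' s ≠ 0} :=
    ((hx.sub hx') (measurableSet_singleton 0)).compl
  rw [← lintegral_indicator_one hA]
  refine lintegral_congr fun s => ?_
  by_cases h : x s = x' s
  · simp [discreteCost, h]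
  · simp [discreteCost, h, sub_eq_zero]

lemma lintegral_normCost {Θ : Type*} [MeasurableSpace Θ] {π : Measure Θ} (x x' : Θ → Vec d) :
    ∫⁻ s, normCost (x s) (x' s) ∂π = eLpNorm (fun s => x s - x' s) 1 π := by
  rw [eLpNorm_one_eq_lintegral_enorm]
  refine lintegral_congr fun s => ?_
  rw [normCost, ofReal_norm]

/-- Hölder's inequality for coupled vectors. -/
lemma lintegral_normCost_le {Θ : Type*} [MeasurableSpace Θ] {π : Measure Θ} {x x' : Θ → Vec d}
    (hx : Measurable x) (hx' : Measurable x') {p p' : ℝ≥0∞} (hpp : p⁻¹ + p'⁻¹ = 1) :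
    ∫⁻ s, normCost (x s) (x' s) ∂π ≤ eLpNorm (fun s => x s - x' s) p π *
      (∫⁻ s, discreteCost (x s) (x' s) ∂π) ^ (p'.toReal)⁻¹ := by
  have hp1 : 1 ≤ p := by
    rw [← ENNReal.inv_le_one, ← hpp]
    exact le_self_add
  -- The conventions `toReal ∞ = 0` and `0⁻¹ = 0` make this true for the pairs `(1, ∞)` and `(∞, 1)`
  -- as well.
  have hexp : 1 / (1 : ℝ≥0∞).toReal - 1 / p.toReal = (p'.toReal)⁻¹ := by
    have h1 := congrArg ENNReal.toReal hpp
    have h2 : p⁻¹ ≠ ∞ := ENNReal.inv_ne_top.2 (by positivity)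
    have h3 : p'⁻¹ ≠ ∞ := ne_top_of_le_ne_top ENNReal.one_ne_top (hpp ▸ le_add_self)
    rw [ENNReal.toReal_add h2 h3, ENNReal.toReal_inv, ENNReal.toReal_inv] at h1
    simp only [ENNReal.toReal_one] at h1 ⊢
    rw [one_div, one_div, inv_one]
    linarith
  rw [lintegral_normCost, lintegral_discreteCost hx hx', ← hexp]
  exact eLpNorm_le_mul_measure_support (hx.sub hx') hp1

/-- The Cauchy–Schwarz inequality for square roots of coupled vectors. -/
lemma lintegral_sqrt_normCost_le {Θ : Type*} [MeasurableSpace Θ] {π : Measure Θ}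
    {x x' : Θ → Vec d} (hx : Measurable x) (hx' : Measurable x') :
    ∫⁻ s, normCost (x s) (x' s) ^ (1 / 2 : ℝ) ∂π ≤ ((∫⁻ s, normCost (x s) (x' s) ∂π) *
      ∫⁻ s, discreteCost (x s) (x' s) ∂π) ^ (1 / 2 : ℝ) := by
  have h2 : (2⁻¹ : ℝ≥0∞).toReal = 1 / 2 := by simp
  have h1 := eLpNorm_le_mul_measure_support (π := π) (hx.sub hx') (r := 2⁻¹) (p := 1)
    (by simp)
  rw [eLpNorm_eq_lintegral_rpow_enorm_toReal (by simp) (by simp), h2] at h1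
  rw [lintegral_normCost, lintegral_discreteCost hx hx']
  have h3 : ∀ s, normCost (x s) (x' s) ^ (1 / 2 : ℝ) = ‖x s - x' s‖ₑ ^ (1 / 2 : ℝ) := fun s => by
    rw [normCost, ofReal_norm]
  simp only [h3]
  have h4 := ENNReal.rpow_le_rpow h1 (by norm_num : (0 : ℝ) ≤ 1 / 2)
  rw [← ENNReal.rpow_mul] at h4
  norm_num at h4 ⊢
  exact h4

/-- A divergent real series has the value `0`, so the inequality needs no summability and `covError`
can be bounded for all paths. -/
lemma ofReal_tsum_le {f : ℕ → ℝ} (hf : ∀ i, 0 ≤ f i) :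
    ENNReal.ofReal (∑' i, f i) ≤ ∑' i, ENNReal.ofReal (f i) := by
  by_cases h : Summable f
  · exact (ENNReal.ofReal_tsum_of_nonneg hf h).le
  · rw [tsum_eq_zero_of_not_summable h]
    simp

lemma ofReal_covError_le {K θ : ℝ} (hK : 0 ≤ K) (hθ : 0 ≤ θ) (t : ℤ) (x x' : ℤ → Vec d) :
    ENNReal.ofReal (covError K θ t x x') ≤
      ENNReal.ofReal K * ∑' i : ℕ, ENNReal.ofReal θ ^ i * normCost (x (t - i)) (x' (t - i)) := by
  refine (ENNReal.ofReal_le_ofReal (min_le_right _ _)).trans ?_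
  rw [ENNReal.ofReal_mul hK]
  gcongr
  refine (ofReal_tsum_le fun i => by positivity).trans_eq (tsum_congr fun i => ?_)
  rw [ENNReal.ofReal_mul (by positivity), ENNReal.ofReal_pow hθ, normCost]

/-- Either some term is at least one, and so is its root, or all terms are below one and are
dominated by their roots. -/
lemma min_one_tsum_le (f : ℕ → ℝ≥0∞) : min 1 (∑' i, f i) ≤ ∑' i, f i ^ (1 / 2 : ℝ) := by
  by_cases h : ∃ i, 1 ≤ f i
  · obtain ⟨i, hi⟩ := h
    refine (min_le_left _ _).trans (le_trans ?_ (ENNReal.le_tsum i))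
    exact ENNReal.one_le_rpow hi (by norm_num)
  · push Not at h
    refine (min_le_right _ _).trans (ENNReal.tsum_le_tsum fun i => ?_)
    calc f i = f i ^ (1 : ℝ) := (ENNReal.rpow_one _).symm
      _ ≤ _ := ENNReal.rpow_le_rpow_of_exponent_ge (h i).le (by norm_num)

/-- The cap at one in `covError` allows the passage to square roots, whose means are small when the
coupled covariates differ rarely, with only a first moment. The discount becomes `√θ`. -/
lemma ofReal_covError_le_sqrt {K θ : ℝ} (hK : 0 ≤ K) (hθ : 0 ≤ θ) (t : ℤ) (x x' : ℤ → Vec d) :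
    ENNReal.ofReal (covError K θ t x x') ≤ ENNReal.ofReal K ^ (1 / 2 : ℝ) *
      ∑' i : ℕ, ENNReal.ofReal √θ ^ i * normCost (x (t - i)) (x' (t - i)) ^ (1 / 2 : ℝ) := by
  have h1 : ENNReal.ofReal (covError K θ t x x') ≤ 1 :=
    ENNReal.ofReal_le_one.2 (min_le_left _ _)
  refine (le_min h1 (ofReal_covError_le hK hθ t x x')).trans ?_
  rw [← ENNReal.tsum_mul_left]
  refine (min_one_tsum_le _).trans_eq ?_
  rw [← ENNReal.tsum_mul_left]
  refine tsum_congr fun i => ?_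
  have h2 : (0 : ℝ) ≤ 1 / 2 := by norm_num
  rw [ENNReal.mul_rpow_of_nonneg _ _ h2, ENNReal.mul_rpow_of_nonneg _ _ h2, Real.sqrt_eq_rpow,
    ← ENNReal.ofReal_rpow_of_nonneg hθ h2, ← ENNReal.rpow_natCast, ← ENNReal.rpow_natCast,
    ← ENNReal.rpow_mul, ← ENNReal.rpow_mul, mul_comm (1 / 2 : ℝ)]

/-- The means of the costs of single times decay like the coupling rates. -/
lemma isBigORate_lintegral_blockCost {𝒵 : Type*} [MeasurableSpace 𝒵]
    {π : Measure ((ℤ → 𝒵) × (ℤ → 𝒵))} [IsProbabilityMeasure π] {γ : Vec d → Vec d → ℝ≥0∞}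
    (hγ : Measurable fun x : Vec d × Vec d => γ x.1 x.2) {h : 𝒵 → Vec d} (hh : Measurable h)
    {δ : ℤ → (ℤ → 𝒵) → (ℤ → 𝒵) → ℝ}
    (hδm : ∀ t, Measurable fun zz : (ℤ → 𝒵) × (ℤ → 𝒵) => δ t zz.1 zz.2)
    {D : ℤ → (ℤ → 𝒵) × (ℤ → 𝒵) → ℝ≥0∞} (hDm : ∀ t, Measurable (D t)) {K M : ℝ≥0∞} (hK : K ≠ ∞)
    (hM : M ≠ ∞) {θ ρ r : ℝ} (hθ0 : 0 ≤ θ) (hθ1 : θ < 1) (hρ : 0 ≤ ρ) (hθr : θ < r) (hρr : ρ < r)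
    (hδ : ∀ t zz, ENNReal.ofReal (δ t zz.1 zz.2) ≤
      K * ∑' i : ℕ, ENNReal.ofReal θ ^ i * D (t - i) zz)
    (hDM : ∀ t, ∫⁻ zz, D t zz ∂π ≤ M) {v : ℕ → ℝ}
    (hv : ∀ᶠ s in atTop, 0 < v s ∧ r * v s ≤ v (s + 1))
    (hγv : IsBigORate (fun s => ∫⁻ zz, γ (h (zz.1 s)) (h (zz.2 s)) ∂π) v)
    (hD : IsBigORate (fun s => ∫⁻ zz, D s zz ∂π) v) :
    IsBigORate (fun s => ∫⁻ zz, blockCost γ h ρ δ s zz.1 zz.2 ∂π) v := by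
  -- The step `n` of the chain started at time `0` produces the response at time `n + 1`, hence the
  -- shift in the error.
  have h1 := isBigORate_lintegral_accum (π := π) (δ := fun n zz => δ (0 + 1 + n) zz.1 zz.2)
    (fun n => hδm _) hDm hK hM hθ0 hθ1 hρ hθr hρr (fun n zz => by
      have := hδ (0 + 1 + n) zz
      have h2 : (0 + 1 + n : ℤ) = (n + 1 : ℕ) := by push_cast; ring
      rw [h2] at this ⊢
      exact this) hDM hv hD
  refine (hγv.add h1).mono_left (Eventually.of_forall fun s => ?_)
  have hm : Measurable fun zz : (ℤ → 𝒵) × (ℤ → 𝒵) => γ (h (zz.1 s)) (h (zz.2 s)) :=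
    hγ.comp (f := fun zz : (ℤ → 𝒵) × (ℤ → 𝒵) => (h (zz.1 s), h (zz.2 s)))
      ((hh.comp ((measurable_pi_apply (s : ℤ)).comp measurable_fst)).prodMk
      (hh.comp ((measurable_pi_apply (s : ℤ)).comp measurable_snd)))
  simp only [blockCost, Int.toNat_natCast]
  exact (lintegral_add_left hm _).le

end Moments

/-! ### Rates of the dependence coefficients -/

section Coefficients

variable {Ω : Type*} [MeasurableSpace Ω] {μ : Measure Ω} [IsProbabilityMeasure μ]
  {E : Type*} [Fintype E] [Nonempty E] [DecidableEq E] [MeasurableSpace E]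
  [DiscreteMeasurableSpace E] {d : ℕ} {𝒵 : Type*} [MeasurableSpace 𝒵]

lemma measurable_normCost : Measurable fun x : Vec d × Vec d => normCost x.1 x.2 :=
  (measurable_fst.sub measurable_snd).norm.ennreal_ofReal

lemma measurable_discreteCost : Measurable fun x : Vec d × Vec d => discreteCost x.1 x.2 := by
  unfold discreteCost
  exact Measurable.ite (measurableSet_eq_fun measurable_fst measurable_snd) measurable_const
    measurable_const

lemma normCost_le (x x' : Vec d) : normCost x x' ≤ ENNReal.ofReal ‖x‖ + ENNReal.ofReal ‖x'‖ := by
  rw [← ENNReal.ofReal_add (norm_nonneg _) (norm_nonneg _)]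
  exact ENNReal.ofReal_le_ofReal (norm_sub_le _ _)

lemma measurable_cost_apply {γ : Vec d → Vec d → ℝ≥0∞}
    (hγ : Measurable fun x : Vec d × Vec d => γ x.1 x.2) {h : 𝒵 → Vec d} (hh : Measurable h)
    (t : ℤ) : Measurable fun zz : (ℤ → 𝒵) × (ℤ → 𝒵) => γ (h (zz.1 t)) (h (zz.2 t)) :=
  hγ.comp (f := fun zz : (ℤ → 𝒵) × (ℤ → 𝒵) => (h (zz.1 t), h (zz.2 t)))
    ((hh.comp ((measurable_pi_apply t).comp measurable_fst)).prodMk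
    (hh.comp ((measurable_pi_apply t).comp measurable_snd)))

lemma measurable_covError_comp {h : 𝒵 → Vec d} (hh : Measurable h) (K θ : ℝ) (t : ℤ) :
    Measurable fun zz : (ℤ → 𝒵) × (ℤ → 𝒵) =>
      covError K θ t (fun r => h (zz.1 r)) fun r => h (zz.2 r) := by
  refine (measurable_covError K θ t).comp
    (f := fun zz : (ℤ → 𝒵) × (ℤ → 𝒵) => (fun r => h (zz.1 r), fun r => h (zz.2 r))) ?_
  refine Measurable.prodMk (measurable_pi_iff.2 fun r => ?_) (measurable_pi_iff.2 fun r => ?_)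
  · exact hh.comp ((measurable_pi_apply r).comp measurable_fst)
  · exact hh.comp ((measurable_pi_apply r).comp measurable_snd)

variable {Y : ℤ → Ω → E} {Z : ℤ → Ω → 𝒵} {Q : Kernel (ℕ → 𝒵) (ℕ → 𝒵)} [IsMarkovKernel Q]
  {Qt : Kernel ((ℕ → 𝒵) × (ℕ → 𝒵)) ((ℕ → 𝒵) × (ℕ → 𝒵))} [IsMarkovKernel Qt]

/-- Both marginals of the coupled law are the law of the exogenous process, at past times as well;
so distances are bounded in mean at all times, not only where (C) gives decay. -/
lemma lintegral_normCost_coupledLaw_le (hZ : ∀ t, Measurable (Z t))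
    (hQ : μ.map (fun ω => (pastSeq (path Z ω) 0, futSeq (path Z ω))) =
      μ.map (fun ω => pastSeq (path Z ω) 0) ⊗ₘ Q)
    (hQt : ∀ s, (Qt s).map Prod.fst = Q s.1 ∧ (Qt s).map Prod.snd = Q s.2)
    {h : 𝒵 → Vec d} (hh : Measurable h) {m : ℝ≥0∞}
    (hm : ∀ t, ∫⁻ ω, ENNReal.ofReal ‖h (Z t ω)‖ ∂μ ≤ m) (t : ℤ) :
    ∫⁻ zz, normCost (h (zz.1 t)) (h (zz.2 t))
      ∂(coupledLaw Qt (μ.map fun ω => pastSeq (path Z ω) 0)) ≤ m + m := by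
  have hf : Measurable fun z : ℤ → 𝒵 => ENNReal.ofReal ‖h (z t)‖ :=
    (hh.comp (measurable_pi_apply t)).norm.ennreal_ofReal
  have hf1 : Measurable fun zz : (ℤ → 𝒵) × (ℤ → 𝒵) => ENNReal.ofReal ‖h (zz.1 t)‖ :=
    hf.comp measurable_fst
  refine (lintegral_mono fun zz => normCost_le _ _).trans ?_
  rw [lintegral_add_left hf1]
  exact add_le_add ((lintegral_coupledLaw_fst hZ hQ hQt hf).trans_le (hm t))
    ((lintegral_coupledLaw_snd hZ hQ hQt hf).trans_le (hm t))

/-- The rate of `τ` for a response process that is driven by covariates with coupled futures. -/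
lemma isBigORate_tauCoeff_of_coupling {p : ℤ → (ℕ → E) × (ℤ → 𝒵) → E → ℝ} {𝒢 : Set (ℤ → 𝒵)}
    {K θ ρ : ℝ} (hK : 0 ≤ K) (hθ0 : 0 ≤ θ) (hθ1 : θ < 1) {h : 𝒵 → Vec d} (hh : Measurable h)
    (hF : Forgetting p 𝒢 (fun t z z' => covError K θ t (fun r => h (z r)) fun r => h (z' r)) ρ)
    (hT : HasTransition p Y Z μ) (h𝒢 : ∀ᵐ ω ∂μ, path Z ω ∈ 𝒢)
    (hQ : μ.map (fun ω => (pastSeq (path Z ω) 0, futSeq (path Z ω))) =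
      μ.map (fun ω => pastSeq (path Z ω) 0) ⊗ₘ Q)
    (hQt : ∀ s, (Qt s).map Prod.fst = Q s.1 ∧ (Qt s).map Prod.snd = Q s.2)
    {m : ℝ≥0∞} (hm : m ≠ ∞) (hhm : ∀ t, ∫⁻ ω, ENNReal.ofReal ‖h (Z t ω)‖ ∂μ ≤ m)
    {a : ℕ → ℝ≥0∞} (ha : ∀ t : ℕ, 1 ≤ t → ∫⁻ zz, normCost (h (zz.1 t)) (h (zz.2 t))
      ∂(coupledLaw Qt (μ.map fun ω => pastSeq (path Z ω) 0)) = a t)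
    {r : ℝ} (hθr : θ < r) (hρr : ρ < r) {v : ℕ → ℝ}
    (hv : ∀ᶠ s in atTop, 0 < v s ∧ r * v s ≤ v (s + 1)) {n₀ : ℕ}
    (hva : ∀ m n, n₀ ≤ m → m ≤ n → v n ≤ v m) (hav : IsBigORate a v) :
    IsBigORate (tauCoeff (fun t ω => (Y t ω, h (Z t ω)))
      (fun ω => pastSeq (fun t => (Y t ω, Z t ω)) 0) μ) v := by
  have hZ := hT.measurable_exog
  have hZp : Measurable fun ω => pastSeq (path Z ω) 0 :=
    (measurable_pastSeq 0).comp (measurable_path hZ)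
  have hpr := Measure.isProbabilityMeasure_map (μ := μ) hZp.aemeasurable
  have hprc := isProbabilityMeasure_coupledLaw Qt (μ.map fun ω => pastSeq (path Z ω) 0)
  have hint : ∀ t, Integrable (fun ω => h (Z t ω)) μ := by
    intro t
    refine ⟨(hh.comp (hZ t)).aestronglyMeasurable, ?_⟩
    rw [hasFiniteIntegral_iff_norm]
    exact (hhm t).trans_lt hm.lt_top
  have hDO : IsBigORate (fun s : ℕ => ∫⁻ zz, normCost (h (zz.1 s)) (h (zz.2 s))
      ∂(coupledLaw Qt (μ.map fun ω => pastSeq (path Z ω) 0))) v :=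
    hav.mono_left (by filter_upwards [eventually_ge_atTop 1] with s hs using (ha s hs).le)
  let δ : ℤ → (ℤ → 𝒵) → (ℤ → 𝒵) → ℝ :=
    fun t z z' => covError K θ t (fun r => h (z r)) fun r => h (z' r)
  have hδm : ∀ t, Measurable fun zz : (ℤ → 𝒵) × (ℤ → 𝒵) => δ t zz.1 zz.2 :=
    measurable_covError_comp hh K θ
  have hδ : ∀ t (zz : (ℤ → 𝒵) × (ℤ → 𝒵)), ENNReal.ofReal (δ t zz.1 zz.2) ≤ ENNReal.ofReal K *
      ∑' i : ℕ, ENNReal.ofReal θ ^ i * normCost (h (zz.1 (t - i))) (h (zz.2 (t - i))) :=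
    fun t zz => ofReal_covError_le hK hθ0 t (fun r => h (zz.1 r)) fun r => h (zz.2 r)
  have hO : IsBigORate (fun s : ℕ => ∫⁻ zz, blockCost normCost h ρ δ s zz.1 zz.2
      ∂(coupledLaw Qt (μ.map fun ω => pastSeq (path Z ω) 0))) v :=
    isBigORate_lintegral_blockCost
      (D := fun t zz => normCost (h (zz.1 t)) (h (zz.2 t))) measurable_normCost hh hδm
      (fun t => measurable_cost_apply measurable_normCost hh t) ENNReal.ofReal_ne_top
      (ENNReal.add_ne_top.2 ⟨hm, hm⟩) hθ0 hθ1 hF.pos.le hθr hρr hδ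
      (lintegral_normCost_coupledLaw_le hZ hQ hQt hh hhm) hv hDO hDO
  refine isBigORate_tauCoeff hO hva fun ℓ J hJ => ?_
  refine (hF.tauBlock_le hT h𝒢 hQ hQt hh hδm hint hJ).trans_eq ?_
  refine Finset.sum_congr rfl fun i _ => ?_
  rw [Int.toNat_of_nonneg (by have := hJ i; omega)]

variable {p : ℤ → (ℕ → E) × (ℤ → Vec d) → E → ℝ} {X : ℤ → Ω → Vec d} {𝒢 : Set (ℤ → Vec d)}
  {K θ ρ : ℝ} {R : Kernel (ℕ → Vec d) (ℕ → Vec d)} [IsMarkovKernel R]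
  {Rt : Kernel ((ℕ → Vec d) × (ℕ → Vec d)) ((ℕ → Vec d) × (ℕ → Vec d))} [IsMarkovKernel Rt]

/-- Tail bound for `β` when the errors are dominated by costs `D` of order `v`. -/
lemma isBigORate_betaCoeff {δ : ℤ → (ℤ → Vec d) → (ℤ → Vec d) → ℝ}
    (hF : Forgetting p 𝒢 δ ρ) (hT : HasTransition p Y X μ) (h𝒢 : ∀ᵐ ω ∂μ, path X ω ∈ 𝒢)
    (hQ : μ.map (fun ω => (pastSeq (path X ω) 0, futSeq (path X ω))) =
      μ.map (fun ω => pastSeq (path X ω) 0) ⊗ₘ R)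
    (hQt : ∀ s, (Rt s).map Prod.fst = R s.1 ∧ (Rt s).map Prod.snd = R s.2)
    (hδm : ∀ t, Measurable fun zz : (ℤ → Vec d) × (ℤ → Vec d) => δ t zz.1 zz.2)
    {D : ℤ → (ℤ → Vec d) × (ℤ → Vec d) → ℝ≥0∞} (hDm : ∀ t, Measurable (D t)) {K M : ℝ≥0∞}
    (hK : K ≠ ∞) (hM : M ≠ ∞) {θ r : ℝ} (hθ0 : 0 ≤ θ) (hθ1 : θ < 1) (hθr : θ < r) (hρr : ρ < r)
    (hδ : ∀ t zz, ENNReal.ofReal (δ t zz.1 zz.2) ≤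
      K * ∑' i : ℕ, ENNReal.ofReal θ ^ i * D (t - i) zz)
    (hDM : ∀ t, ∫⁻ zz, D t zz ∂(coupledLaw Rt (μ.map fun ω => pastSeq (path X ω) 0)) ≤ M)
    {v w : ℕ → ℝ} (hv : ∀ᶠ s in atTop, 0 < v s ∧ r * v s ≤ v (s + 1))
    (ha : IsBigORate (fun s => ∫⁻ zz, discreteCost (zz.1 s) (zz.2 s)
      ∂(coupledLaw Rt (μ.map fun ω => pastSeq (path X ω) 0))) v)
    (hD : IsBigORate (fun s => ∫⁻ zz, D s zz
      ∂(coupledLaw Rt (μ.map fun ω => pastSeq (path X ω) 0))) v) {C : ℝ≥0∞} (hC : C ≠ ∞)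
    (hw : ∀ᶠ n in atTop, ∑' i : ℕ, ENNReal.ofReal (v (n + i)) ≤ C * ENNReal.ofReal (w n)) :
    IsBigORate (betaCoeff (fun t ω => (Y t ω, X t ω)) μ) w := by
  have hXp : Measurable fun ω => pastSeq (path X ω) 0 :=
    (measurable_pastSeq 0).comp (measurable_path hT.measurable_exog)
  have hpr := Measure.isProbabilityMeasure_map (μ := μ) hXp.aemeasurable
  have hprc := isProbabilityMeasure_coupledLaw Rt (μ.map fun ω => pastSeq (path X ω) 0)
  have hO := isBigORate_lintegral_blockCost measurable_discreteCost measurable_id hδm hDm hK hM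
    hθ0 hθ1 hF.pos.le hθr hρr hδ hDM hv ha hD
  refine hO.tsum ?_ hC hw
  filter_upwards [eventually_ge_atTop 1] with n hn
  refine (hF.betaCoeff_le hT h𝒢 hQ hQt hδm hn).trans_eq (tsum_congr fun i => ?_)
  push_cast
  rfl

lemma lintegral_norm_le_of_map_eq (hX : ∀ t, Measurable (X t))
    (hst : ∀ t, μ.map (X t) = μ.map (X 0)) (t : ℤ) :
    ∫⁻ ω, ENNReal.ofReal ‖X t ω‖ ∂μ ≤ ∫⁻ ω, ENNReal.ofReal ‖X 0 ω‖ ∂μ := by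
  have hn : Measurable fun x : Vec d => ENNReal.ofReal ‖x‖ := measurable_norm.ennreal_ofReal
  rw [← lintegral_map hn (hX t), hst, lintegral_map hn (hX 0)]

lemma map_apply_fst_coupledLaw (hX : ∀ t, Measurable (X t))
    (hQ : μ.map (fun ω => (pastSeq (path X ω) 0, futSeq (path X ω))) =
      μ.map (fun ω => pastSeq (path X ω) 0) ⊗ₘ R)
    (hQt : ∀ s, (Rt s).map Prod.fst = R s.1 ∧ (Rt s).map Prod.snd = R s.2) (t : ℤ) :
    (coupledLaw Rt (μ.map fun ω => pastSeq (path X ω) 0)).map (fun zz => zz.1 t) =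
      μ.map (X t) := by
  refine Measure.ext_of_lintegral _ fun f hf => ?_
  have hft : Measurable fun z : ℤ → Vec d => f (z t) := hf.comp (measurable_pi_apply t)
  have hm : Measurable fun zz : (ℤ → Vec d) × (ℤ → Vec d) => zz.1 t :=
    (measurable_pi_apply t).comp measurable_fst
  rw [lintegral_map hf hm, lintegral_map hf (hX t)]
  exact lintegral_coupledLaw_fst hX hQ hQt hft

lemma map_apply_snd_coupledLaw (hX : ∀ t, Measurable (X t))
    (hQ : μ.map (fun ω => (pastSeq (path X ω) 0, futSeq (path X ω))) =
      μ.map (fun ω => pastSeq (path X ω) 0) ⊗ₘ R)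
    (hQt : ∀ s, (Rt s).map Prod.fst = R s.1 ∧ (Rt s).map Prod.snd = R s.2) (t : ℤ) :
    (coupledLaw Rt (μ.map fun ω => pastSeq (path X ω) 0)).map (fun zz => zz.2 t) =
      μ.map (X t) := by
  refine Measure.ext_of_lintegral _ fun f hf => ?_
  have hft : Measurable fun z : ℤ → Vec d => f (z t) := hf.comp (measurable_pi_apply t)
  have hm : Measurable fun zz : (ℤ → Vec d) × (ℤ → Vec d) => zz.2 t :=
    (measurable_pi_apply t).comp measurable_snd
  rw [lintegral_map hf hm, lintegral_map hf (hX t)]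
  exact lintegral_coupledLaw_snd hX hQ hQt hft

lemma eLpNorm_sub_coupledLaw_le (hX : ∀ t, Measurable (X t))
    (hst : ∀ t, μ.map (X t) = μ.map (X 0))
    (hQ : μ.map (fun ω => (pastSeq (path X ω) 0, futSeq (path X ω))) =
      μ.map (fun ω => pastSeq (path X ω) 0) ⊗ₘ R)
    (hQt : ∀ s, (Rt s).map Prod.fst = R s.1 ∧ (Rt s).map Prod.snd = R s.2) (t : ℤ) {p : ℝ≥0∞}
    (hp : 1 ≤ p) :
    eLpNorm (fun zz : (ℤ → Vec d) × (ℤ → Vec d) => zz.1 t - zz.2 t) p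
      (coupledLaw Rt (μ.map fun ω => pastSeq (path X ω) 0)) ≤
        eLpNorm (X 0) p μ + eLpNorm (X 0) p μ := by
  have h1 : Measurable fun zz : (ℤ → Vec d) × (ℤ → Vec d) => zz.1 t :=
    (measurable_pi_apply t).comp measurable_fst
  have h2 : Measurable fun zz : (ℤ → Vec d) × (ℤ → Vec d) => zz.2 t :=
    (measurable_pi_apply t).comp measurable_snd
  have hid : ∀ ν : Measure (Vec d), AEStronglyMeasurable id ν := fun ν =>
    measurable_id.aestronglyMeasurable
  refine (eLpNorm_sub_le h1.aestronglyMeasurable h2.aestronglyMeasurable hp).trans_eq ?_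
  have h3 := eLpNorm_map_measure (p := p) (hid ((coupledLaw Rt
    (μ.map fun ω => pastSeq (path X ω) 0)).map fun zz => zz.1 t)) h1.aemeasurable
  have h4 := eLpNorm_map_measure (p := p) (hid ((coupledLaw Rt
    (μ.map fun ω => pastSeq (path X ω) 0)).map fun zz => zz.2 t)) h2.aemeasurable
  have h5 := eLpNorm_map_measure (p := p) (hid (μ.map (X 0))) (hX 0).aemeasurable
  rw [map_apply_fst_coupledLaw hX hQ hQt, hst, h5] at h3
  rw [map_apply_snd_coupledLaw hX hQ hQt, hst, h5] at h4
  exact congrArg₂ (· + ·) h3.symm h4.symm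

/-- The polynomial rate of `β`. -/
lemma isBigORate_betaCoeff_rpow (hK : 0 ≤ K) (hθ0 : 0 ≤ θ) (hθ1 : θ < 1)
    (hF : Forgetting p 𝒢 (covError K θ) ρ) (hT : HasTransition p Y X μ)
    (h𝒢 : ∀ᵐ ω ∂μ, path X ω ∈ 𝒢) (hst : ∀ t, μ.map (X t) = μ.map (X 0))
    (hQ : μ.map (fun ω => (pastSeq (path X ω) 0, futSeq (path X ω))) =
      μ.map (fun ω => pastSeq (path X ω) 0) ⊗ₘ R)
    (hQt : ∀ s, (Rt s).map Prod.fst = R s.1 ∧ (Rt s).map Prod.snd = R s.2)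
    {a : ℕ → ℝ≥0∞} (ha : ∀ t : ℕ, 1 ≤ t → ∫⁻ zz, discreteCost (zz.1 t) (zz.2 t)
      ∂(coupledLaw Rt (μ.map fun ω => pastSeq (path X ω) 0)) = a t)
    {s s' : ℝ≥0∞} (hss : s⁻¹ + s'⁻¹ = 1) (hLp : MemLp (X 0) s μ) {κ : ℝ}
    (hκ : s' < ENNReal.ofReal κ) (haκ : IsBigORate a fun i => (i : ℝ) ^ (-κ)) :
    IsBigORate (betaCoeff (fun t ω => (Y t ω, X t ω)) μ)
      fun n => (n : ℝ) ^ (-κ / s'.toReal + 1) := by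
  have hs1 : 1 ≤ s := by
    rw [← ENNReal.inv_le_one, ← hss]
    exact le_self_add
  have hs'1 : 1 ≤ s' := by
    rw [← ENNReal.inv_le_one, ← hss]
    exact le_add_self
  have hs'top : s' ≠ ∞ := hκ.ne_top
  set b := s'.toReal with hb
  have hb1 : 1 ≤ b := by
    rw [hb, ← ENNReal.toReal_one]
    exact ENNReal.toReal_mono hs'top hs'1
  have hb0 : 0 < b := by linarith
  have hbκ : b < κ := (ENNReal.lt_ofReal_iff_toReal_lt hs'top).1 hκ
  have hκb : 1 < κ / b := (one_lt_div hb0).2 hbκ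
  have hX := hT.measurable_exog
  -- Any `r` above both geometric rates and below one will do, since the polynomial rate is slower
  -- than `r ^ n`.
  obtain ⟨r, hr, hr1⟩ := exists_between (max_lt hθ1 hF.lt_one)
  have h1 : ∫⁻ ω, ENNReal.ofReal ‖X 0 ω‖ ∂μ ≠ ∞ := by
    have h2 := (hLp.integrable hs1).2
    rw [hasFiniteIntegral_iff_norm] at h2
    exact h2.ne
  have hm := lintegral_norm_le_of_map_eq hX hst
  have hpow : ∀ i : ℕ, ((i : ℝ) ^ (-κ)) ^ b⁻¹ = (i : ℝ) ^ (-(κ / b)) := fun i => by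
    rw [← Real.rpow_mul (Nat.cast_nonneg i)]
    congr 1
    ring
  have haO : IsBigORate (fun t : ℕ => ∫⁻ zz, discreteCost (zz.1 t) (zz.2 t)
      ∂(coupledLaw Rt (μ.map fun ω => pastSeq (path X ω) 0))) fun i => (i : ℝ) ^ (-κ) :=
    haκ.mono_left (by filter_upwards [eventually_ge_atTop 1] with t ht using (ha t ht).le)
  refine isBigORate_betaCoeff hF hT h𝒢 hQ hQt (measurable_covError K θ)
    (D := fun t zz => normCost (zz.1 t) (zz.2 t))
    (fun t => measurable_cost_apply measurable_normCost measurable_id t) ENNReal.ofReal_ne_top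
    (ENNReal.add_ne_top.2 ⟨h1, h1⟩) hθ0 hθ1 ((le_max_left _ _).trans_lt hr)
    ((le_max_right _ _).trans_lt hr) (fun t zz => ofReal_covError_le hK hθ0 t _ _)
    (lintegral_normCost_coupledLaw_le hX hQ hQt measurable_id hm)
    (v := fun i => (i : ℝ) ^ (-(κ / b))) (eventually_rpow_ratio hr1) ?_ ?_
    (C := ENNReal.ofReal ((κ / b - 1)⁻¹ * 2 ^ (κ / b - 1))) ENNReal.ofReal_ne_top ?_
  · refine haO.trans_le ?_
    filter_upwards [eventually_ge_atTop 1] with i hi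
    refine Real.rpow_le_rpow_of_exponent_le (by exact_mod_cast hi) (neg_le_neg ?_)
    exact div_le_self (by linarith) hb1
  -- Hölder's inequality: the mean distance is at most `2 ‖X 0‖_s` times `a_t ^ (1 / b)`, which
  -- gives the exponent `κ / b`.
  · have h3 := (haO.rpow (fun i => by positivity) (inv_nonneg.2 hb0.le)).const_mul
      (ENNReal.add_ne_top.2 ⟨hLp.2.ne, hLp.2.ne⟩)
    simp only [hpow] at h3
    refine h3.mono_left (Eventually.of_forall fun t => ?_)
    refine (lintegral_normCost_le ((measurable_pi_apply (t : ℤ)).comp measurable_fst)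
      ((measurable_pi_apply (t : ℤ)).comp measurable_snd) hss).trans ?_
    exact mul_le_mul_left (eLpNorm_sub_coupledLaw_le hX hst hQ hQt t hs1) _
  · filter_upwards [eventually_ge_atTop 2] with n hn
    have h4 := tsum_rpow_le hκb hn
    rwa [← neg_div] at h4 ⊢

/-- The geometric rate of `β`. -/
lemma exists_isBigORate_betaCoeff_pow (hK : 0 ≤ K) (hθ0 : 0 ≤ θ) (hθ1 : θ < 1)
    (hF : Forgetting p 𝒢 (covError K θ) ρ) (hT : HasTransition p Y X μ)
    (h𝒢 : ∀ᵐ ω ∂μ, path X ω ∈ 𝒢)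
    (hQ : μ.map (fun ω => (pastSeq (path X ω) 0, futSeq (path X ω))) =
      μ.map (fun ω => pastSeq (path X ω) 0) ⊗ₘ R)
    (hQt : ∀ s, (Rt s).map Prod.fst = R s.1 ∧ (Rt s).map Prod.snd = R s.2)
    {m : ℝ≥0∞} (hm : m ≠ ∞) (hXm : ∀ t, ∫⁻ ω, ENNReal.ofReal ‖X t ω‖ ∂μ ≤ m)
    {a : ℕ → ℝ≥0∞} (ha : ∀ t : ℕ, 1 ≤ t → ∫⁻ zz, discreteCost (zz.1 t) (zz.2 t)
      ∂(coupledLaw Rt (μ.map fun ω => pastSeq (path X ω) 0)) = a t)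
    {σ : ℝ} (hσ0 : 0 < σ) (hσ1 : σ < 1) (haσ : IsBigORate a fun i => σ ^ i) :
    ∃ σ' : ℝ, 0 < σ' ∧ σ' < 1 ∧
      IsBigORate (betaCoeff (fun t ω => (Y t ω, X t ω)) μ) fun n => σ' ^ n := by
  have hX := hT.measurable_exog
  have hsq : ∀ {x : ℝ}, 0 ≤ x → x < 1 → √x < 1 := fun h0 h1 => by
    rw [Real.sqrt_lt' one_pos]
    simpa using h1
  have hXp : Measurable fun ω => pastSeq (path X ω) 0 :=
    (measurable_pastSeq 0).comp (measurable_path hX)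
  have hpr := Measure.isProbabilityMeasure_map (μ := μ) hXp.aemeasurable
  have hprc := isProbabilityMeasure_coupledLaw Rt (μ.map fun ω => pastSeq (path X ω) 0)
  -- The final rate must exceed `√θ` and `ρ`, the rates of the two recursions, and `√σ`, the decay
  -- of the root costs.
  obtain ⟨r, hr, hr1⟩ := exists_between
    (max_lt (max_lt (hsq hθ0 hθ1) hF.lt_one) (hsq hσ0.le hσ1))
  have hrθ : √θ < r := ((le_max_left _ _).trans (le_max_left _ _)).trans_lt hr
  have hrρ : ρ < r := ((le_max_right _ _).trans (le_max_left _ _)).trans_lt hr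
  have hrσ : √σ < r := (le_max_right _ _).trans_lt hr
  have hr0 : 0 < r := hF.pos.trans hrρ
  have hσσ : σ ≤ √σ := Real.le_sqrt_of_sq_le (by nlinarith)
  have haO : IsBigORate (fun t : ℕ => ∫⁻ zz, discreteCost (zz.1 t) (zz.2 t)
      ∂(coupledLaw Rt (μ.map fun ω => pastSeq (path X ω) 0))) fun i => σ ^ i :=
    haσ.mono_left (by filter_upwards [eventually_ge_atTop 1] with t ht using (ha t ht).le)
  have hM := lintegral_normCost_coupledLaw_le hX hQ hQt measurable_id hXm
  have hDm : ∀ t, Measurable fun zz : (ℤ → Vec d) × (ℤ → Vec d) => normCost (zz.1 t) (zz.2 t) :=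
    fun t => measurable_cost_apply measurable_normCost measurable_id t
  -- The costs `D` are square roots of the distances, so a first moment suffices and the conjugate
  -- exponent plays no role.
  refine ⟨r, hr0, hr1, isBigORate_betaCoeff hF hT h𝒢 hQ hQt (measurable_covError K θ)
    (D := fun t zz => normCost (zz.1 t) (zz.2 t) ^ (1 / 2 : ℝ))
    (fun t => (hDm t).pow_const _) (M := ((m + m) * 1) ^ (1 / 2 : ℝ))
    (ENNReal.rpow_ne_top_of_nonneg (by norm_num) ENNReal.ofReal_ne_top)
    (ENNReal.rpow_ne_top_of_nonneg (by norm_num)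
      (ENNReal.mul_ne_top (ENNReal.add_ne_top.2 ⟨hm, hm⟩) ENNReal.one_ne_top))
    (Real.sqrt_nonneg θ) (hsq hθ0 hθ1) hrθ hrρ (fun t zz => ofReal_covError_le_sqrt hK hθ0 t _ _)
    (fun t => ?_) (v := fun i => r ^ i) (Eventually.of_forall fun i => ⟨by positivity, ?_⟩) ?_ ?_
    (C := (1 - ENNReal.ofReal r)⁻¹)
    (ENNReal.inv_ne_top.2 (tsub_pos_of_lt (ENNReal.ofReal_lt_one.2 hr1)).ne')
    (Eventually.of_forall fun n => (tsum_ofReal_pow hr0.le n).le)⟩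
  · refine (lintegral_sqrt_normCost_le ((measurable_pi_apply t).comp measurable_fst)
      ((measurable_pi_apply t).comp measurable_snd)).trans ?_
    refine ENNReal.rpow_le_rpow (mul_le_mul' (hM t) ?_) (by norm_num)
    rw [lintegral_discreteCost ((measurable_pi_apply t).comp measurable_fst)
      ((measurable_pi_apply t).comp measurable_snd)]
    exact prob_le_one
  · rw [pow_succ']
  · refine haO.trans_le (Eventually.of_forall fun i => ?_)
    exact pow_le_pow_left₀ hσ0.le (hσσ.trans hrσ.le) i
  · have h3 := (haO.const_mul (ENNReal.add_ne_top.2 ⟨hm, hm⟩)).rpow (r := 1 / 2)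
      (fun i => by positivity) (by norm_num)
    refine (h3.mono_left (Eventually.of_forall fun t => ?_)).trans_le
      (Eventually.of_forall fun i => ?_)
    · refine (lintegral_sqrt_normCost_le ((measurable_pi_apply (t : ℤ)).comp measurable_fst)
        ((measurable_pi_apply (t : ℤ)).comp measurable_snd)).trans ?_
      refine ENNReal.rpow_le_rpow ?_ (by norm_num)
      gcongr
      exact hM t
    · rw [← Real.sqrt_eq_rpow, Real.sqrt_eq_rpow, ← Real.rpow_natCast, ← Real.rpow_natCast,
        ← Real.rpow_mul hσ0.le, mul_comm, Real.rpow_mul hσ0.le, ← Real.sqrt_eq_rpow]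
      exact Real.rpow_le_rpow (Real.sqrt_nonneg σ) hrσ.le (Nat.cast_nonneg i)

/-- The memory loss of the model with stationary integrable covariates. -/
lemma exists_forgetting_of_integrable {Λ : Type*} [NormedAddCommGroup Λ] [NormedSpace ℝ Λ]
    [FiniteDimensional ℝ Λ] [MeasurableSpace Λ] [BorelSpace Λ] {X : ℤ → Ω → Vec d}
    {G : E → Vec d → Λ → Λ} (hG : IsContractiveFamily G) {q : Λ → E → ℝ} (hq : IsLipschitzKernel q)
    (hX : ∀ t, Measurable (X t)) (hst : ∀ t, μ.map (X t) = μ.map (X 0))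
    (hint : Integrable (X 0) μ) (hb : HasUniformOverlap q G X μ) {lam : ℤ → Ω → Λ}
    (hlam_meas : ∀ t, Measurable (lam t)) (hlam_stat : IsStationary lam μ)
    (hlam : ∀ t, ∀ᵐ ω ∂μ, lam t ω = G (Y (t - 1) ω) (X t ω) (lam (t - 1) ω)) :
    ∃ (K θ ρ : ℝ) (𝒢 : Set (ℤ → Vec d)) (m : ℝ≥0∞),
      0 ≤ K ∧ 0 ≤ θ ∧ θ < 1 ∧ m ≠ ∞ ∧ (∀ t, ∫⁻ ω, ENNReal.ofReal ‖X t ω‖ ∂μ ≤ m) ∧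
      Forgetting (respProb q G) 𝒢 (covError K θ) ρ ∧ (∀ᵐ ω ∂μ, path X ω ∈ 𝒢) ∧
      ∀ t, ∀ᵐ ω ∂μ,
        lam t ω = latent G (pastSeq (path Y ω) (t - 1)) (pastSeq (path X ω) t) := by
  obtain ⟨K, C, θ, ρ, hK, hC, hθ0, hθ1, hcon, hlim, D, hD, hF⟩ := exists_forgetting hG hq hb
  have hm : ∫⁻ ω, ENNReal.ofReal ‖X 0 ω‖ ∂μ ≠ ∞ :=
    ((hasFiniteIntegral_iff_norm _).1 hint.2).ne
  have hXb := lintegral_norm_le_of_map_eq hX hst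
  have hsum := ae_mem_summablePaths hX hθ0 hθ1 hm hXb
  -- The good paths lie in the overlap set and are summable; both properties hold almost surely.
  refine ⟨K, θ, ρ, _, _, hK, hθ0.le, hθ1, hm, hXb, hF, ?_, ?_⟩
  · filter_upwards [hD, hsum] with ω h1 h2 using ⟨h1, h2⟩
  · exact lam_eq_latent hC hθ0 hθ1 hcon hlim hsum hlam_meas hlam_stat hlam

end Coefficients

end ObsDriven

end

/-! ### The two statements on `β` and `τ` -/

open ObsDriven in
theorem corollary2
    {Ω : Type*} [MeasurableSpace Ω] (μ : Measure Ω) [IsProbabilityMeasure μ]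
    {E : Type*} [Fintype E] [Nonempty E] [DecidableEq E] [MeasurableSpace E]
    [DiscreteMeasurableSpace E]
    {d : ℕ}
    {Λ : Type*} [NormedAddCommGroup Λ] [NormedSpace ℝ Λ] [FiniteDimensional ℝ Λ]
    [MeasurableSpace Λ] [BorelSpace Λ]
    {𝒮 : Type*} [TopologicalSpace 𝒮] [PolishSpace 𝒮] [MeasurableSpace 𝒮] [BorelSpace 𝒮]
    -- the stationary Markov chain `S` and the stationary ergodic covariate process `X = g(S)`
    (S : ℤ → Ω → 𝒮) (hS_meas : ∀ t, Measurable (S t))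
    (P : Kernel 𝒮 (ℕ → 𝒮)) [IsMarkovKernel P]
    (hS_stat : IsStationary S μ) (hS_markov : IsMarkovChain S P μ)
    (g : 𝒮 → Vec d) (hg : Measurable g)
    (X : ℤ → Ω → Vec d) (hX : ∀ t ω, X t ω = g (S t ω))
    (hX_erg : IsStationaryErgodic X μ)
    (hX_log : Integrable (fun ω => Real.posLog ‖X 1 ω‖) μ)
    -- the observation-driven model
    (G : E → Vec d → Λ → Λ) (hG : IsContractiveFamily G)
    (q : Λ → E → ℝ) (hq : IsLipschitzKernel q)
    (hb : HasUniformOverlap q G X μ)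
    (Y : ℤ → Ω → E) (hY_meas : ∀ t, Measurable (Y t))
    (lam : ℤ → Ω → Λ) (hlam_meas : ∀ t, Measurable (lam t)) (hlam_stat : IsStationary lam μ)
    (hlam : ∀ t, ∀ᵐ ω ∂μ, lam t ω = G (Y (t - 1) ω) (X t ω) (lam (t - 1) ω))
    (hY : HasConditionalLaw q lam Y X μ)
    (V : ℤ → Ω → E × Vec d) (hV : ∀ t ω, V t ω = (Y t ω, X t ω)) :
    -- discrete metric: absolute regularity
    (∀ (Pt : Kernel (𝒮 × 𝒮) ((ℕ → 𝒮) × (ℕ → 𝒮))) [IsMarkovKernel Pt], IsPathCoupling P Pt →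
      ∀ a : ℕ → ℝ≥0∞, a = couplingRate discreteCost g (μ.map (S 0)) Pt →
      Tendsto a atTop (𝓝 0) →
      ∀ p p' : ℝ≥0∞, p⁻¹ + p'⁻¹ = 1 → MemLp (X 0) p μ →
        (∀ κ : ℝ, p' < ENNReal.ofReal κ → IsBigORate a (fun i => (i : ℝ) ^ (-κ)) →
          IsBigORate (betaCoeff V μ) (fun n => (n : ℝ) ^ (-κ / p'.toReal + 1)) ∧
          Tendsto (betaCoeff V μ) atTop (𝓝 0)) ∧
        (∀ ρ : ℝ, 0 < ρ → ρ < 1 → IsBigORate a (fun i => ρ ^ i) →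
          ∃ ρ' : ℝ, 0 < ρ' ∧ ρ' < 1 ∧ IsBigORate (betaCoeff V μ) (fun n => ρ' ^ n))) ∧
    -- `ℓ¹` metric: `τ`-dependence, with `ℱ₀ = σ(V_j : j ≤ 0)` and, if `Y` is strictly exogenous
    -- relative to the chain `S`, also with the larger `ℱ₀ = σ((Y_j, S_j) : j ≤ 0)`
    (∀ (Pt : Kernel (𝒮 × 𝒮) ((ℕ → 𝒮) × (ℕ → 𝒮))) [IsMarkovKernel Pt], IsPathCoupling P Pt →
      ∀ a : ℕ → ℝ≥0∞, a = couplingRate normCost g (μ.map (S 0)) Pt →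
      Tendsto a atTop (𝓝 0) → Integrable (X 0) μ →
        (∀ κ : ℝ, 1 < κ → IsBigORate a (fun i => (i : ℝ) ^ (-κ)) →
          IsBigORate (tauCoeff V (fun ω => pastSeq (path V ω) 0) μ)
            (fun n => (n : ℝ) ^ (-κ)) ∧
          (HasConditionalLaw q lam Y S μ →
            IsBigORate (tauCoeff V (fun ω => pastSeq (fun t => (Y t ω, S t ω)) 0) μ)
              (fun n => (n : ℝ) ^ (-κ)))) ∧
        (∀ ρ : ℝ, 0 < ρ → ρ < 1 → IsBigORate a (fun i => ρ ^ i) →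
          ∃ ρ' : ℝ, 0 < ρ' ∧ ρ' < 1 ∧
            IsBigORate (tauCoeff V (fun ω => pastSeq (path V ω) 0) μ) (fun n => ρ' ^ n) ∧
            (HasConditionalLaw q lam Y S μ →
              IsBigORate (tauCoeff V (fun ω => pastSeq (fun t => (Y t ω, S t ω)) 0) μ)
                (fun n => ρ' ^ n)))) := by
  obtain rfl : V = fun t ω => (Y t ω, X t ω) := by
    funext t ω
    exact hV t ω
  have hXm : ∀ t, Measurable (X t) := fun t => by
    have : X t = g ∘ S t := funext (hX t)
    rw [this]
    exact hg.comp (hS_meas t)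
  have hst : ∀ t, μ.map (X t) = μ.map (X 0) :=
    map_eq_of_isStationary hXm hX_erg.toMeasurePreserving
  have setup := fun hint : Integrable (X 0) μ =>
    exists_forgetting_of_integrable hG hq hXm hst hint hb hlam_meas hlam_stat hlam
  constructor
  · intro Pt _ hPt a ha _ p p' hpp hLp
    have hp1 : 1 ≤ p := by
      rw [← ENNReal.inv_le_one, ← hpp]
      exact le_self_add
    obtain ⟨K, θ, ρ, 𝒢, m, hK, hθ0, hθ1, hm, hXb, hF, h𝒢, hlat⟩ := setup (hLp.integrable hp1)
    have hT : HasTransition (respProb q G) Y X μ :=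
      hasTransition_respProb_covariate hq hG hY_meas hXm hlat hY
    obtain ⟨R, Rt, _, _, hQ, hQt, hrate⟩ := exists_coupling_covariate hS_meas hS_markov hPt hg hX
    have ha' := fun (t : ℕ) (ht : 1 ≤ t) =>
      (hrate discreteCost measurable_discreteCost t ht).trans (congrFun ha t).symm
    refine ⟨fun κ hκ haκ => ?_, fun σ hσ0 hσ1 haσ => ?_⟩
    · have hO := isBigORate_betaCoeff_rpow hK hθ0 hθ1 hF hT h𝒢 hst hQ hQt ha' hpp hLp hκ haκ
      refine ⟨hO, hO.tendsto_zero ?_⟩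
      have hp'1 : 1 ≤ p' := by
        rw [← ENNReal.inv_le_one, ← hpp]
        exact le_add_self
      have hb0 : 0 < p'.toReal := ENNReal.toReal_pos (by positivity) hκ.ne_top
      have hb1 : 1 < κ / p'.toReal :=
        (one_lt_div hb0).2 ((ENNReal.lt_ofReal_iff_toReal_lt hκ.ne_top).1 hκ)
      -- Absolute regularity holds because `κ / p' > 1` makes the exponent of the rate negative.
      have h1 := (tendsto_rpow_neg_atTop (sub_pos.2 hb1)).comp tendsto_natCast_atTop_atTop
      refine h1.congr fun n => ?_
      simp only [Function.comp_apply]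
      congr 1
      ring
    · exact exists_isBigORate_betaCoeff_pow hK hθ0 hθ1 hF hT h𝒢 hQ hQt hm hXb ha' hσ0 hσ1 haσ
  · intro Pt _ hPt a ha _ hint
    obtain ⟨K, θ, ρ, 𝒢, m, hK, hθ0, hθ1, hm, hXb, hF, h𝒢, hlat⟩ := setup hint
    have hT : HasTransition (respProb q G) Y X μ :=
      hasTransition_respProb_covariate hq hG hY_meas hXm hlat hY
    have hgXS : X = fun t ω => g (S t ω) := by
      funext t ω
      exact hX t ω
    -- both choices of the past at once, for an arbitrary slowly varying rate
    have key : ∀ (r : ℝ) (v : ℕ → ℝ) (n₀ : ℕ), θ < r → ρ < r →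
        (∀ᶠ s in atTop, 0 < v s ∧ r * v s ≤ v (s + 1)) →
        (∀ m n, n₀ ≤ m → m ≤ n → v n ≤ v m) → IsBigORate a v →
        IsBigORate (tauCoeff (fun t ω => (Y t ω, X t ω))
          (fun ω => pastSeq (path (fun t ω => (Y t ω, X t ω)) ω) 0) μ) v ∧
        (HasConditionalLaw q lam Y S μ → IsBigORate (tauCoeff (fun t ω => (Y t ω, X t ω))
          (fun ω => pastSeq (fun t => (Y t ω, S t ω)) 0) μ) v) := by
      intro r v n₀ hθr hρr hv hva hav
      constructor
      · obtain ⟨R, Rt, _, _, hQ, hQt, hrate⟩ :=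
          exists_coupling_covariate hS_meas hS_markov hPt hg hX
        have ha' := fun (t : ℕ) (ht : 1 ≤ t) =>
          (hrate normCost measurable_normCost t ht).trans (congrFun ha t).symm
        exact isBigORate_tauCoeff_of_coupling hK hθ0 hθ1 measurable_id hF hT h𝒢 hQ hQt hm hXb ha'
          hθr hρr hv hva hav
      · intro hYS
        -- The chain `S` is now the exogenous process: its future is coupled directly from its
        -- present state, and the covariates enter through `g` only.
        have hTS := hasTransition_respProb hq hG hY_meas hS_meas hg hX hlat hYS
        obtain ⟨R, Rt, _, _, hQ, hQt, hrate⟩ := exists_coupling_chain hS_meas hS_markov hPt hg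
        have ha' := fun (t : ℕ) (ht : 1 ≤ t) =>
          (hrate normCost measurable_normCost t ht).trans (congrFun ha t).symm
        have hXb' : ∀ t, ∫⁻ ω, ENNReal.ofReal ‖g (S t ω)‖ ∂μ ≤ m := fun t => by
          simpa only [hX] using hXb t
        have h𝒢' : ∀ᵐ ω ∂μ, path S ω ∈ (fun (z : ℤ → 𝒮) r => g (z r)) ⁻¹' 𝒢 := by
          filter_upwards [h𝒢] with ω hω
          have h1 : path X ω = fun r => g (path S ω r) := funext fun r => hX r ω
          rw [h1] at hω
          exact hω
        rw [hgXS]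
        exact isBigORate_tauCoeff_of_coupling hK hθ0 hθ1 hg (hF.comap hg) hTS h𝒢' hQ hQt hm hXb'
          ha' hθr hρr hv hva hav
    refine ⟨fun κ hκ haκ => ?_, fun σ hσ0 hσ1 haσ => ?_⟩
    · obtain ⟨r, hr, hr1⟩ := exists_between (max_lt hθ1 hF.lt_one)
      -- Monotonicity starts at `1` because the real power `0 ^ (-κ)` has the value `0`.
      refine key r _ 1 ((le_max_left _ _).trans_lt hr) ((le_max_right _ _).trans_lt hr)
        (eventually_rpow_ratio hr1) (fun i j hi hij => ?_) haκ
      exact Real.rpow_le_rpow_of_nonpos (by exact_mod_cast hi) (by exact_mod_cast hij)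
        (by linarith)
    -- Here `r` itself becomes the rate, so it must also exceed `σ`.
    · obtain ⟨r, hr, hr1⟩ := exists_between (max_lt (max_lt hθ1 hF.lt_one) hσ1)
      have hrθ : θ < r := ((le_max_left _ _).trans (le_max_left _ _)).trans_lt hr
      have hrρ : ρ < r := ((le_max_right _ _).trans (le_max_left _ _)).trans_lt hr
      have hr0 : 0 < r := hF.pos.trans hrρ
      refine ⟨r, hr0, hr1, key r _ 0 hrθ hrρ
        (Eventually.of_forall fun i => ⟨by positivity, by rw [pow_succ']⟩)
        (fun i j _ hij => pow_le_pow_of_le_one hr0.le hr1.le hij)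
        (haσ.trans_le (Eventually.of_forall fun i => ?_))⟩
      exact pow_le_pow_left₀ hσ0.le ((le_max_right _ _).trans_lt hr).le i
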